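/- **Theorem (Abstraction Theorem for the weak IsoRel translation).** Let $\Gamma$ be a context and $a,B$ terms of CoC$^-$. If $\Gamma$ is a capture-safe context, $a$ and $B$ are capture-safe in $\Gamma$, and $\Gamma\vdash a:B$ in CoC$^-$, then in CIC (with proof irrelevance and dependent function extensionality as axioms) $$[\![\Gamma]\!]\vdash a:B,\qquad [\![\Gamma]\!]\vdash a':B',\qquad [\![\Gamma]\!]\vdash [\![a]\!] : (\mathrm{proj}_B\,[\![B]\!])\;a\;a'.$$ *CoC$^-$.* The universes are $\mathsf{Prop}$ and $\mathsf{Type}_i$ ($i\ge 0$), with $\mathsf{Set}=\mathsf{Type}_0$. Terms are $x\mid s\mid \forall_{fg}x{:}A.B\mid\lambda_f x{:}A.b\mid M\,N$, with flags $f,g\in\{S,P,T\}$ that record whether the domain (and the codomain) is in $\mathsf{Set}$, $\mathsf{Prop}$ or some $\mathsf{Type}_i$, $i>0$. A product $\forall_{fg}$ counts as being in $\mathsf{Prop}$ if $fg\in\{SP,PP\}$, in $\mathsf{Set}$ if $fg\in\{SS,PS\}$, and in a higher universe otherwise. The typing rules, up to renaming of bound variables and with the flags as just said, are: $\vdash\mathsf{Prop}:\mathsf{Type}_1$;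 $\vdash\mathsf{Type}_i:\mathsf{Type}_{i+1}$; the start and weakening rules for fresh variables; from $\Gamma\vdash A:\mathsf{Type}_i$ and $\Gamma,x{:}A\vdash B:\mathsf{Type}_i$ infer $\Gamma\vdash\forall x{:}A.B:\mathsf{Type}_i$; from $\Gamma\vdash A:s$ with $s\in\{\mathsf{Set},\mathsf{Prop}\}$ and $\Gamma,x{:}A\vdash B:\mathsf{Prop}$ infer $\Gamma\vdash\forall x{:}A.B:\mathsf{Prop}$; from $\Gamma\vdash M:\forall x{:}A.B$ and $\Gamma\vdash N:A$ infer $\Gamma\vdash M\,N:B[N/x]$; from $\Gamma,x{:}A\vdash b:C$ infer $\Gamma\vdash\lambda x{:}A.b:\forall x{:}A.C$; from $\Gamma\vdash A:C$, $\Gamma\vdash B:s$ and $B\equiv_\Gamma C$ infer $\Gamma\vdash A:B$; from $\Gamma\vdash A:B$ and $B<:C$ infer $\Gamma\vdash A:C$. Here $<:$ is generated by $\mathsf{Type}_i<:\mathsf{Type}_j$ for $0<i<j$ and by $A<:B\Rightarrow\forall x{:}C.A<:\forall x{:}C.B$ (so neither $\mathsf{Prop}<:\mathsf{Set}$ nor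 $\mathsf{Set}<:\mathsf{Type}_1$), and $\equiv_\Gamma$ is $\beta$-equivalence through terms that are capture-safe in $\Gamma$ (extended by the variables of the binders passed); substitution first renames the bound variables so as to preserve capture safety. *Capture safety.* There are five disjoint classes of variables, and injections $x\mapsto x',x_R,x_4,x_5$ of the first class into the other four; $c$ is a reserved variable of the first class. A term $t$ is capture-safe in $\Gamma$ if all its variables are of the first class and different from $c$, its free variables are declared in $\Gamma$, its bound variables are not declared in $\Gamma$, and in each subterm $\forall x{:}A.B$ or $\lambda x{:}A.B$ the variable $x$ is bound neither in $A$ nor in $B$. A context is capture-safe if its variables are of the first class and different from $c$ and each of its types is capture-safe in the preceding part. *The translation.* $t'$ is $t$ with every variable $x$ replaced by $x'$. For $A,A':\mathsf{Set}$ and $R:A\to A'\to\mathsf{Prop}$, $\mathrm{Total}\,R$ is $(\forall a,\{b\ \&\ R\,a\,b\})\times(\forall b,\{a\ \&\ R\,a\,b\})$, $\mathrm{OneToOne}\,R$ says that $R\,a\,b_1,R\,a\,b_2$ imply $b_1=b_2$ and that $R\,a_1\,b,R\,a_2\,b$ imply $a_1=a_2$, and $\mathrm{IsoRel}\,A\,A'=\{R:A\to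 A'\to\mathsf{Prop}\ \&\ \mathrm{Total}\,R\times\mathrm{OneToOne}\,R\}$, with first projection $\mathrm{projRel}\,A\,A'$. For a type $A$, $\mathrm{proj}_A\,t$ is $\mathrm{projRel}\,A\,A'\,t$ if $A$ is in $\mathsf{Set}$ or $\mathsf{Prop}$, and $t$ otherwise. Then - $[\![s]\!]=\lambda(c\,c':s).\,\mathrm{IsoRel}\,c\,c'$ for $s\in\{\mathsf{Prop},\mathsf{Set}\}$, and $[\![\mathsf{Type}_i]\!]=\lambda(c\,c':\mathsf{Type}_i).\,c\to c'\to\mathsf{Type}_i$ for $i>0$; - $[\![x]\!]=x_R$, $\ [\![M\,N]\!]=[\![M]\!]\,N\,N'\,[\![N]\!]$, $\ [\![\lambda x{:}A.b]\!]=\lambda(x{:}A)(x'{:}A')(x_R:\mathrm{proj}_A[\![A]\!]\,x\,x').\,[\![b]\!]$; - $[\![\forall_{fg}x{:}A.B]\!]=\mathrm{piProp}\;A\;A'\;[\![A]\!]\;(\lambda x{:}A.B)\;(\lambda x'{:}A'.B')\;(\lambda(x{:}A)(x'{:}A')(x_R:\mathrm{proj}_A[\![A]\!]\,x\,x').[\![B]\!])$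 if $fg\in\{SP,PP\}$, the same with $\mathrm{piSet}$ if $fg\in\{SS,PS\}$, and $\lambda(x_4:\forall x{:}A.B)(x_5:\forall x'{:}A'.B').\,\forall(x{:}A)(x'{:}A')(x_R:\mathrm{proj}_A[\![A]\!]\,x\,x').\,(\mathrm{proj}_B[\![B]\!])\,(x_4\,x)\,(x_5\,x')$ otherwise; - $[\![\langle\rangle]\!]=\langle\rangle$ and $[\![\Gamma,x{:}A]\!]=[\![\Gamma]\!],\,x{:}A,\,x'{:}A',\,x_R:\mathrm{proj}_A[\![A]\!]\,x\,x'$. Here $\mathrm{piProp}$ and $\mathrm{piSet}$ are the closed terms of CIC that send $A_1,A_2:\mathsf{Set}$, $A_R:\mathrm{IsoRel}\,A_1\,A_2$, $B_i:A_i\to s$ (with $s=\mathsf{Prop}$ and $s=\mathsf{Set}$, respectively) and $B_R:\forall a_1\,a_2,\ \pi_1A_R\,a_1\,a_2\to\mathrm{IsoRel}\,(B_1a_1)\,(B_2a_2)$ to the relation $\lambda f_1\,f_2.\,\forall a_1\,a_2\,(p:\pi_1A_R\,a_1\,a_2),\ \pi_1(B_R\,a_1\,a_2\,p)\,(f_1a_1)\,(f_2a_2)$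 between $\forall a{:}A_1.\,B_1a$ and $\forall a{:}A_2.\,B_2a$, paired with proof terms of its $\mathrm{Total}$ and $\mathrm{OneToOne}$ properties. -/

import Mathlib

namespace WeakIsoRel

/-! ## Sorts, flags and variables -/

/-- The universes `Prop` and `Type i`; `Type 0` is `Set`. -/
inductive Srt : Type
  | prop : Srt
  | type (i : ℕ) : Srt

/-- The universe flags: `S` for `Set`, `P` for `Prop`, `T` for `Type i` with `0 < i`. -/
inductive Flag : Type
  | S : Flag
  | P : Flag
  | T : Flag

/-- The flag of a universe. -/
def Srt.flag : Srt → Flag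
  | .prop => .P
  | .type 0 => .S
  | .type (_ + 1) => .T

/-- The universe of a product `∀ x : A, B`, as indicated by the universes of `A` and of `B`:
`Prop` for `SP`, `PP`, `Set` for `SS`, `PS`, and a higher one (no bundling) otherwise. -/
def Flag.prod : Flag → Flag → Flag
  | .S, .P => .P
  | .P, .P => .P
  | .S, .S => .S
  | .P, .S => .S
  | _, _ => .T

/-- Variables of the input language, that is, variables of the first class. -/
abbrev Name : Type := ℕ

/-- The variable of the first class that is reserved for the translation of universes. -/
def c : Name := 0

/-- Variables of the output language: the five disjoint classes, with the four injections
`x ↦ x'`, `x ↦ x_R`, `x ↦ x₄`, `x ↦ x₅` from the first class into the others, together with an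
anonymous binder, for non-dependent arrows. -/
inductive Var : Type
  | one (x : Name) : Var
  | prime (x : Name) : Var
  | rel (x : Name) : Var
  | four (x : Name) : Var
  | five (x : Name) : Var
  | anon : Var
  deriving DecidableEq

/-! ## The source calculus CoC⁻ -/

/-- Raw terms of CoC⁻ with explicit variable names. Products carry the flags of domain and
codomain, abstractions the flag of the domain. -/
inductive Term : Type
  | var (x : Name) : Term
  | sort (s : Srt) : Term
  | pi (f g : Flag) (x : Name) (A B : Term) : Term
  | lam (f : Flag) (x : Name) (A b : Term) : Term
  | app (M N : Term) : Term

namespace Term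

/-- Free variables. -/
def fv : Term → Finset Name
  | var x => {x}
  | sort _ => ∅
  | pi _ _ x A B => fv A ∪ (fv B).erase x
  | lam _ x A b => fv A ∪ (fv b).erase x
  | app M N => fv M ∪ fv N

/-- Bound variables (all variables at a binder, whether or not they are used). -/
def bv : Term → Finset Name
  | var _ => ∅
  | sort _ => ∅
  | pi _ _ x A B => insert x (bv A ∪ bv B)
  | lam _ x A b => insert x (bv A ∪ bv b)
  | app M N => bv M ∪ bv N

/-- All variables. -/
def vars (t : Term) : Finset Name := fv t ∪ bv t

/-- No shadowing: the variable at a binder is not a bound variable of its scope, and not one of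
its domain either. -/
def NoShadow : Term → Prop
  | var _ => True
  | sort _ => True
  | pi _ _ x A B => x ∉ bv A ∧ x ∉ bv B ∧ NoShadow A ∧ NoShadow B
  | lam _ x A b => x ∉ bv A ∧ x ∉ bv b ∧ NoShadow A ∧ NoShadow b
  | app M N => NoShadow M ∧ NoShadow N

/-- Two variables denote the same thing under a list of pairs of binders, innermost first. -/
def AlphaVar : List (Name × Name) → Name → Name → Prop
  | [], x, y => x = y
  | (a, b) :: l, x, y => (x = a ∧ y = b) ∨ (x ≠ a ∧ y ≠ b ∧ AlphaVar l x y)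

/-- `α`-equivalence under a list of pairs of binders, innermost first. -/
def AlphaIn : List (Name × Name) → Term → Term → Prop
  | l, var x, var y => AlphaVar l x y
  | _, sort s, sort s' => s = s'
  | l, pi f g x A B, pi f' g' x' A' B' =>
      f = f' ∧ g = g' ∧ AlphaIn l A A' ∧ AlphaIn ((x, x') :: l) B B'
  | l, lam f x A b, lam f' x' A' b' =>
      f = f' ∧ AlphaIn l A A' ∧ AlphaIn ((x, x') :: l) b b'
  | l, app M N, app M' N' => AlphaIn l M M' ∧ AlphaIn l N N'
  | _, _, _ => False

/-- `α`-equivalence. -/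
def Alpha (t u : Term) : Prop := AlphaIn [] t u

/-- Naive structural substitution of `u` for `x`, without any renaming. -/
def unsafeSubst (x : Name) (u : Term) : Term → Term
  | var y => if y = x then u else var y
  | sort s => sort s
  | pi f g y A B =>
      pi f g y (unsafeSubst x u A) (if y = x then B else unsafeSubst x u B)
  | lam f y A b =>
      lam f y (unsafeSubst x u A) (if y = x then b else unsafeSubst x u b)
  | app M N => app (unsafeSubst x u M) (unsafeSubst x u N)

end Term

open Term

/-- Capture safety of `t` in a context that binds the variables `l`. That all variables are of the
first class holds by the choice of the type `Name`. -/
def BC (l : List Name) (t : Term) : Prop :=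
  (∀ x ∈ bv t, x ∉ l) ∧ NoShadow t ∧ (∀ x ∈ fv t, x ∈ l) ∧ c ∉ vars t

/-- `r` is a result of the safe substitution of `t` for `x` in `b`, in a context that binds `l`:
`b` is first renamed to `b'` whose bound variables avoid all variables of `t` and which is safe
under `x :: l`, and then the naive substitution is performed. -/
def SafeSubst (l : List Name) (b : Term) (x : Name) (t r : Term) : Prop :=
  ∃ b' : Term, Alpha b b' ∧ Disjoint (bv b') (vars t) ∧ BC (x :: l) b' ∧ r = unsafeSubst x t b'

/-- One step of `β`-reduction in a context that binds `l`, at any position. -/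
inductive Step : List Name → Term → Term → Prop
  | beta {l f x A b t r} : SafeSubst l b x t r → Step l (app (lam f x A b) t) r
  | piDom {l f g x A A' B} : Step l A A' → Step l (pi f g x A B) (pi f g x A' B)
  | piCod {l f g x A B B'} : Step (x :: l) B B' → Step l (pi f g x A B) (pi f g x A B')
  | lamDom {l f x A A' b} : Step l A A' → Step l (lam f x A b) (lam f x A' b)
  | lamBody {l f x A b b'} : Step (x :: l) b b' → Step l (lam f x A b) (lam f x A b')
  | appFun {l M M' N} : Step l M M' → Step l (app M N) (app M' N)
  | appArg {l M N N'} : Step l N N' → Step l (app M N) (app M N')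

/-- `β`-equivalence on safe terms: the symmetric transitive closure of `β`-reduction between safe
terms, reflexive exactly on the safe terms. -/
inductive BetaEq (l : List Name) : Term → Term → Prop
  | refl {t} : BC l t → BetaEq l t t
  | step {t u} : BC l t → BC l u → Step l t u → BetaEq l t u
  | symm {t u} : BetaEq l t u → BetaEq l u t
  | trans {t u v} : BetaEq l t u → BetaEq l u v → BetaEq l t v

/-- The subtyping relation of CoC⁻; neither `Prop <: Set` nor `Set <: Type 1`. -/
inductive SubTy : Term → Term → Prop
  | type {i j} : 0 < i → i < j → SubTy (sort (.type i)) (sort (.type j))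
  | pi {f g x C A B} : SubTy A B → SubTy (pi f g x C A) (pi f g x C B)

/-- Typing contexts, the most recent declaration first. -/
abbrev Ctx : Type := List (Name × Term)

/-- The variables that a context binds. -/
def Ctx.names (Γ : Ctx) : List Name := Γ.map Prod.fst

/-- The typing rules of CoC⁻, with the flags made explicit, for terms up to renaming of bound
variables (rule `alpha`).

The flags record the universes of the domain and of the codomain. In `abs` the codomain `C` is a
type in the universe `s'`. In `absPi` the codomain is itself a product, whose universe is already
indicated by its flags; this rule is needed because a product of types in different universes need
not have a universe in CoC⁻, and yet is the type of a function. -/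
inductive Typing : Ctx → Term → Term → Prop
  | ax₁ : Typing [] (sort .prop) (sort (.type 1))
  | ax₂ {i} : Typing [] (sort (.type i)) (sort (.type (i + 1)))
  | var {Γ x A s} : x ∉ Ctx.names Γ → Typing Γ A (sort s) → Typing ((x, A) :: Γ) (var x) A
  | weak {Γ x A s B C} : x ∉ Ctx.names Γ → Typing Γ B C → Typing Γ A (sort s) →
      Typing ((x, A) :: Γ) B C
  | conv {Γ A B C s} : Typing Γ A C → Typing Γ B (sort s) → BetaEq (Ctx.names Γ) B C →
      Typing Γ A B
  | cum {Γ A B C} : Typing Γ A B → SubTy B C → Typing Γ A C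
  | pi₁ {Γ x A B i} : Typing Γ A (sort (.type i)) → Typing ((x, A) :: Γ) B (sort (.type i)) →
      Typing Γ (pi (Srt.type i).flag (Srt.type i).flag x A B) (sort (.type i))
  | pi₂ {Γ x A B s} : s = .type 0 ∨ s = .prop → Typing Γ A (sort s) →
      Typing ((x, A) :: Γ) B (sort .prop) →
      Typing Γ (pi s.flag .P x A B) (sort .prop)
  | app {Γ f g x A B M N R} : Typing Γ M (pi f g x A B) → Typing Γ N A →
      SafeSubst (Ctx.names Γ) B x N R → Typing Γ (app M N) R
  | abs {Γ x A B C s s'} : Typing ((x, A) :: Γ) B C → Typing Γ A (sort s) →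
      Typing ((x, A) :: Γ) C (sort s') →
      Typing Γ (lam s.flag x A B) (pi s.flag s'.flag x A C)
  | absPi {Γ x A B f g y D E s} : Typing ((x, A) :: Γ) B (pi f g y D E) → Typing Γ A (sort s) →
      Typing Γ (lam s.flag x A B) (pi s.flag (f.prod g) x A (pi f g y D E))
  | alpha {Γ A A' B B'} : Typing Γ A B → Alpha A A' → Alpha B B' → Typing Γ A' B'

/-- The type `A` is in the universe with flag `u`: by its type, or, for a product, as indicated by
the flags. -/
def InUniverse (Γ : Ctx) (A : Term) (u : Flag) : Prop :=
  (∃ s : Srt, Typing Γ A (sort s) ∧ s.flag = u) ∨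
    ∃ f g x D E, A = pi f g x D E ∧ f.prod g = u

/-- Capture safety of contexts. -/
def BCCtx : Ctx → Prop
  | [] => True
  | (x, A) :: Γ => BCCtx Γ ∧ x ≠ c ∧ BC (Ctx.names Γ) A

/-! ## The target calculus: the fragment of CIC that the translation uses -/

/-- Constants of the target: the inductive families `sigT`, `prod`, `and`, `eq` of Coq's library at
explicit universe levels, with their constructors and eliminators, and the two axioms that the
lemmas use, proof irrelevance and dependent function extensionality. -/
inductive Const : Type
  | sigT (i j : ℕ) | existT (i j : ℕ) | projT1 (i j : ℕ) | projT2 (i j : ℕ)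
  | prod (i j : ℕ) | pair (i j : ℕ) | fst (i j : ℕ) | snd (i j : ℕ)
  | and | conj | proj1 | proj2
  | eq (i : ℕ) | eqRefl (i : ℕ) | eqRect (i j : ℕ)
  | proofIrrelevance
  | funext (i j : ℕ)

/-- Raw terms of the target with explicit variable names. -/
inductive Tgt : Type
  | var (x : Var) : Tgt
  | sort (s : Srt) : Tgt
  | pi (x : Var) (A B : Tgt) : Tgt
  | lam (x : Var) (A b : Tgt) : Tgt
  | app (f a : Tgt) : Tgt
  | const (k : Const) : Tgt

instance : Coe Var Tgt := ⟨Tgt.var⟩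

namespace Tgt

/-- Iterated application. -/
def apps (f : Tgt) (l : List Tgt) : Tgt := l.foldl app f

/-- The non-dependent product. -/
def arr (A B : Tgt) : Tgt := pi Var.anon A B

infixr:30 " ⇒ " => Tgt.arr

/-- `Prop`. -/
abbrev Prp : Tgt := sort .prop

/-- `Type i`. -/
abbrev Typ (i : ℕ) : Tgt := sort (.type i)

end Tgt

/-- Raw terms of the target with de Bruijn indices, that is, up to renaming of bound variables. -/
inductive DB : Type
  | bvar (n : ℕ) : DB
  | sort (s : Srt) : DB
  | pi (A B : DB) : DB
  | lam (A b : DB) : DB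
  | app (f a : DB) : DB
  | const (k : Const) : DB

/-- The de Bruijn form of a named term under the binders `l`, innermost first. A variable that is
not bound becomes an index that points beyond `l`. -/
def Tgt.toDB : List Var → Tgt → DB
  | l, .var x => .bvar (l.idxOf x)
  | _, .sort s => .sort s
  | l, .pi x A B => .pi (A.toDB l) (B.toDB (x :: l))
  | l, .lam x A b => .lam (A.toDB l) (b.toDB (x :: l))
  | l, .app f a => .app (f.toDB l) (a.toDB l)
  | _, .const k => .const k

namespace DB

/-- The action on renamings under a binder. -/
def upRen (ρ : ℕ → ℕ) : ℕ → ℕ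
  | 0 => 0
  | n + 1 => ρ n + 1

/-- Renaming of indices. -/
def rename : (ℕ → ℕ) → DB → DB
  | ρ, bvar n => bvar (ρ n)
  | _, sort s => sort s
  | ρ, pi A B => pi (rename ρ A) (rename (upRen ρ) B)
  | ρ, lam A b => lam (rename ρ A) (rename (upRen ρ) b)
  | ρ, app f a => app (rename ρ f) (rename ρ a)
  | _, const k => const k

/-- Weakening by one variable. -/
def shift (t : DB) : DB := rename Nat.succ t

/-- The action on substitutions under a binder. -/
def up (σ : ℕ → DB) : ℕ → DB
  | 0 => bvar 0
  | n + 1 => shift (σ n)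

/-- Parallel capture-avoiding substitution. -/
def subst : (ℕ → DB) → DB → DB
  | σ, bvar n => σ n
  | _, sort s => sort s
  | σ, pi A B => pi (subst σ A) (subst (up σ) B)
  | σ, lam A b => lam (subst σ A) (subst (up σ) b)
  | σ, app f a => app (subst σ f) (subst σ a)
  | _, const k => const k

/-- Substitution of `a` for the variable with index `0`. -/
def inst (b a : DB) : DB :=
  subst (fun n => match n with
    | 0 => a
    | n + 1 => bvar n) b

/-- Iterated application of a constant. -/
def capps (k : Const) (l : List DB) : DB := l.foldl app (const k)

/-- One step of `β`- or `ι`-reduction, at any position. -/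
inductive Red : DB → DB → Prop
  | beta {A b a} : Red (app (lam A b) a) (inst b a)
  | projT1 {i j A P A' P' a b} :
      Red (capps (.projT1 i j) [A, P, capps (.existT i j) [A', P', a, b]]) a
  | projT2 {i j A P A' P' a b} :
      Red (capps (.projT2 i j) [A, P, capps (.existT i j) [A', P', a, b]]) b
  | fst {i j A B A' B' a b} :
      Red (capps (.fst i j) [A, B, capps (.pair i j) [A', B', a, b]]) a
  | snd {i j A B A' B' a b} :
      Red (capps (.snd i j) [A, B, capps (.pair i j) [A', B', a, b]]) b
  | proj1 {A B A' B' a b} : Red (capps .proj1 [A, B, capps .conj [A', B', a, b]]) a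
  | proj2 {A B A' B' a b} : Red (capps .proj2 [A, B, capps .conj [A', B', a, b]]) b
  | eqRect {i j A x P p y A' x'} :
      Red (capps (.eqRect i j) [A, x, P, p, y, capps (.eqRefl i) [A', x']]) p
  | piDom {A A' B} : Red A A' → Red (pi A B) (pi A' B)
  | piCod {A B B'} : Red B B' → Red (pi A B) (pi A B')
  | lamDom {A A' b} : Red A A' → Red (lam A b) (lam A' b)
  | lamBody {A b b'} : Red b b' → Red (lam A b) (lam A b')
  | appFun {f f' a} : Red f f' → Red (app f a) (app f' a)
  | appArg {f a a'} : Red a a' → Red (app f a) (app f a')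

/-- Definitional equality. -/
def Conv : DB → DB → Prop := Relation.EqvGen Red

end DB

/-- The order `Prop ≤ Set ≤ Type 1 ≤ …`. -/
def Srt.le : Srt → Srt → Prop
  | .prop, _ => True
  | .type _, .prop => False
  | .type i, .type j => i ≤ j

/-- The universe of a universe. -/
def Srt.succ : Srt → Srt
  | .prop => .type 1
  | .type i => .type (i + 1)

/-- The universe of a product in CIC (`Prop` is impredicative). -/
def Srt.prod : Srt → Srt → Srt
  | _, .prop => .prop
  | .prop, .type j => .type j
  | .type i, .type j => .type (max i j)

/-- The subtyping relation of CIC (up to definitional equality). -/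
inductive Cumul : DB → DB → Prop
  | conv {A B} : DB.Conv A B → Cumul A B
  | sort {s s'} : Srt.le s s' → Cumul (.sort s) (.sort s')
  | pi {A A' B B'} : DB.Conv A A' → Cumul B B' → Cumul (.pi A B) (.pi A' B')
  | trans {A B C} : Cumul A B → Cumul B C → Cumul A C

section Constants

open Tgt

/-- The types of the constants. -/
def Const.type : Const → Tgt :=
  let A : Var := .one 1
  let B : Var := .one 2
  let x : Var := .one 3
  let y : Var := .one 4
  let f : Var := .one 5
  let g : Var := .one 6
  fun
  | .sigT i j => pi A (Typ i) ((A ⇒ Typ j) ⇒ Typ (max i j))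
  | .existT i j => pi A (Typ i) (pi B (A ⇒ Typ j) (pi x A
      (app B x ⇒ apps (const (.sigT i j)) [A, B])))
  | .projT1 i j => pi A (Typ i) (pi B (A ⇒ Typ j) (apps (const (.sigT i j)) [A, B] ⇒ A))
  | .projT2 i j => pi A (Typ i) (pi B (A ⇒ Typ j) (pi x (apps (const (.sigT i j)) [A, B])
      (app B (apps (const (.projT1 i j)) [A, B, x]))))
  | .prod i j => Typ i ⇒ Typ j ⇒ Typ (max i j)
  | .pair i j => pi A (Typ i) (pi B (Typ j) (A ⇒ B ⇒ apps (const (.prod i j)) [A, B]))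
  | .fst i j => pi A (Typ i) (pi B (Typ j) (apps (const (.prod i j)) [A, B] ⇒ A))
  | .snd i j => pi A (Typ i) (pi B (Typ j) (apps (const (.prod i j)) [A, B] ⇒ B))
  | .and => Prp ⇒ Prp ⇒ Prp
  | .conj => pi A Prp (pi B Prp (A ⇒ B ⇒ apps (const .and) [A, B]))
  | .proj1 => pi A Prp (pi B Prp (apps (const .and) [A, B] ⇒ A))
  | .proj2 => pi A Prp (pi B Prp (apps (const .and) [A, B] ⇒ B))
  | .eq i => pi A (Typ i) (A ⇒ A ⇒ Prp)
  | .eqRefl i => pi A (Typ i) (pi x A (apps (const (.eq i)) [A, x, x]))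
  | .eqRect i j => pi A (Typ i) (pi x A (pi B (A ⇒ Typ j) (app B x ⇒
      pi y A (apps (const (.eq i)) [A, x, y] ⇒ app B y))))
  | .proofIrrelevance => pi A Prp (pi x A (pi y A (apps (const (.eq 0)) [A, x, y])))
  | .funext i j => pi A (Typ i) (pi B (A ⇒ Typ j) (pi f (pi x A (app B x)) (pi g (pi x A (app B x))
      (pi x A (apps (const (.eq j)) [app B x, app f x, app g x]) ⇒
        apps (const (.eq (max i j))) [pi x A (app B x), f, g]))))

end Constants

/-- The typing judgement of the target calculus; contexts list the most recent type first. -/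
inductive CICTyping : List DB → DB → DB → Prop
  | sort {s : Srt} : CICTyping [] (.sort s) (.sort s.succ)
  | const {k : Const} : CICTyping [] (.const k) (k.type.toDB [])
  | var {Γ A s} : CICTyping Γ A (.sort s) → CICTyping (A :: Γ) (.bvar 0) A.shift
  | weak {Γ a B A s} : CICTyping Γ a B → CICTyping Γ A (.sort s) →
      CICTyping (A :: Γ) a.shift B.shift
  | pi {Γ A B s s'} : CICTyping Γ A (.sort s) → CICTyping (A :: Γ) B (.sort s') →
      CICTyping Γ (.pi A B) (.sort (s.prod s'))
  | lam {Γ A b B s} : CICTyping (A :: Γ) b B → CICTyping Γ (.pi A B) (.sort s) →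
      CICTyping Γ (.lam A b) (.pi A B)
  | app {Γ f a A B} : CICTyping Γ f (.pi A B) → CICTyping Γ a A →
      CICTyping Γ (.app f a) (B.inst a)
  | cumul {Γ a A B s} : CICTyping Γ a A → CICTyping Γ B (.sort s) → Cumul A B →
      CICTyping Γ a B

/-- Named contexts of the target, the most recent declaration first. -/
abbrev ECtx : Type := List (Var × Tgt)

/-- The variables that a context of the target binds. -/
def ECtx.names (Δ : ECtx) : List Var := Δ.map Prod.fst

/-- The de Bruijn form of a context. -/
def ECtx.toDB : ECtx → List DB
  | [] => []
  | (_, A) :: Δ => A.toDB (ECtx.names Δ) :: ECtx.toDB Δ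

/-- The judgement `Δ ⊢ t : T` of the target, for named terms. -/
def CoqTyping (Δ : ECtx) (t T : Tgt) : Prop :=
  CICTyping Δ.toDB (t.toDB Δ.names) (T.toDB Δ.names)

/-! ## The bundled relations and the combinators for products, as closed terms of the target -/

section Library

open Tgt

/-- `Total := λ (A B : Set) (R : A → B → Prop),
(∀ a : A, {b : B & R a b}) × (∀ b : B, {a : A & R a b})`. -/
def total : Tgt :=
  let A : Var := .one 1
  let B : Var := .one 2
  let R : Var := .one 3
  let a : Var := .one 4
  let b : Var := .one 5
  lam A (Typ 0) <| lam B (Typ 0) <| lam R (A ⇒ B ⇒ Prp) <|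
    apps (const (.prod 0 0))
      [pi a A (apps (const (.sigT 0 0)) [B, lam b B (apps R [a, b])]),
       pi b B (apps (const (.sigT 0 0)) [A, lam a A (apps R [a, b])])]

/-- `OneToOne := λ (A B : Set) (R : A → B → Prop),
(∀ (a : A) (b1 b2 : B), R a b1 → R a b2 → b1 = b2) ∧
(∀ (b : B) (a1 a2 : A), R a1 b → R a2 b → a1 = a2)`. -/
def oneToOne : Tgt :=
  let A : Var := .one 1
  let B : Var := .one 2
  let R : Var := .one 3
  let u : Var := .one 4
  let v : Var := .one 5
  let w : Var := .one 6
  lam A (Typ 0) <| lam B (Typ 0) <| lam R (A ⇒ B ⇒ Prp) <|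
    apps (const .and)
      [pi u A <| pi v B <| pi w B <|
         apps R [u, v] ⇒ apps R [u, w] ⇒ apps (const (.eq 0)) [B, v, w],
       pi u B <| pi v A <| pi w A <|
         apps R [v, u] ⇒ apps R [w, u] ⇒ apps (const (.eq 0)) [A, v, w]]

/-- The family `λ R : A → B → Prop, Total R × OneToOne R`. -/
def bundle (A B : Tgt) : Tgt :=
  let R : Var := .one 10
  lam R (A ⇒ B ⇒ Prp) <|
    apps (const (.prod 0 0)) [apps total [A, B, R], apps oneToOne [A, B, R]]

/-- `IsoRel := λ A B : Set, {R : A → B → Prop & Total R × OneToOne R}`. -/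
def isoRel : Tgt :=
  let A : Var := .one 1
  let B : Var := .one 2
  lam A (Typ 0) <| lam B (Typ 0) <| apps (const (.sigT 1 0)) [A ⇒ B ⇒ Prp, bundle A B]

/-- `mkIsoRel := λ (A B : Set) (R : A → B → Prop) (t : Total R) (o : OneToOne R),
existT R (t, o)`. -/
def mkIsoRel : Tgt :=
  let A : Var := .one 1
  let B : Var := .one 2
  let R : Var := .one 3
  let t : Var := .one 4
  let o : Var := .one 5
  lam A (Typ 0) <| lam B (Typ 0) <| lam R (A ⇒ B ⇒ Prp) <|
    lam t (apps total [A, B, R]) <| lam o (apps oneToOne [A, B, R]) <|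
      apps (const (.existT 1 0)) [A ⇒ B ⇒ Prp, bundle A B, R,
        apps (const (.pair 0 0)) [apps total [A, B, R], apps oneToOne [A, B, R], t, o]]

/-- `projRel := λ (A B : Set) (r : IsoRel A B), π₁ r`. -/
def projRel : Tgt :=
  let A : Var := .one 1
  let B : Var := .one 2
  let r : Var := .one 3
  lam A (Typ 0) <| lam B (Typ 0) <| lam r (apps isoRel [A, B]) <|
    apps (const (.projT1 1 0)) [A ⇒ B ⇒ Prp, bundle A B, r]

/-- The proof of `Total (projRel r)` in a bundle `r : IsoRel A B`. -/
def isoTot : Tgt :=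
  let A : Var := .one 1
  let B : Var := .one 2
  let r : Var := .one 3
  let R : Tgt := apps projRel [A, B, r]
  lam A (Typ 0) <| lam B (Typ 0) <| lam r (apps isoRel [A, B]) <|
    apps (const (.fst 0 0)) [apps total [A, B, R], apps oneToOne [A, B, R],
      apps (const (.projT2 1 0)) [A ⇒ B ⇒ Prp, bundle A B, r]]

/-- The proof of `OneToOne (projRel r)` in a bundle `r : IsoRel A B`. -/
def isoOne : Tgt :=
  let A : Var := .one 1
  let B : Var := .one 2
  let r : Var := .one 3
  let R : Tgt := apps projRel [A, B, r]
  lam A (Typ 0) <| lam B (Typ 0) <| lam r (apps isoRel [A, B]) <|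
    apps (const (.snd 0 0)) [apps total [A, B, R], apps oneToOne [A, B, R],
      apps (const (.projT2 1 0)) [A ⇒ B ⇒ Prp, bundle A B, r]]

/-- `∀ a : A, {b : B & projRel A B r a b}`, for variables `A`, `B`, `r`. -/
def fwdType (A B r : Var) : Tgt :=
  let a : Var := .one 20
  let b : Var := .one 21
  pi a A (apps (const (.sigT 0 0)) [B, lam b B (apps projRel [A, B, r, a, b])])

/-- `∀ b : B, {a : A & projRel A B r a b}`, for variables `A`, `B`, `r`. -/
def bwdType (A B r : Var) : Tgt :=
  let a : Var := .one 20
  let b : Var := .one 21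
  pi b B (apps (const (.sigT 0 0)) [A, lam a A (apps projRel [A, B, r, a, b])])

/-- For a bundle `r : IsoRel A B`, the element of `B` that the totality proof gives for `a : A`
(`k = projT1 0 0`), or the proof that it is related to `a` (`k = projT2 0 0`). -/
def fwdWith (k : Const) : Tgt :=
  let A : Var := .one 1
  let B : Var := .one 2
  let r : Var := .one 3
  let a : Var := .one 4
  let b : Var := .one 5
  lam A (Typ 0) <| lam B (Typ 0) <| lam r (apps isoRel [A, B]) <| lam a A <|
    apps (const k) [B, lam b B (apps projRel [A, B, r, a, b]),
      apps (const (.fst 0 0)) [fwdType A B r, bwdType A B r, apps isoTot [A, B, r], a]]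

/-- The same in the other direction, for `b : B`. -/
def bwdWith (k : Const) : Tgt :=
  let A : Var := .one 1
  let B : Var := .one 2
  let r : Var := .one 3
  let a : Var := .one 4
  let b : Var := .one 5
  lam A (Typ 0) <| lam B (Typ 0) <| lam r (apps isoRel [A, B]) <| lam b B <|
    apps (const k) [A, lam a A (apps projRel [A, B, r, a, b]),
      apps (const (.snd 0 0)) [fwdType A B r, bwdType A B r, apps isoTot [A, B, r], b]]

/-- `∀ (A B : Set) (r : IsoRel A B), A → B`. -/
def fwd : Tgt := fwdWith (.projT1 0 0)

/-- `∀ (A B : Set) (r : IsoRel A B) (a : A), projRel r a (fwd r a)`. -/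
def fwdRel : Tgt := fwdWith (.projT2 0 0)

/-- `∀ (A B : Set) (r : IsoRel A B), B → A`. -/
def bwd : Tgt := bwdWith (.projT1 0 0)

/-- `∀ (A B : Set) (r : IsoRel A B) (b : B), projRel r (bwd r b) b`. -/
def bwdRel : Tgt := bwdWith (.projT2 0 0)

/-- The two halves of `OneToOne (projRel r)`, for `k = proj1` and `k = proj2`. -/
def oneWith (k : Const) : Tgt :=
  let A : Var := .one 1
  let B : Var := .one 2
  let r : Var := .one 3
  let u : Var := .one 4
  let v : Var := .one 5
  let w : Var := .one 6
  let R (x y : Tgt) : Tgt := apps projRel [A, B, r, x, y]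
  lam A (Typ 0) <| lam B (Typ 0) <| lam r (apps isoRel [A, B]) <|
    apps (const k)
      [pi u A <| pi v B <| pi w B <| R u v ⇒ R u w ⇒ apps (const (.eq 0)) [B, v, w],
       pi u B <| pi v A <| pi w A <| R v u ⇒ R w u ⇒ apps (const (.eq 0)) [A, v, w],
       apps isoOne [A, B, r]]

/-- `∀ (A B : Set) (r : IsoRel A B) (a : A) (b1 b2 : B), projRel r a b1 → projRel r a b2 →
b1 = b2`. -/
def oneR : Tgt := oneWith .proj1

/-- `∀ (A B : Set) (r : IsoRel A B) (b : B) (a1 a2 : A), projRel r a1 b → projRel r a2 b →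
a1 = a2`. -/
def oneL : Tgt := oneWith .proj2

/-! The variables of the two combinators for products. -/

abbrev vA1 : Var := .one 101
abbrev vA2 : Var := .one 102
abbrev vAR : Var := .one 103
abbrev vB1 : Var := .one 104
abbrev vB2 : Var := .one 105
abbrev vBR : Var := .one 106
abbrev va : Var := .one 107
abbrev va1 : Var := .one 108
abbrev va2 : Var := .one 109
abbrev vp : Var := .one 110
abbrev vf1 : Var := .one 111
abbrev vf2 : Var := .one 112
abbrev vg : Var := .one 113
abbrev vg' : Var := .one 114
abbrev vh : Var := .one 115
abbrev vh' : Var := .one 116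
abbrev vz : Var := .one 117
abbrev vq : Var := .one 118

/-- `π₁ A_R x y`. -/
def relA (x y : Tgt) : Tgt := apps projRel [vA1, vA2, vAR, x, y]

/-- An operation on bundles applied to `B_R x y p : IsoRel (B1 x) (B2 y)`. -/
def atB (op x y p : Tgt) (l : List Tgt) : Tgt :=
  apps op ([app vB1 x, app vB2 y, apps vBR [x, y, p]] ++ l)

/-- The product `∀ a : A1, B1 a`. -/
def prod1 : Tgt := pi va vA1 (app vB1 va)

/-- The product `∀ a : A2, B2 a`. -/
def prod2 : Tgt := pi va vA2 (app vB2 va)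

/-- `∀ (a1 : A1) (a2 : A2) (p : π₁ A_R a1 a2), π₁ (B_R a1 a2 p) (f1 a1) (f2 a2)`. -/
def relPi (f1 f2 : Tgt) : Tgt :=
  pi va1 vA1 <| pi va2 vA2 <| pi vp (relA va1 va2) <|
    atB projRel va1 va2 vp [app f1 va1, app f2 va2]

/-- `λ (A1 A2 : Set) (A_R : IsoRel A1 A2) (B1 : A1 → s) (B2 : A2 → s)
(B_R : ∀ a1 a2, π₁ A_R a1 a2 → IsoRel (B1 a1) (B2 a2)), body`. -/
def piHyps (s : Srt) (body : Tgt) : Tgt :=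
  lam vA1 (Typ 0) <| lam vA2 (Typ 0) <| lam vAR (apps isoRel [vA1, vA2]) <|
    lam vB1 (vA1 ⇒ sort s) <| lam vB2 (vA2 ⇒ sort s) <|
    lam vBR (pi va1 vA1 <| pi va2 vA2 <|
      relA va1 va2 ⇒ apps isoRel [app vB1 va1, app vB2 va2]) <|
    body

/-- The element of `A1` that totality of `A_R` gives for `y : A2`, and the proof that they are
related; then the same for `x : A1`. -/
def bwdA (y : Tgt) : Tgt := apps bwd [vA1, vA2, vAR, y]
def bwdRelA (y : Tgt) : Tgt := apps bwdRel [vA1, vA2, vAR, y]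
def fwdA (x : Tgt) : Tgt := apps fwd [vA1, vA2, vAR, x]
def fwdRelA (x : Tgt) : Tgt := apps fwdRel [vA1, vA2, vAR, x]

/-- The function of type `∀ a : A2, B2 a` that is related to `f1`. -/
def transport1 : Tgt :=
  lam va vA2 (atB fwd (bwdA va) va (bwdRelA va) [app vf1 (bwdA va)])

/-- The function of type `∀ a : A1, B1 a` that is related to `f2`. -/
def transport2 : Tgt :=
  lam va vA1 (atB bwd va (fwdA va) (fwdRelA va) [app vf2 (fwdA va)])

/-- `IsoRel`s of products, given the proofs that the relation of products is `Total` (in both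
directions) and `OneToOne` (in both directions). -/
def mkPi (t1 t2 o1 o2 : Tgt) : Tgt :=
  let R : Tgt := lam vf1 prod1 (lam vf2 prod2 (relPi vf1 vf2))
  apps mkIsoRel [prod1, prod2, R,
    apps (const (.pair 0 0))
      [pi vf1 prod1 (apps (const (.sigT 0 0)) [prod2, lam vf2 prod2 (relPi vf1 vf2)]),
       pi vf2 prod2 (apps (const (.sigT 0 0)) [prod1, lam vf1 prod1 (relPi vf1 vf2)]),
       lam vf1 prod1 (apps (const (.existT 0 0))
         [prod2, lam vf2 prod2 (relPi vf1 vf2), transport1,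
          lam va1 vA1 <| lam va2 vA2 <| lam vp (relA va1 va2) t1]),
       lam vf2 prod2 (apps (const (.existT 0 0))
         [prod1, lam vf1 prod1 (relPi vf1 vf2), transport2,
          lam va1 vA1 <| lam va2 vA2 <| lam vp (relA va1 va2) t2])],
    apps (const .conj)
      [pi vf1 prod1 <| pi vg prod2 <| pi vg' prod2 <|
         relPi vf1 vg ⇒ relPi vf1 vg' ⇒ apps (const (.eq 0)) [prod2, vg, vg'],
       pi vf2 prod2 <| pi vg prod1 <| pi vg' prod1 <|
         relPi vg vf2 ⇒ relPi vg' vf2 ⇒ apps (const (.eq 0)) [prod1, vg, vg'],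
       lam vf1 prod1 <| lam vg prod2 <| lam vg' prod2 <|
         lam vh (relPi vf1 vg) <| lam vh' (relPi vf1 vg') o1,
       lam vf2 prod2 <| lam vg prod1 <| lam vg' prod1 <|
         lam vh (relPi vg vf2) <| lam vh' (relPi vg' vf2) o2]]

/-- The combinator for products in `Prop`. Proof irrelevance of `B1 a` and `B2 a` makes related
whatever has to be related, so only totality of `A_R` and `B_R` is used. -/
def piProp : Tgt :=
  piHyps .prop <| mkPi
    (apps (const (.eqRect 0 0)) [app vB2 va2, atB fwd va1 va2 vp [app vf1 va1],
      lam vz (app vB2 va2) (atB projRel va1 va2 vp [app vf1 va1, vz]),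
      atB fwdRel va1 va2 vp [app vf1 va1],
      app transport1 va2,
      apps (const .proofIrrelevance)
        [app vB2 va2, atB fwd va1 va2 vp [app vf1 va1], app transport1 va2]])
    (apps (const (.eqRect 0 0)) [app vB1 va1, atB bwd va1 va2 vp [app vf2 va2],
      lam vz (app vB1 va1) (atB projRel va1 va2 vp [vz, app vf2 va2]),
      atB bwdRel va1 va2 vp [app vf2 va2],
      app transport2 va1,
      apps (const .proofIrrelevance)
        [app vB1 va1, atB bwd va1 va2 vp [app vf2 va2], app transport2 va1]])
    (apps (const .proofIrrelevance) [prod2, vg, vg'])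
    (apps (const .proofIrrelevance) [prod1, vg, vg'])

/-- The combinator for products in `Set`. Totality uses that `A_R` is one-to-one and proof
irrelevance of `π₁ A_R`; one-to-oneness uses function extensionality. -/
def piSet : Tgt :=
  piHyps (.type 0) <| mkPi
    (apps (const (.eqRect 0 0)) [vA1, bwdA va2,
      lam vz vA1 (pi vq (relA vz va2)
        (atB projRel vz va2 vq [app vf1 vz, app transport1 va2])),
      lam vq (relA (bwdA va2) va2) (apps (const (.eqRect 0 0))
        [relA (bwdA va2) va2, bwdRelA va2,
         lam vz (relA (bwdA va2) va2)
           (atB projRel (bwdA va2) va2 vz [app vf1 (bwdA va2), app transport1 va2]),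
         atB fwdRel (bwdA va2) va2 (bwdRelA va2) [app vf1 (bwdA va2)],
         vq,
         apps (const .proofIrrelevance) [relA (bwdA va2) va2, bwdRelA va2, vq]]),
      va1, apps oneL [vA1, vA2, vAR, va2, bwdA va2, va1, bwdRelA va2, vp], vp])
    (apps (const (.eqRect 0 0)) [vA2, fwdA va1,
      lam vz vA2 (pi vq (relA va1 vz)
        (atB projRel va1 vz vq [app transport2 va1, app vf2 vz])),
      lam vq (relA va1 (fwdA va1)) (apps (const (.eqRect 0 0))
        [relA va1 (fwdA va1), fwdRelA va1,
         lam vz (relA va1 (fwdA va1))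
           (atB projRel va1 (fwdA va1) vz [app transport2 va1, app vf2 (fwdA va1)]),
         atB bwdRel va1 (fwdA va1) (fwdRelA va1) [app vf2 (fwdA va1)],
         vq,
         apps (const .proofIrrelevance) [relA va1 (fwdA va1), fwdRelA va1, vq]]),
      va2, apps oneR [vA1, vA2, vAR, va1, fwdA va1, va2, fwdRelA va1, vp], vp])
    (apps (const (.funext 0 0)) [vA2, vB2, vg, vg',
      lam va vA2 (atB oneR (bwdA va) va (bwdRelA va)
        [app vf1 (bwdA va), app vg va, app vg' va,
         apps vh [bwdA va, va, bwdRelA va], apps vh' [bwdA va, va, bwdRelA va]])])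
    (apps (const (.funext 0 0)) [vA1, vB1, vg, vg',
      lam va vA1 (atB oneL va (fwdA va) (fwdRelA va)
        [app vf2 (fwdA va), app vg va, app vg' va,
         apps vh [va, fwdA va, fwdRelA va], apps vh' [va, fwdA va, fwdRelA va]])])

end Library

/-! ## The weak IsoRel translation -/

section Translation

open Tgt

/-- A term of CoC⁻ as a term of the target, with its variables mapped by `ρ`. -/
def embed (ρ : Name → Var) : Term → Tgt
  | .var x => ρ x
  | .sort s => sort s
  | .pi _ _ x A B => pi (ρ x) (embed ρ A) (embed ρ B)
  | .lam _ x A b => lam (ρ x) (embed ρ A) (embed ρ b)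
  | .app M N => app (embed ρ M) (embed ρ N)

/-- The term itself. -/
def Term.emb (t : Term) : Tgt := embed .one t

/-- The term `t'`: every variable `x` is replaced by `x'`. -/
def Term.primed (t : Term) : Tgt := embed .prime t

/-- The relation that underlies `t`, the translation of a type `A` in the universe with flag `f`:
`projRel A A' t` for `Set` and `Prop`, and `t` itself for the higher universes. -/
def projFlag (f : Flag) (A : Term) (t : Tgt) : Tgt :=
  match f with
  | .T => t
  | _ => apps projRel [A.emb, A.primed, t]

/-- The weak IsoRel translation of terms. -/
def trans : Term → Tgt
  | .var x => Var.rel x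
  | .sort (.type (i + 1)) =>
      lam (.one c) (Typ (i + 1)) <| lam (.prime c) (Typ (i + 1)) <|
        Var.one c ⇒ Var.prime c ⇒ Typ (i + 1)
  | .sort s =>
      lam (.one c) (sort s) <| lam (.prime c) (sort s) <|
        apps isoRel [Var.one c, Var.prime c]
  | .lam f x A b =>
      lam (.one x) A.emb <| lam (.prime x) A.primed <|
        lam (.rel x) (apps (projFlag f A (trans A)) [Var.one x, Var.prime x]) <|
          trans b
  | .app M N => apps (trans M) [N.emb, N.primed, trans N]
  | .pi f g x A B =>
      let args : List Tgt :=
        [A.emb, A.primed, trans A,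
         lam (.one x) A.emb B.emb,
         lam (.prime x) A.primed B.primed,
         lam (.one x) A.emb <| lam (.prime x) A.primed <|
           lam (.rel x) (apps (projFlag f A (trans A)) [Var.one x, Var.prime x]) <|
             trans B]
      match f.prod g with
      | .P => apps piProp args
      | .S => apps piSet args
      | .T =>
          lam (.four x) (pi (.one x) A.emb B.emb) <|
          lam (.five x) (pi (.prime x) A.primed B.primed) <|
            pi (.one x) A.emb <| pi (.prime x) A.primed <|
              pi (.rel x) (apps (projFlag f A (trans A)) [Var.one x, Var.prime x]) <|
                apps (projFlag g B (trans B))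
                  [app (Var.four x) (Var.one x), app (Var.five x) (Var.prime x)]

open Classical in
/-- `projTyRel Γ A t` is `projRel A A' t` if the type `A` is in `Set` or in `Prop`, and `t`
otherwise. -/
noncomputable def projTyRel (Γ : Ctx) (A : Term) (t : Tgt) : Tgt :=
  if InUniverse Γ A .S ∨ InUniverse Γ A .P then apps projRel [A.emb, A.primed, t] else t

/-- The translation of contexts. -/
noncomputable def transCtx : Ctx → ECtx
  | [] => []
  | (x, A) :: Γ =>
      (.rel x, apps (projTyRel Γ A (trans A)) [Var.one x, Var.prime x]) ::
      (.prime x, A.primed) :: (.one x, A.emb) :: transCtx Γ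

end Translation

end WeakIsoRel

/-! The theorem is proved by induction on typing derivations over de Bruijn terms, where renaming of
bound variables is invisible. A source variable with index `n` becomes three target variables:
`3n+2` for `x`, `3n+1` for `x'` and `3n` for `x_R`. With this numbering the translation `Src.tr`
commutes exactly with substitution (`Src.tr_subst`), so a source `β`-step becomes a conversion in
the target (`Src.Red.tr`). The first two conclusions come from erasing flags and using cumulativity
of CIC (`SrcTyping.emb`), followed by a renaming of indices.

The heart of the third conclusion is `DB.conv_trPi`: whatever the universe of a product, the
relation underlying its translation, at `t` and `t'`, is convertible to `∀ x x' x_R, (proj_B [[B]])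
(t x) (t' x')`. Application, abstraction and subtyping then look the same in all universes
(`SrcTyping.tr`). This needs `piProp` and `piSet` to be well typed. Mathematically, `f₁` is
transported to the function sending `a₂` to the image under `B_R` of `f₁` at the partner of `a₂`.
For `Prop`-valued families relatedness and uniqueness are proof irrelevance. For `Set`-valued
families one-to-oneness of `A_R` identifies any related `a₁` with that partner, proof irrelevance
identifies the two proofs of relatedness, and uniqueness is function extensionality with
one-to-oneness of `B_R`. That the explicit proof terms have these types is checked by evaluating a
type checker whose soundness is proved (`LTerm.infer_sound`).

The conversion rule raises a difficulty: convertible types must have the same flag, or `proj` would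
change. Collapsing all `Type i`, `i > 0`, to one universe turns subtyping into equality and CoC⁻
into a pure type system with every product. It is not normalizing in general, but confluence,
subject reduction and uniqueness of types up to flags suffice (`PTS.flag_eq`). A second difficulty
is that some products have no universe in CoC⁻, although they are types of functions; hence the
auxiliary judgement `ty B u`, "`B` is a type with flag `u`".

Finally the named calculus is matched with the indexed one. Derivations go over by `Typing.toSrc`.
They must also come back (`SrcTyping.named`), because the translation of contexts asks for the
universe of a named type. Capture safety ensures that the named translation has the expected de
Bruijn form (`Term.transEq`). -/

namespace WeakIsoRel

/-! ## Renaming and substitution in the target -/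

namespace DB

/-- The substitution that maps index `0` to `a` and the others by `σ`. -/
def scons (a : DB) (σ : ℕ → DB) : ℕ → DB
  | 0 => a
  | n + 1 => σ n

@[simp] theorem scons_zero (a : DB) (σ) : scons a σ 0 = a := rfl
@[simp] theorem scons_succ (a : DB) (σ) (n : ℕ) : scons a σ (n + 1) = σ n := rfl
@[simp] theorem upRen_zero (ρ) : upRen ρ 0 = 0 := rfl
@[simp] theorem upRen_succ (ρ) (n : ℕ) : upRen ρ (n + 1) = ρ n + 1 := rfl
@[simp] theorem up_zero (σ) : up σ 0 = bvar 0 := rfl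
@[simp] theorem up_succ (σ) (n : ℕ) : up σ (n + 1) = shift (σ n) := rfl

theorem inst_eq (b a : DB) : inst b a = subst (scons a bvar) b := by
  unfold inst; congr 1

theorem upRen_comp (ρ ρ' : ℕ → ℕ) : upRen (fun n => ρ (ρ' n)) = fun n => upRen ρ (upRen ρ' n) := by
  funext n; cases n <;> rfl

theorem upRen_id : upRen (fun n => n) = fun n => n := by funext n; cases n <;> rfl

@[simp] theorem rename_id (t : DB) : rename (fun n => n) t = t := by
  induction t <;> simp_all [rename, upRen_id]

@[simp] theorem rename_rename (t : DB) : ∀ ρ ρ' : ℕ → ℕ,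
    rename ρ (rename ρ' t) = rename (fun n => ρ (ρ' n)) t := by
  induction t <;> intros <;> simp_all [rename, upRen_comp]

theorem up_comp_upRen (σ : ℕ → DB) (ρ : ℕ → ℕ) :
    up (fun n => σ (ρ n)) = fun n => up σ (upRen ρ n) := by
  funext n; cases n <;> rfl

@[simp] theorem subst_rename (t : DB) : ∀ (σ : ℕ → DB) (ρ : ℕ → ℕ),
    subst σ (rename ρ t) = subst (fun n => σ (ρ n)) t := by
  induction t <;> intros <;> simp_all [rename, subst, up_comp_upRen]

theorem up_rename_comp (σ : ℕ → DB) (ρ : ℕ → ℕ) :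
    up (fun n => rename ρ (σ n)) = fun n => rename (upRen ρ) (up σ n) := by
  funext n; cases n <;> simp [rename, shift]

@[simp] theorem rename_subst (t : DB) : ∀ (σ : ℕ → DB) (ρ : ℕ → ℕ),
    rename ρ (subst σ t) = subst (fun n => rename ρ (σ n)) t := by
  induction t <;> intros <;> simp_all [rename, subst, up_rename_comp]

theorem up_subst_comp (σ τ : ℕ → DB) :
    up (fun n => subst τ (σ n)) = fun n => subst (up τ) (up σ n) := by
  funext n; cases n <;> simp [subst, shift]

@[simp] theorem subst_subst (t : DB) : ∀ σ τ : ℕ → DB,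
    subst τ (subst σ t) = subst (fun n => subst τ (σ n)) t := by
  induction t <;> intros <;> simp_all [subst, up_subst_comp]

theorem up_bvar : up bvar = bvar := by funext n; cases n <;> rfl

@[simp] theorem subst_bvar (t : DB) : subst bvar t = t := by
  induction t <;> simp_all [subst, up_bvar]

theorem up_bvar_comp (ρ : ℕ → ℕ) : up (fun n => bvar (ρ n)) = fun n => bvar (upRen ρ n) := by
  funext n; cases n <;> rfl

theorem rename_eq_subst (t : DB) : ∀ ρ : ℕ → ℕ, rename ρ t = subst (fun n => bvar (ρ n)) t := by
  induction t <;> intros <;> simp_all [rename, subst, up_bvar_comp]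

theorem subst_congr {σ τ : ℕ → DB} (t : DB) (h : ∀ n, σ n = τ n) : subst σ t = subst τ t := by
  rw [funext h]

theorem rename_congr {σ τ : ℕ → ℕ} (t : DB) (h : ∀ n, σ n = τ n) : rename σ t = rename τ t := by
  rw [funext h]

theorem shift_eq (t : DB) : shift t = rename (fun n => n + 1) t := rfl

theorem subst_up_shift (σ : ℕ → DB) (t : DB) : subst (up σ) (shift t) = shift (subst σ t) := by
  simp [shift_eq, up]

theorem rename_upRen_shift (ρ : ℕ → ℕ) (t : DB) :
    rename (upRen ρ) (shift t) = shift (rename ρ t) := by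
  simp [shift_eq]

theorem subst_inst (σ : ℕ → DB) (b a : DB) :
    subst σ (inst b a) = inst (subst (up σ) b) (subst σ a) := by
  simp only [inst_eq, subst_subst]
  refine subst_congr _ fun n => ?_
  cases n <;> simp [subst, shift_eq]

@[simp] theorem inst_shift (t a : DB) : inst (shift t) a = t := by
  simp [inst_eq, shift_eq]

/-! ### Reduction and conversion -/

theorem subst_foldl_app (σ : ℕ → DB) (l : List DB) : ∀ f : DB,
    subst σ (l.foldl app f) = (l.map (subst σ)).foldl app (subst σ f) := by
  induction l <;> intros <;> simp_all [subst]

theorem subst_capps (σ : ℕ → DB) (k : Const) (l : List DB) :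
    subst σ (capps k l) = capps k (l.map (subst σ)) :=
  subst_foldl_app σ l (const k)

theorem Red.subst {t u : DB} (h : Red t u) : ∀ σ, Red (DB.subst σ t) (DB.subst σ u) := by
  induction h with
  | beta => intro σ; rw [subst_inst]; exact .beta
  | piDom _ ih => exact fun σ => .piDom (ih σ)
  | piCod _ ih => exact fun σ => .piCod (ih _)
  | lamDom _ ih => exact fun σ => .lamDom (ih σ)
  | lamBody _ ih => exact fun σ => .lamBody (ih _)
  | appFun _ ih => exact fun σ => .appFun (ih σ)
  | appArg _ ih => exact fun σ => .appArg (ih σ)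
  | projT1 => intro σ; simpa only [subst_capps, List.map] using Red.projT1
  | projT2 => intro σ; simpa only [subst_capps, List.map] using Red.projT2
  | fst => intro σ; simpa only [subst_capps, List.map] using Red.fst
  | snd => intro σ; simpa only [subst_capps, List.map] using Red.snd
  | proj1 => intro σ; simpa only [subst_capps, List.map] using Red.proj1
  | proj2 => intro σ; simpa only [subst_capps, List.map] using Red.proj2
  | eqRect => intro σ; simpa only [subst_capps, List.map] using Red.eqRect

theorem Conv.refl (t : DB) : Conv t t := Relation.EqvGen.refl t
theorem Conv.of_eq {t u : DB} (h : t = u) : Conv t u := h ▸ Conv.refl t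
theorem Conv.symm {t u : DB} (h : Conv t u) : Conv u t := Relation.EqvGen.symm _ _ h
theorem Conv.trans {t u v : DB} (h : Conv t u) (h' : Conv u v) : Conv t v :=
  Relation.EqvGen.trans _ _ _ h h'
theorem Conv.red {t u : DB} (h : Red t u) : Conv t u := Relation.EqvGen.rel _ _ h

theorem Conv.map {t u : DB} (F : DB → DB) (hF : ∀ {a b}, Red a b → Red (F a) (F b))
    (h : Conv t u) : Conv (F t) (F u) := by
  induction h with
  | rel _ _ h => exact .red (hF h)
  | refl => exact .refl _
  | symm _ _ _ ih => exact ih.symm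
  | trans _ _ _ _ _ ih ih' => exact ih.trans ih'

theorem Conv.subst {t u : DB} (h : Conv t u) (σ) : Conv (DB.subst σ t) (DB.subst σ u) :=
  h.map _ fun h => h.subst σ

theorem Conv.rename {t u : DB} (h : Conv t u) (ρ) : Conv (DB.rename ρ t) (DB.rename ρ u) := by
  simpa only [rename_eq_subst] using h.subst _

theorem Conv.app {f f' a a' : DB} (h : Conv f f') (h' : Conv a a') :
    Conv (.app f a) (.app f' a') :=
  (h.map (DB.app · a) .appFun).trans (h'.map (DB.app f' ·) .appArg)

theorem Conv.pi {f f' a a' : DB} (h : Conv f f') (h' : Conv a a') :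
    Conv (.pi f a) (.pi f' a') :=
  (h.map (DB.pi · a) .piDom).trans (h'.map (DB.pi f' ·) .piCod)

theorem Conv.lam {f f' a a' : DB} (h : Conv f f') (h' : Conv a a') :
    Conv (.lam f a) (.lam f' a') :=
  (h.map (DB.lam · a) .lamDom).trans (h'.map (DB.lam f' ·) .lamBody)

theorem Conv.beta {A b a : DB} : Conv (.app (.lam A b) a) (inst b a) := .red .beta

end DB

theorem Cumul.refl (t : DB) : Cumul t t := .conv (.refl t)

theorem Cumul.subst {A B : DB} (h : Cumul A B) : ∀ σ, Cumul (A.subst σ) (B.subst σ) := by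
  induction h with
  | conv h => exact fun σ => .conv (h.subst σ)
  | sort h => exact fun σ => .sort h
  | pi h _ ih => exact fun σ => .pi (h.subst σ) (ih _)
  | trans _ _ ih ih' => exact fun σ => (ih σ).trans (ih' σ)

/-! ## Renaming and substitution for derivations of the target -/

/-- The declaration of index `n`, with its type moved to the whole context. -/
inductive DB.Lookup : List DB → ℕ → DB → Prop
  | zero {Γ A} : Lookup (A :: Γ) 0 A.shift
  | succ {Γ A B n} : Lookup Γ n B → Lookup (A :: Γ) (n + 1) B.shift

/-- Well-formed contexts of the target. -/
inductive CICCtx : List DB → Prop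
  | nil : CICCtx []
  | cons {Γ A s} : CICCtx Γ → CICTyping Γ A (.sort s) → CICCtx (A :: Γ)

namespace CICTyping

theorem ctx {Γ : List DB} {t T : DB} (h : CICTyping Γ t T) : CICCtx Γ := by
  induction h with
  | sort | const => exact .nil
  | var h ih => exact .cons ih h
  | weak _ h _ ih => exact .cons ih h
  | pi _ _ ih _ => exact ih
  | lam _ _ _ ih => exact ih
  | app _ _ ih _ => exact ih
  | cumul _ _ _ ih _ => exact ih

theorem closed_weak {t T : DB} (ht : ∀ ρ, t.rename ρ = t) (hT : ∀ ρ, T.rename ρ = T)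
    (h : CICTyping [] t T) {Γ : List DB} (hΓ : CICCtx Γ) : CICTyping Γ t T := by
  induction hΓ with
  | nil => exact h
  | cons _ hA ih => simpa only [DB.shift, ht, hT] using ih.weak hA

theorem sort' {Γ : List DB} (hΓ : CICCtx Γ) (s : Srt) : CICTyping Γ (.sort s) (.sort s.succ) :=
  closed_weak (fun _ => rfl) (fun _ => rfl) .sort hΓ

theorem lookup {Γ : List DB} {n : ℕ} {A : DB} (hΓ : CICCtx Γ) (h : DB.Lookup Γ n A) :
    CICTyping Γ (.bvar n) A := by
  induction h with
  | zero => cases hΓ with | cons _ h => exact .var h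
  | succ _ ih => cases hΓ with | cons hΓ h => exact (ih hΓ).weak h

/-- The rule for abstractions only has the typing of the whole product as a premise; going under the
binder needs the universe of the domain, which is recovered here. -/
theorem pi_dom {Γ : List DB} {A B T : DB} (h : CICTyping Γ (.pi A B) T) :
    ∃ s, CICTyping Γ A (.sort s) := by
  generalize ht : DB.pi A B = t at h
  induction h generalizing A B with
  | pi h => cases ht; exact ⟨_, h⟩
  | cumul _ _ _ ih => exact ih ht
  | @weak _ a _ _ _ _ h' ih =>
    cases a <;> cases ht
    obtain ⟨s, h⟩ := ih rfl
    exact ⟨s, h.weak h'⟩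
  | _ => cases ht

/-- A class of substitutions between contexts that preserves typing. -/
structure Morphisms (K : List DB → List DB → (ℕ → DB) → Prop) : Prop where
  ctx {Γ Δ σ} : K Γ Δ σ → CICCtx Δ
  zero {A Γ Δ σ} : K (A :: Γ) Δ σ → CICTyping Δ (σ 0) (A.shift.subst σ)
  tail {A Γ Δ σ} : K (A :: Γ) Δ σ → K Γ Δ (fun n => σ (n + 1))
  up {A Γ Δ σ s} : K Γ Δ σ → CICTyping Δ (A.subst σ) (.sort s) →
    K (A :: Γ) (A.subst σ :: Δ) (DB.up σ)

/-- One induction on derivations serves renamings and substitutions alike. Since weakening is a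
rule, the class has to be closed under forgetting the last variable as well as under passing a
binder. -/
theorem morphism {K} (hK : Morphisms K) {Γ : List DB} {t T : DB} (h : CICTyping Γ t T) :
    ∀ {Δ σ}, K Γ Δ σ → CICTyping Δ (t.subst σ) (T.subst σ) := by
  induction h with
  | sort => exact fun hσ => sort' (hK.ctx hσ) _
  | @const k =>
    intro Δ σ hσ
    -- The types of constants are closed, hence fixed by every substitution.
    have hc : ∀ σ, (k.type.toDB []).subst σ = k.type.toDB [] := by
      intro σ
      cases k <;> simp [Const.type, Tgt.toDB, DB.subst, Tgt.arr, Tgt.apps, DB.shift_eq,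
        DB.rename]
    rw [hc]
    exact closed_weak (fun _ => rfl) (fun ρ => by rw [DB.rename_eq_subst, hc]) .const (hK.ctx hσ)
  | var => exact fun hσ => hK.zero hσ
  | weak _ _ ih =>
    intro Δ σ hσ
    simpa only [DB.shift_eq, DB.subst_rename] using ih (hK.tail hσ)
  | pi _ _ ih ih' => exact fun hσ => .pi (ih hσ) (ih' (hK.up hσ (ih hσ)))
  | lam _ _ ih ih' =>
    intro Δ σ hσ
    obtain ⟨s, hA⟩ := (ih' hσ).pi_dom
    exact .lam (ih (hK.up hσ hA)) (ih' hσ)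
  | app _ _ ih ih' =>
    intro Δ σ hσ
    rw [DB.subst_inst]
    exact .app (ih hσ) (ih' hσ)
  | cumul _ _ h ih ih' => exact fun hσ => .cumul (ih hσ) (ih' hσ) (h.subst _)

theorem rename {Γ Δ : List DB} {t T : DB} (h : CICTyping Γ t T) (hΔ : CICCtx Δ) {ρ : ℕ → ℕ}
    (hρ : ∀ n A, DB.Lookup Γ n A → DB.Lookup Δ (ρ n) (A.rename ρ)) :
    CICTyping Δ (t.rename ρ) (T.rename ρ) := by
  simp only [DB.rename_eq_subst]
  refine morphism (K := fun Γ Δ σ => CICCtx Δ ∧ ∃ ρ : ℕ → ℕ, σ = (fun n => .bvar (ρ n)) ∧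
    ∀ n A, DB.Lookup Γ n A → DB.Lookup Δ (ρ n) (A.rename ρ)) ⟨fun h => h.1, ?_, ?_, ?_⟩ h
    ⟨hΔ, ρ, rfl, hρ⟩
  · rintro A Γ Δ _ ⟨hΔ, ρ, rfl, h⟩
    rw [← DB.rename_eq_subst]
    exact lookup hΔ (h _ _ .zero)
  · rintro A Γ Δ _ ⟨hΔ, ρ, rfl, h⟩
    refine ⟨hΔ, _, rfl, fun n B hB => ?_⟩
    simpa only [DB.shift_eq, DB.rename_rename] using h _ _ (.succ (A := A) hB)
  · rintro A Γ Δ _ s ⟨hΔ, ρ, rfl, h⟩ hA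
    refine ⟨.cons hΔ hA, DB.upRen ρ, DB.up_bvar_comp ρ, fun n B hB => ?_⟩
    cases hB with
    | zero => rw [DB.rename_upRen_shift, DB.rename_eq_subst]; exact .zero
    | succ hB => rw [DB.rename_upRen_shift]; exact .succ (h _ _ hB)

theorem subst {Γ Δ : List DB} {t T : DB} (h : CICTyping Γ t T) (hΔ : CICCtx Δ) {σ : ℕ → DB}
    (hσ : ∀ n A, DB.Lookup Γ n A → CICTyping Δ (σ n) (A.subst σ)) :
    CICTyping Δ (t.subst σ) (T.subst σ) := by
  refine morphism (K := fun Γ Δ σ => CICCtx Δ ∧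
    ∀ n A, DB.Lookup Γ n A → CICTyping Δ (σ n) (A.subst σ)) ⟨fun h => h.1, ?_, ?_, ?_⟩ h ⟨hΔ, hσ⟩
  · rintro A Γ Δ σ ⟨hΔ, h⟩
    exact h _ _ .zero
  · rintro A Γ Δ σ ⟨hΔ, h⟩
    refine ⟨hΔ, fun n B hB => ?_⟩
    simpa only [DB.shift_eq, DB.subst_rename] using h _ _ (.succ (A := A) hB)
  · rintro A Γ Δ σ s ⟨hΔ, h⟩ hA
    refine ⟨.cons hΔ hA, fun n B hB => ?_⟩
    cases hB with
    | zero => rw [DB.subst_up_shift]; exact .var hA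
    | succ hB => rw [DB.subst_up_shift]; exact (h _ _ hB).weak hA

theorem inst {Γ : List DB} {t T A a : DB} (h : CICTyping (A :: Γ) t T) (ha : CICTyping Γ a A) :
    CICTyping Γ (t.inst a) (T.inst a) := by
  simp only [DB.inst_eq]
  refine h.subst ha.ctx fun n B hB => ?_
  cases hB with
  | zero => rw [← DB.inst_eq, DB.inst_shift]; exact ha
  | succ hB => rw [← DB.inst_eq, DB.inst_shift]; exact lookup ha.ctx hB

/-- If the product was weakened, the codomain has to be weakened below its own last variable, which
is a renaming of derivations. -/
theorem pi_inv {Γ : List DB} {A B T : DB} (h : CICTyping Γ (.pi A B) T) :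
    ∃ s s', CICTyping Γ A (.sort s) ∧ CICTyping (A :: Γ) B (.sort s') := by
  generalize ht : DB.pi A B = t at h
  induction h generalizing A B with
  | pi h h' => cases ht; exact ⟨_, _, h, h'⟩
  | cumul _ _ _ ih => exact ih ht
  | @weak Γ a _ C _ _ h' ih =>
    cases a <;> cases ht
    obtain ⟨s, s', h, h''⟩ := ih rfl
    refine ⟨s, s', h.weak h', h''.rename (.cons (.cons h'.ctx h') (h.weak h')) fun n B hB => ?_⟩
    cases hB with
    | zero => rw [DB.rename_upRen_shift]; exact .zero
    | succ hB => rw [DB.rename_upRen_shift]; exact .succ (.succ hB)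
  | _ => cases ht

end CICTyping
end WeakIsoRel

namespace WeakIsoRel

/-! ## A verified type checker for the closed terms of the library -/

/-- A numbering of the constants. -/
def Const.code : Const → ℕ × ℕ × ℕ
  | sigT i j => (0, i, j) | existT i j => (1, i, j)
  | projT1 i j => (2, i, j) | projT2 i j => (3, i, j)
  | prod i j => (4, i, j) | pair i j => (5, i, j)
  | fst i j => (6, i, j) | snd i j => (7, i, j)
  | and => (8, 0, 0) | conj => (9, 0, 0) | proj1 => (10, 0, 0) | proj2 => (11, 0, 0)
  | eq i => (12, i, 0) | eqRefl i => (13, i, 0) | eqRect i j => (14, i, j)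
  | proofIrrelevance => (15, 0, 0)
  | funext i j => (16, i, j)

theorem Const.code_injective : Function.Injective Const.code := by
  intro k k' h
  cases k <;> cases k' <;> simp_all [Const.code]

/-- Comparison of numerical codes by `Nat.beq` keeps evaluation in the kernel cheap. -/
def Const.beq (k k' : Const) : Bool :=
  Nat.beq k.code.1 k'.code.1 && Nat.beq k.code.2.1 k'.code.2.1 && Nat.beq k.code.2.2 k'.code.2.2

theorem Const.eq_of_beq {k k' : Const} (h : k.beq k' = true) : k = k' := by
  simp only [Const.beq, Bool.and_eq_true, Nat.beq_eq] at h
  exact Const.code_injective (Prod.ext h.1.1 (Prod.ext h.1.2 h.2))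

def Srt.beq : Srt → Srt → Bool
  | .prop, .prop => true
  | .type i, .type j => Nat.beq i j
  | _, _ => false

theorem Srt.eq_of_beq {s s' : Srt} (h : s.beq s' = true) : s = s' := by
  cases s <;> cases s' <;> simp_all [Srt.beq]

def Srt.ble : Srt → Srt → Bool
  | .prop, _ => true
  | .type _, .prop => false
  | .type i, .type j => Nat.ble i j

theorem Srt.le_of_ble {s s' : Srt} (h : s.ble s' = true) : Srt.le s s' := by
  cases s <;> cases s' <;> simp_all [Srt.ble, Srt.le]

/-- The class and the number of a variable. -/
def Var.code : Var → ℕ × ℕ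
  | .one x => (0, x) | .prime x => (1, x) | .rel x => (2, x) | .four x => (3, x)
  | .five x => (4, x) | .anon => (5, 0)

def Var.beq (x y : Var) : Bool :=
  Nat.beq x.code.1 y.code.1 && Nat.beq x.code.2 y.code.2

theorem Var.eq_of_beq {x y : Var} (h : x.beq y = true) : x = y := by
  cases x <;> cases y <;> simp_all [Var.beq, Var.code]

def Tgt.beq : Tgt → Tgt → Bool
  | .var x, .var y => x.beq y
  | .sort s, .sort s' => s.beq s'
  | .pi x A B, .pi x' A' B' => x.beq x' && A.beq A' && B.beq B'
  | .lam x A B, .lam x' A' B' => x.beq x' && A.beq A' && B.beq B'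
  | .app A B, .app A' B' => A.beq A' && B.beq B'
  | .const k, .const k' => k.beq k'
  | _, _ => false

theorem Tgt.eq_of_beq {t u : Tgt} (h : t.beq u = true) : t = u := by
  induction t generalizing u <;> cases u <;>
    simp_all [Tgt.beq] <;> grind [Var.eq_of_beq, Srt.eq_of_beq, Const.eq_of_beq]

/-- Whether all free variables of a term are among those given. -/
def Tgt.closedIn : List Var → Tgt → Bool
  | l, .var x => l.any x.beq
  | _, .sort _ => true
  | l, .pi x A B => A.closedIn l && B.closedIn (x :: l)
  | l, .lam x A B => A.closedIn l && B.closedIn (x :: l)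
  | l, .app A B => A.closedIn l && B.closedIn l
  | _, .const _ => true

/-- The index of a variable is its first position, so a term whose free variables are all found in
`l` does not see the binders beyond. -/
theorem Tgt.toDB_append {t : Tgt} : ∀ {l : List Var} (m), t.closedIn l = true →
    t.toDB (l ++ m) = t.toDB l := by
  have mem {l : List Var} {x} (h : l.any x.beq = true) : x ∈ l := by
    obtain ⟨y, hy, h⟩ := List.any_eq_true.1 h
    exact Var.eq_of_beq h ▸ hy
  induction t with
  | var x => exact fun m h => by simp only [toDB, List.idxOf_append_of_mem (mem h)]
  | sort | const => exact fun _ _ => rfl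
  | pi x A B ihA ihB | lam x A B ihA ihB =>
    intro l m h
    simp only [closedIn, Bool.and_eq_true] at h
    simp only [toDB, ihA m h.1, ← List.cons_append, ihB m h.2]
  | app A B ihA ihB =>
    intro l m h
    simp only [closedIn, Bool.and_eq_true] at h
    simp only [toDB, ihA m h.1, ihB m h.2]

/-- For `l = []` the condition on `σ` is empty, so closed library terms are fixed by all
substitutions. -/
theorem Tgt.toDB_subst {t : Tgt} : ∀ {l : List Var} {σ : ℕ → DB}, t.closedIn l = true →
    (∀ n, n < l.length → σ n = .bvar n) → (t.toDB l).subst σ = t.toDB l := by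
  have mem {l : List Var} {x} (h : l.any x.beq = true) : x ∈ l := by
    obtain ⟨y, hy, h⟩ := List.any_eq_true.1 h
    exact Var.eq_of_beq h ▸ hy
  have up {n : ℕ} {σ : ℕ → DB} (h : ∀ k, k < n → σ k = .bvar k) (k) (hk : k < n + 1) :
      DB.up σ k = .bvar k := by
    cases k with
    | zero => rfl
    | succ k => rw [DB.up_succ, h k (by omega)]; rfl
  induction t with
  | var x => exact fun h hσ => by simp only [toDB, DB.subst, hσ _ (List.idxOf_lt_length_of_mem (mem h))]
  | sort | const => exact fun _ _ => rfl
  | pi x A B ihA ihB | lam x A B ihA ihB =>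
    intro l m h hσ
    simp only [closedIn, Bool.and_eq_true] at h
    simp only [toDB, DB.subst, ihA h.1 hσ, ihB h.2 (up hσ)]
  | app A B ihA ihB =>
    intro l m h hσ
    simp only [closedIn, Bool.and_eq_true] at h
    simp only [toDB, DB.subst, ihA h.1 hσ, ihB h.2 hσ]

/-- The closed terms that the checker treats as defined constants. -/
inductive Lib : Type
  | total | oneToOne | isoRel | mkIsoRel | projRel | isoTot | isoOne
  | fwd | fwdRel | bwd | bwdRel | oneR | oneL

def Lib.tm : Lib → Tgt
  | total => WeakIsoRel.total | oneToOne => WeakIsoRel.oneToOne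
  | isoRel => WeakIsoRel.isoRel | mkIsoRel => WeakIsoRel.mkIsoRel
  | projRel => WeakIsoRel.projRel | isoTot => WeakIsoRel.isoTot | isoOne => WeakIsoRel.isoOne
  | fwd => WeakIsoRel.fwd | fwdRel => WeakIsoRel.fwdRel
  | bwd => WeakIsoRel.bwd | bwdRel => WeakIsoRel.bwdRel
  | oneR => WeakIsoRel.oneR | oneL => WeakIsoRel.oneL

def Lib.code : Lib → ℕ
  | total => 0 | oneToOne => 1 | isoRel => 2 | mkIsoRel => 3 | projRel => 4 | isoTot => 5
  | isoOne => 6 | fwd => 7 | fwdRel => 8 | bwd => 9 | bwdRel => 10 | oneR => 11 | oneL => 12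

theorem Lib.code_injective : Function.Injective Lib.code := by
  intro k k' h
  cases k <;> cases k' <;> simp_all [Lib.code]

def Lib.all : List Lib :=
  [total, oneToOne, isoRel, mkIsoRel, projRel, isoTot, isoOne, fwd, fwdRel, bwd, bwdRel, oneR, oneL]

theorem Lib.closedIn (k : Lib) : k.tm.closedIn [] = true := by
  cases k <;> decide +kernel

/-- Terms of the target in which closed library terms may be abbreviated. -/
inductive LTerm : Type
  | bvar (n : ℕ) | sort (s : Srt) | pi (A B : LTerm) | lam (A b : LTerm) | app (f a : LTerm)
  | const (k : Const) | lib (k : Lib)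

namespace LTerm

def toDB : LTerm → DB
  | bvar n => .bvar n
  | sort s => .sort s
  | pi A B => .pi A.toDB B.toDB
  | lam A B => .lam A.toDB B.toDB
  | app A B => .app A.toDB B.toDB
  | const k => .const k
  | lib k => k.tm.toDB []

def beq : LTerm → LTerm → Bool
  | bvar n, bvar m => Nat.beq n m
  | sort s, sort s' => s.beq s'
  | pi A B, pi A' B' => A.beq A' && B.beq B'
  | lam A B, lam A' B' => A.beq A' && B.beq B'
  | app A B, app A' B' => A.beq A' && B.beq B'
  | const k, const k' => k.beq k'
  | lib k, lib k' => Nat.beq k.code k'.code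
  | _, _ => false

theorem eq_of_beq {t u : LTerm} (h : t.beq u = true) : t = u := by
  induction t generalizing u <;> cases u <;>
    simp_all [beq] <;> grind [Srt.eq_of_beq, Const.eq_of_beq, Lib.code_injective.eq_iff]

/-- Abbreviates the library terms in a named term, at the root only if `top`. -/
def absorb : Bool → List Var → Tgt → LTerm
  | top, l, t =>
    match (if top then Lib.all.find? (fun k => t.beq k.tm) else none) with
    | some k => lib k
    | none =>
      match t with
      | .var x => bvar (l.idxOf x)
      | .sort s => sort s
      | .pi x A B => pi (absorb true l A) (absorb true (x :: l) B)
      | .lam x A B => lam (absorb true l A) (absorb true (x :: l) B)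
      | .app A B => app (absorb true l A) (absorb true l B)
      | .const k => const k

/-- Abbreviations match only closed terms, whose de Bruijn form is the same under any binders. Hence
abbreviating and unfolding are equalities after `toDB`, not mere conversions. -/
theorem toDB_absorb (t : Tgt) : ∀ top l, (absorb top l t).toDB = t.toDB l := by
  have root {t : Tgt} {top : Bool} {k} (l : List Var)
      (h : (if top then Lib.all.find? (fun k => t.beq k.tm) else none) = some k) :
      (lib k).toDB = t.toDB l := by
    split at h
    · have h := List.find?_some h
      rw [Tgt.eq_of_beq h]
      exact (Tgt.toDB_append l k.closedIn).symm
    · cases h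
  induction t <;> intro top l <;> unfold absorb <;> split
  all_goals first
    | (rename_i h; exact root l h)
    | simp_all only [toDB, Tgt.toDB]

/-- Weakening with a numerical cutoff in place of a function on indices, for the sake of evaluation.
-/
def shiftAt : ℕ → LTerm → LTerm
  | c, bvar n => if Nat.ble c n then bvar (n + 1) else bvar n
  | _, sort s => sort s
  | c, pi A B => pi (shiftAt c A) (shiftAt (c + 1) B)
  | c, lam A B => lam (shiftAt c A) (shiftAt (c + 1) B)
  | c, app A B => app (shiftAt c A) (shiftAt c B)
  | _, const k => const k
  | _, lib k => lib k

/-- Indices below the cutoff are local, the cutoff itself receives the value, and larger ones drop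
by one because the instantiated binder disappears. -/
def instAt : ℕ → LTerm → LTerm → LTerm
  | c, v, bvar n => if Nat.ble (n + 1) c then bvar n else if Nat.ble n c then v else bvar (n - 1)
  | _, _, sort s => sort s
  | c, v, pi A B => pi (instAt c v A) (instAt (c + 1) (shiftAt 0 v) B)
  | c, v, lam A B => lam (instAt c v A) (instAt (c + 1) (shiftAt 0 v) B)
  | c, v, app A B => app (instAt c v A) (instAt c v B)
  | _, _, const k => const k
  | _, _, lib k => lib k

theorem lib_subst (k : Lib) (σ) : (k.tm.toDB []).subst σ = k.tm.toDB [] :=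
  Tgt.toDB_subst k.closedIn (by simp)

theorem lib_rename (k : Lib) (ρ) : (k.tm.toDB []).rename ρ = k.tm.toDB [] := by
  rw [DB.rename_eq_subst, lib_subst]

theorem toDB_shiftAt (t : LTerm) : ∀ c,
    (shiftAt c t).toDB = t.toDB.rename (fun n => if c ≤ n then n + 1 else n) := by
  have up (c) : DB.upRen (fun n => if c ≤ n then n + 1 else n) =
      (fun n => if c + 1 ≤ n then n + 1 else n) := by
    funext n; cases n <;> simp; split <;> rfl
  induction t with
  | bvar n => intro c; simp only [shiftAt, Nat.ble_eq, toDB, DB.rename]; split <;> rfl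
  | lib k => exact fun _ => (lib_rename _ _).symm
  | _ => intro c; simp_all [shiftAt, toDB, DB.rename]

theorem toDB_shift (t : LTerm) : (shiftAt 0 t).toDB = t.toDB.shift := by
  rw [toDB_shiftAt]; rfl

theorem toDB_instAt (t : LTerm) : ∀ c v, (instAt c v t).toDB = t.toDB.subst (fun n =>
    if n < c then .bvar n else if n = c then v.toDB else .bvar (n - 1)) := by
  have up (c : ℕ) (v : DB) : DB.up (fun n =>
      if n < c then .bvar n else if n = c then v else .bvar (n - 1)) =
      (fun n => if n < c + 1 then .bvar n else if n = c + 1 then v.shift else .bvar (n - 1)) := by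
    funext n
    cases n with
    | zero => simp
    | succ n =>
      simp only [DB.up_succ, Nat.add_lt_add_iff_right, Nat.add_right_cancel_iff]
      split
      · rfl
      split
      · rfl
      · simp only [DB.shift, DB.rename]; congr 1; omega
  induction t with
  | bvar n =>
    intro c v
    simp only [instAt, Nat.ble_eq, toDB, DB.subst, Nat.succ_le_iff]
    split
    · rfl
    split
    · rw [if_pos (by omega)]
    · rw [if_neg (by omega)]; rfl
  | lib k => exact fun _ _ => (lib_subst _ _).symm
  | _ => intro c v; simp_all [instAt, toDB, DB.subst, toDB_shift]

theorem toDB_inst (v t : LTerm) : (instAt 0 v t).toDB = t.toDB.inst v.toDB := by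
  rw [toDB_instAt, DB.inst_eq]
  refine DB.subst_congr _ fun n => ?_
  cases n <;> simp

/-- Weak head normal form (with a bound on the number of steps); the library terms in `un` are
unfolded. -/
def whnf (un : Lib → Bool) : ℕ → LTerm → LTerm
  | 0, t => t
  | n + 1, t =>
    match t with
    | lib k => match un k with
      -- With abbreviation allowed at the root, unfolding would return the same library term.
      | true => absorb false [] k.tm
      | false => lib k
    | app f a =>
      match whnf un n f with
      | lam _ b => whnf un n (instAt 0 a b)
      | app (app (const (.projT1 i j)) A) P =>
        match whnf un n a with
        | app (app (app (app (const (.existT i' j')) _) _) x) _ =>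
          match Nat.beq i i' && Nat.beq j j' with
          | true => whnf un n x
          | false => app (app (app (const (.projT1 i j)) A) P) a
        | _ => app (app (app (const (.projT1 i j)) A) P) a
      | f' => app f' a
    | t => t

/-- Only soundness is needed: each step is `β`, the `ι`-rule of `projT1` or an unfolding, and
exhausting the bound leaves the term as it is. -/
theorem conv_whnf (un) : ∀ n t, DB.Conv t.toDB (whnf un n t).toDB := by
  intro n
  induction n with
  | zero => exact fun t => .refl _
  | succ n ih =>
    intro t
    unfold whnf
    split
    · split
      · rw [toDB_absorb]; exact .refl _
      · exact .refl _
    · rename_i f a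
      have hf := ih f
      split
      · rename_i A b h
        rw [h] at hf
        refine (hf.app (.refl _)).trans (.trans ?_ (ih _))
        rw [toDB_inst]
        exact .beta
      · rename_i i j A P h
        rw [h] at hf
        have ha := ih a
        split
        · rename_i i' j' A' P' x y h
          rw [h] at ha
          split
          · rename_i h
            simp only [Bool.and_eq_true, Nat.beq_eq] at h
            obtain ⟨rfl, rfl⟩ := h
            exact (hf.app ha).trans (.trans (.red .projT1) (ih _))
          · exact hf.app (.refl _)
        · exact hf.app (.refl _)
      · exact hf.app (.refl _)
    · exact .refl _

/-- Normal form (with a bound on the number of steps). -/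
def nf (un : Lib → Bool) : ℕ → LTerm → LTerm
  | 0, t => t
  | n + 1, t =>
    match whnf un 100 t with
    | pi A B => pi (nf un n A) (nf un n B)
    | lam A B => lam (nf un n A) (nf un n B)
    | app A B => app (nf un n A) (nf un n B)
    | t => t

theorem conv_nf (un) : ∀ n t, DB.Conv t.toDB (nf un n t).toDB := by
  intro n
  induction n with
  | zero => exact fun t => .refl _
  | succ n ih =>
    intro t
    refine (conv_whnf un 100 t).trans ?_
    unfold nf
    split
    · rename_i h; rw [h]; exact .pi (ih _) (ih _)
    · rename_i h; rw [h]; exact .lam (ih _) (ih _)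
    · rename_i h; rw [h]; exact .app (ih _) (ih _)
    · exact .refl _

def isConv (un : Lib → Bool) (t u : LTerm) : Bool := (nf un 100 t).beq (nf un 100 u)

theorem conv_of_isConv {un t u} (h : isConv un t u = true) : DB.Conv t.toDB u.toDB :=
  (conv_nf un 100 t).trans (eq_of_beq h ▸ (conv_nf un 100 u).symm)

/-- Subtyping of the target varies only along codomains, so domains are compared for equality. -/
def isCumulNf : LTerm → LTerm → Bool
  | sort s, sort s' => s.ble s'
  | pi A B, pi A' B' => A.beq A' && isCumulNf B B'
  | A, B => A.beq B

theorem cumul_of_isCumulNf {t u : LTerm} (h : isCumulNf t u = true) : Cumul t.toDB u.toDB := by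
  have eq {t u : LTerm} (h : t.beq u = true) : Cumul t.toDB u.toDB :=
    LTerm.eq_of_beq h ▸ .refl _
  induction t generalizing u with
  | sort s =>
    cases u with
    | sort => exact .sort (Srt.le_of_ble h)
    | _ => exact eq h
  | pi A B _ ih =>
    cases u with
    | pi =>
      simp only [isCumulNf, Bool.and_eq_true] at h
      exact eq_of_beq h.1 ▸ .pi (.refl _) (ih h.2)
    | _ => exact eq h
  | _ => exact eq h

/-- Syntactic equality is tried first, which spares normalizing. -/
def isCumul (un : Lib → Bool) (t u : LTerm) : Bool :=
  t.beq u || isCumulNf (nf un 100 t) (nf un 100 u)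

theorem cumul_of_isCumul {un t u} (h : isCumul un t u = true) : Cumul t.toDB u.toDB := by
  rcases Bool.or_eq_true _ _ ▸ h with h | h
  · exact eq_of_beq h ▸ .refl _
  · exact (Cumul.conv (conv_nf un 100 t)).trans
      ((cumul_of_isCumulNf h).trans (.conv (conv_nf un 100 u).symm))

def asSort (un : Lib → Bool) (t : LTerm) : Option Srt :=
  match whnf un 100 t with
  | sort s => some s
  | _ => none

def lookup : List LTerm → ℕ → Option LTerm
  | [], _ => none
  | A :: _, 0 => some (shiftAt 0 A)
  | _ :: Γ, n + 1 =>
    match lookup Γ n with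
    | some A => some (shiftAt 0 A)
    | none => none

/-- The signature that is used in checking: the constants and the types of library terms. -/
structure Sig where
  isConst : Const → Bool
  libType : Lib → Option LTerm

/-- Infers a type. -/
def infer (S : Sig) (un : Lib → Bool) : ℕ → List LTerm → LTerm → Option LTerm
  | 0, _, _ => none
  | m + 1, Γ, t =>
    match t with
    | bvar n => lookup Γ n
    | sort s => some (sort s.succ)
    | const k => match S.isConst k with
      | true => some (absorb true [] k.type)
      | false => none
    | lib k => S.libType k
    | pi A B =>
      match infer S un m Γ A with
      | none => none
      | some T => match asSort un T with
        | none => none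
        | some s => match infer S un m (A :: Γ) B with
          | none => none
          | some T => match asSort un T with
            | none => none
            | some s' => some (sort (s.prod s'))
    | lam A B =>
      match infer S un m Γ A with
      | none => none
      | some T => match asSort un T with
        | none => none
        | some _ => match infer S un m (A :: Γ) B with
          | none => none
          | some T => some (pi A T)
    | app f a =>
      match infer S un m Γ f with
      | none => none
      | some (pi A B) => match infer S un m Γ a with
        | none => none
        | some A' => match isCumul un A' A with
          | true => some (instAt 0 a B)
          | false => none
      | some T => match whnf un 100 T with
        -- The product is only a reduct of the inferred type. Inferring its own type again avoids
        -- any appeal to subject reduction in the target.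
        | pi A B => match infer S un m Γ (pi A B) with
          | none => none
          | some _ => match infer S un m Γ a with
            | none => none
            | some A' => match isCumul un A' A with
              | true => some (instAt 0 a B)
              | false => none
        | _ => none

/-- Checks that `T` is a type. -/
def checkType (S : Sig) (un : Lib → Bool) (Γ : List LTerm) (T : LTerm) : Bool :=
  match infer S un 300 Γ T with
  | some K => (asSort un K).isSome
  | none => false

/-- Checks that `t` has type `T` and that `T` is a type. -/
def check (S : Sig) (un : Lib → Bool) (Γ : List LTerm) (t T : LTerm) : Bool :=
  checkType S un Γ T && match infer S un 300 Γ t with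
    | some T' => isCumul un T' T
    | none => false

end LTerm
end WeakIsoRel

namespace WeakIsoRel

/-- The empty context declares nothing, so the identity is a renaming from it into any well-formed
context. -/
theorem CICTyping.of_nil {t T : DB} (h : CICTyping [] t T) {Γ : List DB} (hΓ : CICCtx Γ) :
    CICTyping Γ t T := by
  simpa using h.rename hΓ (ρ := fun n => n) (fun n A h => by cases h)

/-! ### Soundness of the type checker. -/

namespace LTerm

/-- Types of library terms and of constants are required to have a universe, because conversion and
cumulativity ask for one of the target type. -/
structure Sig.Sound (S : Sig) : Prop where
  const {k} : S.isConst k = true → ∃ s, CICTyping [] (k.type.toDB []) (.sort s)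
  lib {k T} : S.libType k = some T →
    CICTyping [] (k.tm.toDB []) T.toDB ∧ ∃ s, CICTyping [] T.toDB (.sort s)

theorem conv_asSort {un t s} (h : asSort un t = some s) : DB.Conv t.toDB (.sort s) := by
  have := conv_whnf un 100 t
  unfold asSort at h
  split at h
  · rename_i e; cases h; rwa [e] at this
  · cases h

theorem lookup_sound {Γ : List LTerm} : ∀ {n A}, lookup Γ n = some A →
    DB.Lookup (Γ.map toDB) n A.toDB := by
  induction Γ with
  | nil => intro n A h; simp [lookup] at h
  | cons B Γ ih =>
    intro n A h
    cases n with
    | zero => simp only [lookup, Option.some.injEq] at h; subst h; rw [toDB_shift]; exact .zero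
    | succ n =>
      simp only [lookup] at h
      split at h
      · cases h; rw [toDB_shift]; exact .succ (ih ‹_›)
      · cases h

theorem _root_.WeakIsoRel.CICCtx.lookup {Γ : List DB} (hΓ : CICCtx Γ) {n A}
    (h : DB.Lookup Γ n A) : ∃ s, CICTyping Γ A (.sort s) := by
  induction h with
  | zero => cases hΓ with | cons _ h => exact ⟨_, h.weak h⟩
  | succ _ ih =>
    cases hΓ with
    | cons hΓ h => obtain ⟨s, hB⟩ := ih hΓ; exact ⟨s, hB.weak h⟩

/-- The induction also shows that the inferred type is a type; otherwise the inferred product could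
not be inverted in the case of an application. -/
theorem infer_sound {S : Sig} (hS : S.Sound) {un} : ∀ {m Γ t T}, CICCtx (Γ.map toDB) →
    infer S un m Γ t = some T → CICTyping (Γ.map toDB) t.toDB T.toDB ∧
      ∃ s, CICTyping (Γ.map toDB) T.toDB (.sort s) := by
  intro m
  induction m with
  | zero => intro Γ t T _ h; simp [infer] at h
  | succ m ih =>
    intro Γ t T hΓ h
    have sort {Γ t T s} (hΓ : CICCtx (Γ.map toDB)) (h : infer S un m Γ t = some T)
        (hs : asSort un T = some s) : CICTyping (Γ.map toDB) t.toDB (.sort s) :=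
      (ih hΓ h).1.cumul (CICTyping.sort' hΓ _) (.conv (conv_asSort hs))
    cases t with
    | bvar n =>
      have := lookup_sound h
      exact ⟨.lookup hΓ this, hΓ.lookup this⟩
    | sort s => cases h; exact ⟨.sort' hΓ _, _, .sort' hΓ _⟩
    | const k =>
      simp only [infer] at h
      split at h
      · cases h
        rw [toDB_absorb]
        obtain ⟨s, hs⟩ := hS.const ‹_›
        exact ⟨CICTyping.const.of_nil hΓ, s, hs.of_nil hΓ⟩
      · cases h
    | lib k =>
      obtain ⟨h, s, hs⟩ := hS.lib h
      exact ⟨h.of_nil hΓ, s, hs.of_nil hΓ⟩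
    | pi A B =>
      simp only [infer] at h
      repeat' split at h
      all_goals cases h
      have hA := sort hΓ ‹_› ‹_›
      have hB := sort (Γ := A :: Γ) (hΓ.cons hA) ‹_› ‹_›
      exact ⟨.pi hA hB, _, .sort' hΓ _⟩
    | lam A B =>
      simp only [infer] at h
      repeat' split at h
      all_goals cases h
      have hA := sort hΓ ‹_› ‹_›
      obtain ⟨hB, s, hT⟩ := ih (Γ := A :: Γ) (hΓ.cons hA) ‹_›
      exact ⟨.lam hB (.pi hA hT), _, .pi hA hT⟩
    | app f a =>
      have app {A B A' : LTerm} (hf : CICTyping (Γ.map toDB) f.toDB (DB.pi A.toDB B.toDB))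
          (hs : ∃ s, CICTyping (Γ.map toDB) (DB.pi A.toDB B.toDB) (.sort s))
          (ha : infer S un m Γ a = some A') (h : isCumul un A' A = true) :
          CICTyping (Γ.map toDB) (app f a).toDB (instAt 0 a B).toDB ∧
            ∃ s, CICTyping (Γ.map toDB) (instAt 0 a B).toDB (.sort s) := by
        obtain ⟨s, hs⟩ := hs
        obtain ⟨s, s', hA, hB⟩ := hs.pi_inv
        have ha := (ih hΓ ha).1.cumul hA (cumul_of_isCumul h)
        rw [toDB_inst]
        exact ⟨.app hf ha, _, hB.inst ha⟩
      simp only [infer] at h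
      repeat' split at h
      all_goals cases h
      · rename_i hf _ _ ha _ hc
        obtain ⟨hf, hs⟩ := ih hΓ hf
        exact app hf hs ha hc
      · rename_i T _ hT _ _ _ hw _ _ hp _ _ ha _ hc
        obtain ⟨hf, hs⟩ := ih hΓ hT
        obtain ⟨s, s', hA, hB⟩ := (ih hΓ hp).1.pi_inv
        refine app (hf.cumul (.pi hA hB) (.conv ?_)) ⟨_, .pi hA hB⟩ ha hc
        have := conv_whnf un 100 T
        rwa [hw] at this

theorem checkType_sound {S : Sig} (hS : S.Sound) {un Γ T} (hΓ : CICCtx (Γ.map toDB))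
    (h : checkType S un Γ T = true) : ∃ s, CICTyping (Γ.map toDB) T.toDB (.sort s) := by
  unfold checkType at h
  split at h
  · obtain ⟨s, hs⟩ := Option.isSome_iff_exists.1 h
    exact ⟨s, (infer_sound hS hΓ ‹_›).1.cumul (.sort' hΓ _) (.conv (conv_asSort hs))⟩
  · cases h

theorem check_sound {S : Sig} (hS : S.Sound) {un Γ t T} (hΓ : CICCtx (Γ.map toDB))
    (h : check S un Γ t T = true) : CICTyping (Γ.map toDB) t.toDB T.toDB ∧
      ∃ s, CICTyping (Γ.map toDB) T.toDB (.sort s) := by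
  simp only [check, Bool.and_eq_true] at h
  obtain ⟨s, hT⟩ := checkType_sound hS hΓ h.1
  replace h := h.2
  split at h
  · exact ⟨(infer_sound hS hΓ ‹_›).1.cumul hT (cumul_of_isCumul h), s, hT⟩
  · cases h

/-! ### The constants and the library terms -/

/-- The constants that occur in the library and whose types mention at most `n` layers of other
constants. -/
def isConst (n : ℕ) : Const → Bool
  | .sigT 1 0 | .sigT 0 0 | .prod 0 0 | .and | .eq 0 => Nat.ble 1 n
  | .existT 1 0 | .existT 0 0 | .projT1 1 0 | .projT1 0 0 | .pair 0 0 | .fst 0 0 | .snd 0 0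
  | .conj | .proj1 | .proj2 | .eqRect 0 0 | .proofIrrelevance | .funext 0 0 => Nat.ble 2 n
  | .projT2 1 0 | .projT2 0 0 => Nat.ble 3 n
  | _ => false

def constSig (n : ℕ) : Sig := ⟨isConst n, fun _ => none⟩

/-- Typing of a constant is an axiom, but its type must be shown to be a type, and that type
mentions other constants; so constants are admitted in layers. -/
theorem constSig_sound_succ {n : ℕ} (hn : (constSig n).Sound)
    (h : ∀ k, isConst (n + 1) k = true →
      checkType (constSig n) (fun _ => false) [] (absorb true [] k.type) = true) :
    (constSig (n + 1)).Sound := by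
  refine ⟨fun {k} hk => ?_, fun h => by cases h⟩
  simpa only [toDB_absorb, List.map] using checkType_sound hn (Γ := []) .nil (h k hk)

/-- The layers are the type formers, then the constructors, axioms and eliminators over them, and
last `projT2`, whose type mentions `projT1`. -/
theorem constSig_sound : (constSig 3).Sound := by
  refine constSig_sound_succ (constSig_sound_succ (constSig_sound_succ
    ⟨fun {k} h => ?_, fun h => by cases h⟩ ?_) ?_) ?_
  · simp only [constSig, isConst] at h
    split at h <;> simp at h
  all_goals
    intro k h
    simp only [isConst] at h
    split at h <;> first | (exfalso; revert h; decide) | decide +kernel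

/-- The types of the library terms. -/
def _root_.WeakIsoRel.Lib.type : Lib → Tgt :=
  let A : Var := .one 1
  let B : Var := .one 2
  let r : Var := .one 3
  let u : Var := .one 4
  let v : Var := .one 5
  let w : Var := .one 6
  let R (x y : Tgt) : Tgt := .apps projRel [A, B, r, x, y]
  let iso (T : Tgt) : Tgt := .pi A (.Typ 0) (.pi B (.Typ 0) (.pi r (.apps isoRel [A, B]) T))
  fun
  | .total => .pi A (.Typ 0) (.pi B (.Typ 0) ((A ⇒ B ⇒ .Prp) ⇒ .Typ 0))
  | .oneToOne => .pi A (.Typ 0) (.pi B (.Typ 0) ((A ⇒ B ⇒ .Prp) ⇒ .Prp))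
  | .isoRel => .Typ 0 ⇒ .Typ 0 ⇒ .Typ 1
  | .mkIsoRel => .pi A (.Typ 0) (.pi B (.Typ 0) (.pi r (A ⇒ B ⇒ .Prp)
      (.apps total [A, B, r] ⇒ .apps oneToOne [A, B, r] ⇒ .apps isoRel [A, B])))
  | .projRel => iso (A ⇒ B ⇒ .Prp)
  | .isoTot => iso (.apps total [A, B, .apps projRel [A, B, r]])
  | .isoOne => iso (.apps oneToOne [A, B, .apps projRel [A, B, r]])
  | .fwd => iso (A ⇒ B)
  | .fwdRel => iso (.pi u A (R u (.apps fwd [A, B, r, u])))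
  | .bwd => iso (B ⇒ A)
  | .bwdRel => iso (.pi u B (R (.apps bwd [A, B, r, u]) u))
  | .oneR => iso (.pi u A <| .pi v B <| .pi w B <|
      R u v ⇒ R u w ⇒ .apps (.const (.eq 0)) [B, v, w])
  | .oneL => iso (.pi u B <| .pi v A <| .pi w A <|
      R v u ⇒ R w u ⇒ .apps (.const (.eq 0)) [A, v, w])

/-- The library terms to be unfolded in checking a library term. -/
def _root_.WeakIsoRel.Lib.unfolds : Lib → Lib → Bool
  | .mkIsoRel, .isoRel | .projRel, .isoRel => true
  | .isoTot, .isoRel | .isoTot, .projRel | .isoOne, .isoRel | .isoOne, .projRel => true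
  | .fwd, .total | .bwd, .total => true
  | .fwdRel, .total | .fwdRel, .fwd | .bwdRel, .total | .bwdRel, .bwd => true
  | .oneR, .oneToOne | .oneL, .oneToOne => true
  | _, _ => false

/-- The signature with the first `n` library terms. -/
def libSig (n : ℕ) : Sig where
  isConst := isConst 3
  libType k := match Nat.ble (k.code + 1) n with
    | true => some (absorb true [] k.type)
    | false => none

/-- Each library term is checked with the earlier ones as typed constants. Only the few in
`Lib.unfolds` are opened, which keeps normal forms small. -/
theorem check_lib (k : Lib) : check (libSig k.code) k.unfolds []
    (absorb false [] k.tm) (absorb true [] k.type) = true := by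
  cases k <;> decide +kernel

/-- `Lib.code` orders the terms so that each one only uses earlier ones; the induction adds one term
at a time. -/
theorem libSig_sound (n : ℕ) : (libSig n).Sound := by
  induction n with
  | zero => exact ⟨constSig_sound.const, fun {k T} h => by cases h⟩
  | succ n ih =>
    refine ⟨constSig_sound.const, fun {k T} h => ?_⟩
    by_cases hk : k.code = n
    · simp only [libSig] at h
      split at h <;> cases h
      subst hk
      simpa only [toDB_absorb, List.map] using check_sound ih (Γ := []) .nil (check_lib k)
    · refine ih.lib ?_
      simp only [libSig] at h ⊢
      split at h
      · rename_i h'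
        have : Nat.ble (k.code + 1) n = true := by
          rw [Nat.ble_eq] at h' ⊢; omega
        rw [this]; exact h
      · cases h

/-- The signature with all library terms. -/
abbrev fullSig : Sig := libSig 13

theorem fullSig_sound : fullSig.Sound := libSig_sound 13

end LTerm

/-! ## The library terms in use -/

open LTerm

/-- The hypotheses of the combinators for products. -/
def piCtx (s : Srt) : ECtx :=
  [(vBR, .pi va1 vA1 <| .pi va2 vA2 <| relA va1 va2 ⇒ .apps isoRel [.app vB1 va1, .app vB2 va2]),
   (vB2, vA2 ⇒ .sort s), (vB1, vA1 ⇒ .sort s), (vAR, .apps isoRel [vA1, vA2]),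
   (vA2, .Typ 0), (vA1, .Typ 0)]

def absorbCtx : ECtx → List LTerm
  | [] => []
  | (_, A) :: Δ => absorb true (ECtx.names Δ) A :: absorbCtx Δ

theorem toDB_absorbCtx (Δ : ECtx) : (absorbCtx Δ).map toDB = ECtx.toDB Δ := by
  induction Δ with
  | nil => rfl
  | cons p Δ ih => simp only [absorbCtx, List.map, toDB_absorb, ih, ECtx.toDB]

/-- The named terms `t`, `T` check in the context `Δ`. -/
def checkNamed (un : Lib → Bool) (Δ : ECtx) (t T : Tgt) : Bool :=
  check fullSig un (absorbCtx Δ) (absorb true (ECtx.names Δ) t) (absorb true (ECtx.names Δ) T)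

theorem checkNamed_sound {un Δ t T} (hΔ : CICCtx (ECtx.toDB Δ))
    (h : checkNamed un Δ t T = true) :
    CICTyping (ECtx.toDB Δ) (t.toDB (ECtx.names Δ)) (T.toDB (ECtx.names Δ)) := by
  rw [← toDB_absorbCtx] at hΔ ⊢
  simpa only [toDB_absorb] using (check_sound fullSig_sound hΔ h).1

/-- All declarations of a context check. -/
def checkCtx : ECtx → Bool
  | [] => true
  | (_, A) :: Δ => checkCtx Δ &&
      checkType fullSig (fun _ => false) (absorbCtx Δ) (absorb true (ECtx.names Δ) A)

theorem checkCtx_sound {Δ} (h : checkCtx Δ = true) : CICCtx (ECtx.toDB Δ) := by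
  induction Δ with
  | nil => exact .nil
  | cons p Δ ih =>
    simp only [checkCtx, Bool.and_eq_true] at h
    have hΔ := ih h.1
    obtain ⟨s, hs⟩ := checkType_sound fullSig_sound (Γ := absorbCtx Δ)
      (by rwa [toDB_absorbCtx]) h.2
    rw [toDB_absorbCtx, toDB_absorb] at hs
    exact .cons hΔ hs

theorem piCtx_ok : ∀ s ∈ [Srt.prop, .type 0], CICCtx (ECtx.toDB (piCtx s)) := by
  intro s hs
  refine checkCtx_sound ?_
  simp only [List.mem_cons, List.not_mem_nil, or_false] at hs
  rcases hs with rfl | rfl <;> decide +kernel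

/-- The combinators give explicit pairs of proofs, whose types must be compared with the bodies of
`total` and `oneToOne`; everything else can stay opaque. -/
def piUnfolds : Lib → Bool
  | .total | .oneToOne => true
  | _ => false

/-- Enough to compute the first projection of a bundle made by `mkIsoRel`, which discards the proofs
of totality and one-to-oneness. -/
def relUnfolds : Lib → Bool
  | .projRel | .mkIsoRel => true
  | _ => false

/-- The combinator for products in the universe `s`. -/
def piComb : Srt → Tgt
  | .prop => piProp
  | .type _ => piSet

/-- The combinator for products, applied to the hypotheses. -/
def piApp (s : Srt) : Tgt := .apps (piComb s) [vA1, vA2, vAR, vB1, vB2, vBR]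

/-- Checking is done once with variables for the six hypotheses; instances follow by substitution.
-/
theorem piProp_typing : CoqTyping (piCtx .prop) (piApp .prop) (.apps isoRel [prod1, prod2]) :=
  checkNamed_sound (piCtx_ok _ (by simp)) (un := piUnfolds) (by decide +kernel)

theorem piSet_typing :
    CoqTyping (piCtx (.type 0)) (piApp (.type 0)) (.apps isoRel [prod1, prod2]) :=
  checkNamed_sound (piCtx_ok _ (by simp)) (un := piUnfolds) (by decide +kernel)

/-- The variables of the hypotheses of the combinators and of two functions. -/
def relNames : List Var := [vf2, vf1, vBR, vB2, vB1, vAR, vA2, vA1]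

/-- The bundled relation computes to its pointwise definition, since projecting out of an explicit
bundle is `β` and `ι`. -/
theorem projRel_piProp : DB.Conv
    (Tgt.toDB relNames (.apps projRel [prod1, prod2, piApp .prop, vf1, vf2]))
    (Tgt.toDB relNames (relPi vf1 vf2)) := by
  simpa only [toDB_absorb] using conv_of_isConv (un := relUnfolds)
    (t := absorb true relNames (.apps projRel [prod1, prod2, piApp .prop, vf1, vf2]))
    (u := absorb true relNames (relPi vf1 vf2)) (by decide +kernel)

theorem projRel_piSet : DB.Conv
    (Tgt.toDB relNames (.apps projRel [prod1, prod2, piApp (.type 0), vf1, vf2]))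
    (Tgt.toDB relNames (relPi vf1 vf2)) := by
  simpa only [toDB_absorb] using conv_of_isConv (un := relUnfolds)
    (t := absorb true relNames (.apps projRel [prod1, prod2, piApp (.type 0), vf1, vf2]))
    (u := absorb true relNames (relPi vf1 vf2)) (by decide +kernel)

theorem lib_typing (k : Lib) : CICTyping [] (k.tm.toDB []) (k.type.toDB []) := by
  have : (libSig 13).libType k = some (absorb true [] k.type) := by cases k <;> rfl
  simpa only [toDB_absorb] using (fullSig_sound.lib this).1

end WeakIsoRel

namespace WeakIsoRel

/-! ## The source calculus with de Bruijn indices -/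

/-- Raw terms of CoC⁻ with de Bruijn indices. -/
inductive Src : Type
  | bvar (n : ℕ)
  | sort (s : Srt)
  | pi (f g : Flag) (A B : Src)
  | lam (f : Flag) (A b : Src)
  | app (M N : Src)

namespace Src

open DB (upRen)

/-- Renaming of indices. -/
def rename : (ℕ → ℕ) → Src → Src
  | ρ, bvar n => bvar (ρ n)
  | _, sort s => sort s
  | ρ, pi f g A B => pi f g (rename ρ A) (rename (upRen ρ) B)
  | ρ, lam f A b => lam f (rename ρ A) (rename (upRen ρ) b)
  | ρ, app f a => app (rename ρ f) (rename ρ a)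

/-- Weakening by one variable. -/
def shift (t : Src) : Src := rename (fun n => n + 1) t

/-- The action on substitutions under a binder. -/
def up (σ : ℕ → Src) : ℕ → Src
  | 0 => bvar 0
  | n + 1 => shift (σ n)

/-- Parallel substitution. -/
def subst : (ℕ → Src) → Src → Src
  | σ, bvar n => σ n
  | _, sort s => sort s
  | σ, pi f g A B => pi f g (subst σ A) (subst (up σ) B)
  | σ, lam f A b => lam f (subst σ A) (subst (up σ) b)
  | σ, app f a => app (subst σ f) (subst σ a)

/-- The substitution that maps index `0` to `a` and the others by `σ`. -/
def scons (a : Src) (σ : ℕ → Src) : ℕ → Src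
  | 0 => a
  | n + 1 => σ n

/-- Substitution of `a` for the variable with index `0`. -/
def inst (b a : Src) : Src := subst (scons a bvar) b

@[simp] theorem scons_zero (a : Src) (σ) : scons a σ 0 = a := rfl
@[simp] theorem scons_succ (a : Src) (σ) (n : ℕ) : scons a σ (n + 1) = σ n := rfl
@[simp] theorem up_zero (σ) : up σ 0 = bvar 0 := rfl
@[simp] theorem up_succ (σ) (n : ℕ) : up σ (n + 1) = shift (σ n) := rfl

@[simp] theorem rename_id (t : Src) : rename (fun n => n) t = t := by
  induction t <;> simp_all [rename, DB.upRen_id]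

@[simp] theorem rename_rename (t : Src) : ∀ ρ ρ' : ℕ → ℕ,
    rename ρ (rename ρ' t) = rename (fun n => ρ (ρ' n)) t := by
  induction t <;> intros <;> simp_all [rename, DB.upRen_comp]

theorem up_comp_upRen (σ : ℕ → Src) (ρ : ℕ → ℕ) :
    up (fun n => σ (ρ n)) = fun n => up σ (upRen ρ n) := by
  funext n; cases n <;> rfl

@[simp] theorem subst_rename (t : Src) : ∀ (σ : ℕ → Src) (ρ : ℕ → ℕ),
    subst σ (rename ρ t) = subst (fun n => σ (ρ n)) t := by
  induction t <;> intros <;> simp_all [rename, subst, up_comp_upRen]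

theorem up_rename_comp (σ : ℕ → Src) (ρ : ℕ → ℕ) :
    up (fun n => rename ρ (σ n)) = fun n => rename (upRen ρ) (up σ n) := by
  funext n; cases n <;> simp [rename, shift]

@[simp] theorem rename_subst (t : Src) : ∀ (σ : ℕ → Src) (ρ : ℕ → ℕ),
    rename ρ (subst σ t) = subst (fun n => rename ρ (σ n)) t := by
  induction t <;> intros <;> simp_all [rename, subst, up_rename_comp]

theorem up_subst_comp (σ τ : ℕ → Src) :
    up (fun n => subst τ (σ n)) = fun n => subst (up τ) (up σ n) := by
  funext n; cases n <;> simp [subst, shift]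

@[simp] theorem subst_subst (t : Src) : ∀ σ τ : ℕ → Src,
    subst τ (subst σ t) = subst (fun n => subst τ (σ n)) t := by
  induction t <;> intros <;> simp_all [subst, up_subst_comp]

theorem up_bvar : up bvar = bvar := by funext n; cases n <;> rfl

@[simp] theorem subst_bvar (t : Src) : subst bvar t = t := by
  induction t <;> simp_all [subst, up_bvar]

theorem up_bvar_comp (ρ : ℕ → ℕ) : up (fun n => bvar (ρ n)) = fun n => bvar (upRen ρ n) := by
  funext n; cases n <;> rfl

theorem rename_eq_subst (t : Src) : ∀ ρ : ℕ → ℕ, rename ρ t = subst (fun n => bvar (ρ n)) t := by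
  induction t <;> intros <;> simp_all [rename, subst, up_bvar_comp]

theorem subst_congr {σ τ : ℕ → Src} (t : Src) (h : ∀ n, σ n = τ n) : subst σ t = subst τ t := by
  rw [funext h]

theorem subst_up_shift (σ : ℕ → Src) (t : Src) : subst (up σ) (shift t) = shift (subst σ t) := by
  simp [shift, up]

theorem rename_upRen_shift (ρ : ℕ → ℕ) (t : Src) :
    rename (upRen ρ) (shift t) = shift (rename ρ t) := by
  simp [shift]

theorem subst_inst (σ : ℕ → Src) (b a : Src) :
    subst σ (inst b a) = inst (subst (up σ) b) (subst σ a) := by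
  simp only [inst, subst_subst]
  refine subst_congr _ fun n => ?_
  cases n <;> simp [subst, shift]

theorem rename_inst (ρ : ℕ → ℕ) (b a : Src) :
    rename ρ (inst b a) = inst (rename (upRen ρ) b) (rename ρ a) := by
  simp only [inst, subst_rename, rename_subst]
  refine subst_congr _ fun n => ?_
  cases n <;> simp [rename]

@[simp] theorem inst_shift (t a : Src) : inst (shift t) a = t := by
  simp [inst, shift]

/-- One step of `β`-reduction. -/
inductive Red : Src → Src → Prop
  | beta {f A b a} : Red (app (lam f A b) a) (inst b a)
  | piDom {f g A A' B} : Red A A' → Red (pi f g A B) (pi f g A' B)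
  | piCod {f g A B B'} : Red B B' → Red (pi f g A B) (pi f g A B')
  | lamDom {f A A' b} : Red A A' → Red (lam f A b) (lam f A' b)
  | lamBody {f A b b'} : Red b b' → Red (lam f A b) (lam f A b')
  | appFun {f f' a} : Red f f' → Red (app f a) (app f' a)
  | appArg {f a a'} : Red a a' → Red (app f a) (app f a')

/-- `β`-conversion. -/
def Conv : Src → Src → Prop := Relation.EqvGen Red

/-! ## The translation with de Bruijn indices -/

/-- The term without its flags. -/
def emb : Src → DB
  | bvar n => .bvar n
  | sort s => .sort s
  | pi _ _ A B => .pi (emb A) (emb B)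
  | lam _ A b => .lam (emb A) (emb b)
  | app M N => .app (emb M) (emb N)

theorem emb_rename (t : Src) : ∀ ρ, emb (rename ρ t) = (emb t).rename ρ := by
  induction t <;> simp_all [emb, rename, DB.rename]

theorem emb_shift (t : Src) : emb (shift t) = (emb t).shift := emb_rename _ _

theorem emb_subst (t : Src) : ∀ σ, emb (subst σ t) = (emb t).subst (fun n => emb (σ n)) := by
  have (σ : ℕ → Src) : (fun n => emb (up σ n)) = DB.up (fun n => emb (σ n)) := by
    funext n; cases n <;> simp [emb, emb_shift]
  induction t <;> simp_all [emb, subst, DB.subst]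

end Src

namespace DB

/-- `projRel A A' r` for the flags `S` and `P`, and `r` for `T`. -/
def proj (f : Flag) (A A' r : DB) : DB :=
  match f with
  | .T => r
  | _ => app (app (app (projRel.toDB []) A) A') r

/-- The relation underlying `r` at the last two variables, in a context of two more variables. -/
def relDom (f : Flag) (A A' r : DB) : DB :=
  app (app ((proj f A A' r).rename (fun n => n + 2)) (bvar 1)) (bvar 0)

/-- Abstraction over related variables. -/
def lam3 (f : Flag) (A A' r b : DB) : DB := lam A (lam A'.shift (lam (relDom f A A' r) b))

/-- Product over related variables. -/
def pi3 (f : Flag) (A A' r b : DB) : DB := pi A (pi A'.shift (pi (relDom f A A' r) b))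

/-- Index `0` refers to the first of three more variables. -/
def famL : ℕ → ℕ
  | 0 => 2
  | n + 1 => n + 3

/-- Index `0` refers to the second of three more variables. -/
def famR : ℕ → ℕ
  | 0 => 1
  | n + 1 => n + 3

@[simp] theorem famL_zero : famL 0 = 2 := rfl
@[simp] theorem famL_succ (n : ℕ) : famL (n + 1) = n + 3 := rfl
@[simp] theorem famR_zero : famR 0 = 1 := rfl
@[simp] theorem famR_succ (n : ℕ) : famR (n + 1) = n + 3 := rfl

/-- The relatedness of `t` and `t'` as functions, in a context of three more variables. -/
def relBody (g : Flag) (B B' r t t' : DB) : DB :=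
  app (app (proj g (B.rename famL) (B'.rename famR) r)
    (app (t.rename (fun n => n + 3)) (bvar 2))) (app (t'.rename (fun n => n + 3)) (bvar 1))

/-- The translation of a product, from those of its parts. -/
def trPi (f g : Flag) (A A' r B B' r' : DB) : DB :=
  match f.prod g with
  | .P => app (app (app (app (app (app (piProp.toDB []) A) A') r) (lam A B)) (lam A' B'))
      (lam3 f A A' r r')
  | .S => app (app (app (app (app (app (piSet.toDB []) A) A') r) (lam A B)) (lam A' B'))
      (lam3 f A A' r r')
  | .T => lam (pi A B) (lam (pi A' B').shift
      (pi3 f (A.rename (fun n => n + 2)) (A'.rename (fun n => n + 2)) (r.rename (fun n => n + 2))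
        (relBody g (B.rename (upRen fun n => n + 2)) (B'.rename (upRen fun n => n + 2))
          (r'.rename (upRen (upRen (upRen fun n => n + 2)))) (bvar 1) (bvar 0))))

/-- The translation of a universe. -/
def trSort : Srt → DB
  | .type (i + 1) => lam (sort (.type (i + 1))) (lam (sort (.type (i + 1)))
      (pi (bvar 1) (pi (bvar 1) (sort (.type (i + 1))))))
  | s => lam (sort s) (lam (sort s) (app (app (isoRel.toDB []) (bvar 1)) (bvar 0)))

theorem piProp_subst (σ) : (piProp.toDB []).subst σ = piProp.toDB [] :=
  Tgt.toDB_subst (by decide +kernel) (by simp)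

theorem piSet_subst (σ) : (piSet.toDB []).subst σ = piSet.toDB [] :=
  Tgt.toDB_subst (by decide +kernel) (by simp)

theorem projRel_subst (σ) : (projRel.toDB []).subst σ = projRel.toDB [] :=
  LTerm.lib_subst .projRel σ

theorem isoRel_subst (σ) : (isoRel.toDB []).subst σ = isoRel.toDB [] :=
  LTerm.lib_subst .isoRel σ

theorem projRel_rename (σ) : (projRel.toDB []).rename σ = projRel.toDB [] :=
  LTerm.lib_rename .projRel σ

theorem isoRel_rename (σ) : (isoRel.toDB []).rename σ = isoRel.toDB [] :=
  LTerm.lib_rename .isoRel σ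

theorem proj_subst (f A A' r σ) :
    (proj f A A' r).subst σ = proj f (A.subst σ) (A'.subst σ) (r.subst σ) := by
  cases f <;> simp only [proj, subst, projRel_subst]

theorem proj_rename (f A A' r ρ) :
    (proj f A A' r).rename ρ = proj f (A.rename ρ) (A'.rename ρ) (r.rename ρ) := by
  simp only [rename_eq_subst, proj_subst]

theorem relDom_subst (f A A' r σ) :
    (relDom f A A' r).subst (up (up σ)) = relDom f (A.subst σ) (A'.subst σ) (r.subst σ) := by
  simp [relDom, subst, proj_rename, proj_subst, shift_eq, rename]

theorem lam3_subst (f A A' r b σ) : (lam3 f A A' r b).subst σ =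
    lam3 f (A.subst σ) (A'.subst σ) (r.subst σ) (b.subst (up (up (up σ)))) := by
  simp [lam3, subst, relDom_subst, subst_up_shift]

theorem pi3_subst (f A A' r b σ) : (pi3 f A A' r b).subst σ =
    pi3 f (A.subst σ) (A'.subst σ) (r.subst σ) (b.subst (up (up (up σ)))) := by
  simp [pi3, subst, relDom_subst, subst_up_shift]

theorem relBody_subst (g B B' r t t' σ) : (relBody g B B' r t t').subst (up (up (up σ))) =
    relBody g (B.subst (up σ)) (B'.subst (up σ)) (r.subst (up (up (up σ)))) (t.subst σ)
      (t'.subst σ) := by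
  simp only [relBody, subst, proj_subst, subst_rename, rename_subst, up_succ, up_zero, shift_eq,
    rename, rename_rename]
  congr 5
  all_goals
    funext n
    cases n <;> simp [shift_eq, rename]

/-- The combinators are closed, so a substitution only reaches the parts: under one binder for the
families, under three for the relation between them. -/
theorem trPi_subst (f g A A' r B B' r' σ) : (trPi f g A A' r B B' r').subst σ =
    trPi f g (A.subst σ) (A'.subst σ) (r.subst σ) (B.subst (up σ)) (B'.subst (up σ))
      (r'.subst (up (up (up σ)))) := by
  unfold trPi
  cases f.prod g
  · simp only [subst, piSet_subst, lam3_subst]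
  · simp only [subst, piProp_subst, lam3_subst]
  · simp only [subst, pi3_subst, relBody_subst, subst_rename, rename_subst, up_succ,
      up_zero, shift_eq, rename_rename, rename]
    congr 5
    all_goals
      funext n
      rcases n with _ | _ | _ | n <;> simp [shift_eq, rename]

theorem trSort_subst (s σ) : (trSort s).subst σ = trSort s := by
  rcases s with _ | _ | i <;> simp [trSort, subst, isoRel_subst, shift, rename]

theorem trPi_rename (f g A A' r B B' r' ρ) : (trPi f g A A' r B B' r').rename ρ =
    trPi f g (A.rename ρ) (A'.rename ρ) (r.rename ρ) (B.rename (upRen ρ)) (B'.rename (upRen ρ))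
      (r'.rename (upRen (upRen (upRen ρ)))) := by
  simp only [rename_eq_subst, trPi_subst, up_bvar_comp]

theorem lam3_rename (f A A' r b ρ) : (lam3 f A A' r b).rename ρ =
    lam3 f (A.rename ρ) (A'.rename ρ) (r.rename ρ) (b.rename (upRen (upRen (upRen ρ)))) := by
  simp only [rename_eq_subst, lam3_subst, up_bvar_comp]

end DB

/-! ### Commutation of the translation with renaming and substitution. -/

namespace Src

open DB (upRen)

/-- The term with its variables in the first class. -/
def e1 (t : Src) : DB := t.emb.rename fun n => 3 * n + 2

/-- The term with its variables in the second class. -/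
def e2 (t : Src) : DB := t.emb.rename fun n => 3 * n + 1

/-- The scope of a binder, with its variables in the first class. -/
def b1 (t : Src) : DB := t.emb.rename (upRen fun n => 3 * n + 2)

/-- The scope of a binder, with its variables in the second class. -/
def b2 (t : Src) : DB := t.emb.rename (upRen fun n => 3 * n + 1)

/-- The weak IsoRel translation. -/
def tr : Src → DB
  | bvar n => .bvar (3 * n)
  | sort s => DB.trSort s
  | pi f g A B => DB.trPi f g A.e1 A.e2 (tr A) B.b1 B.b2 (tr B)
  | lam f A b => DB.lam3 f A.e1 A.e2 (tr A) (tr b)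
  | app M N => .app (.app (.app (tr M) N.e1) N.e2) (tr N)

/-- The renaming of the translation that belongs to a renaming of the source. -/
def ren3 (ρ : ℕ → ℕ) (n : ℕ) : ℕ := 3 * ρ (n / 3) + n % 3

/-- The substitution of the translation that belongs to a substitution of the source. -/
def sub3 (σ : ℕ → Src) (n : ℕ) : DB :=
  match n % 3 with
  | 0 => (σ (n / 3)).tr
  | 1 => (σ (n / 3)).e2
  | _ => (σ (n / 3)).e1

theorem sub3_zero (σ n) : sub3 σ (3 * n) = (σ n).tr := by
  have h1 : 3 * n % 3 = 0 := by omega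
  have h2 : 3 * n / 3 = n := by omega
  simp only [sub3, h1, h2]

theorem sub3_one (σ n) : sub3 σ (3 * n + 1) = (σ n).e2 := by
  have h1 : (3 * n + 1) % 3 = 1 := by omega
  have h2 : (3 * n + 1) / 3 = n := by omega
  simp only [sub3, h1, h2]

theorem sub3_two (σ n) : sub3 σ (3 * n + 2) = (σ n).e1 := by
  have h1 : (3 * n + 2) % 3 = 2 := by omega
  have h2 : (3 * n + 2) / 3 = n := by omega
  simp only [sub3, h1, h2]

theorem three_cases (n : ℕ) : ∃ k, n = 3 * k ∨ n = 3 * k + 1 ∨ n = 3 * k + 2 :=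
  ⟨n / 3, by omega⟩

/-- One source binder corresponds to three target binders. -/
theorem ren3_upRen (ρ) : ren3 (upRen ρ) = upRen (upRen (upRen (ren3 ρ))) := by
  funext n
  rcases n with _ | _ | _ | n
  · rfl
  · rfl
  · rfl
  · have h1 : (n + 1 + 1 + 1) / 3 = n / 3 + 1 := by omega
    have h2 : (n + 1 + 1 + 1) % 3 = n % 3 := by omega
    simp only [ren3, h1, h2, DB.upRen_succ]
    omega

theorem e1_rename (t : Src) (ρ) : e1 (rename ρ t) = (e1 t).rename (ren3 ρ) := by
  simp only [e1, emb_rename, DB.rename_rename, ren3]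
  refine DB.rename_congr _ fun n => ?_
  have h1 : (3 * n + 2) / 3 = n := by omega
  have h2 : (3 * n + 2) % 3 = 2 := by omega
  rw [h1, h2]

theorem e2_rename (t : Src) (ρ) : e2 (rename ρ t) = (e2 t).rename (ren3 ρ) := by
  simp only [e2, emb_rename, DB.rename_rename, ren3]
  refine DB.rename_congr _ fun n => ?_
  have h1 : (3 * n + 1) / 3 = n := by omega
  have h2 : (3 * n + 1) % 3 = 1 := by omega
  rw [h1, h2]

theorem b1_rename (t : Src) (ρ) : b1 (rename (upRen ρ) t) = (b1 t).rename (upRen (ren3 ρ)) := by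
  simp only [b1, emb_rename, DB.rename_rename]
  refine DB.rename_congr _ fun n => ?_
  rcases n with _ | n
  · rfl
  have h1 : (3 * n + 2) / 3 = n := by omega
  have h2 : (3 * n + 2) % 3 = 2 := by omega
  simp only [DB.upRen_succ, ren3, h1, h2]

theorem b2_rename (t : Src) (ρ) : b2 (rename (upRen ρ) t) = (b2 t).rename (upRen (ren3 ρ)) := by
  simp only [b2, emb_rename, DB.rename_rename]
  refine DB.rename_congr _ fun n => ?_
  rcases n with _ | n
  · rfl
  have h1 : (3 * n + 1) / 3 = n := by omega
  have h2 : (3 * n + 1) % 3 = 1 := by omega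
  simp only [DB.upRen_succ, ren3, h1, h2]

theorem tr_rename (t : Src) : ∀ ρ, tr (rename ρ t) = (tr t).rename (ren3 ρ) := by
  induction t with
  | bvar n =>
    intro ρ
    have h1 : (3 * n) / 3 = n := by omega
    have h2 : (3 * n) % 3 = 0 := by omega
    simp [tr, rename, DB.rename, ren3, h1, h2]
  | sort s => intro ρ; simp only [tr, rename, DB.rename_eq_subst, DB.trSort_subst]
  | pi f g A B ihA ihB =>
    intro ρ
    simp only [tr, rename, ihA, ihB, e1_rename, e2_rename, b1_rename, b2_rename, DB.trPi_rename,
      ren3_upRen]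
  | lam f A B ihA ihB =>
    intro ρ
    simp only [tr, rename, ihA, ihB, e1_rename, e2_rename, DB.lam3_rename, ren3_upRen]
  | app A B ihA ihB =>
    intro ρ
    simp only [tr, rename, ihA, ihB, e1_rename, e2_rename, DB.rename]

theorem ren3_succ : ren3 (fun n => n + 1) = fun n => n + 3 := by
  funext n; simp only [ren3]; omega

theorem tr_shift (t : Src) : tr t.shift = (tr t).rename (fun n => n + 3) := by
  rw [shift, tr_rename, ren3_succ]

theorem e1_shift (t : Src) : e1 t.shift = (e1 t).rename (fun n => n + 3) := by
  rw [shift, e1_rename, ren3_succ]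

theorem e2_shift (t : Src) : e2 t.shift = (e2 t).rename (fun n => n + 3) := by
  rw [shift, e2_rename, ren3_succ]

/-- The variable of a source binder becomes three variables that are fixed; the images of the others
are weakened by three. -/
theorem sub3_up (σ) : sub3 (up σ) = DB.up (DB.up (DB.up (sub3 σ))) := by
  have three (t : DB) : t.shift.shift.shift = t.rename (fun n => n + 3) := by
    simp [DB.shift_eq]
  funext n
  rcases n with _ | _ | _ | n
  · rfl
  · rfl
  · rfl
  · obtain ⟨k, rfl | rfl | rfl⟩ := three_cases n
    · rw [show 3 * k + 1 + 1 + 1 = 3 * (k + 1) by ring, sub3_zero, up_succ, tr_shift,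
        show 3 * (k + 1) = 3 * k + 1 + 1 + 1 by ring]
      simp only [DB.up_succ, three, sub3_zero]
    · rw [show 3 * k + 1 + 1 + 1 + 1 = 3 * (k + 1) + 1 by ring, sub3_one, up_succ, e2_shift,
        show 3 * (k + 1) + 1 = 3 * k + 1 + 1 + 1 + 1 by ring]
      simp only [DB.up_succ, three, sub3_one]
    · rw [show 3 * k + 2 + 1 + 1 + 1 = 3 * (k + 1) + 2 by ring, sub3_two, up_succ, e1_shift,
        show 3 * (k + 1) + 2 = 3 * k + 2 + 1 + 1 + 1 by ring]
      simp only [DB.up_succ, three, sub3_two]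

theorem e1_subst (t : Src) (σ) : e1 (subst σ t) = (e1 t).subst (sub3 σ) := by
  simp only [e1, emb_subst, DB.subst_rename, DB.rename_subst]
  exact DB.subst_congr _ fun n => (sub3_two σ n).symm

theorem e2_subst (t : Src) (σ) : e2 (subst σ t) = (e2 t).subst (sub3 σ) := by
  simp only [e2, emb_subst, DB.subst_rename, DB.rename_subst]
  exact DB.subst_congr _ fun n => (sub3_one σ n).symm

theorem b1_subst (t : Src) (σ) : b1 (subst (up σ) t) = (b1 t).subst (DB.up (sub3 σ)) := by
  simp only [b1, emb_subst, DB.subst_rename, DB.rename_subst]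
  refine DB.subst_congr _ fun n => ?_
  rcases n with _ | n
  · rfl
  · simp only [up_succ, emb_shift, DB.rename_upRen_shift, DB.upRen_succ, DB.up_succ, sub3_two, e1]

theorem b2_subst (t : Src) (σ) : b2 (subst (up σ) t) = (b2 t).subst (DB.up (sub3 σ)) := by
  simp only [b2, emb_subst, DB.subst_rename, DB.rename_subst]
  refine DB.subst_congr _ fun n => ?_
  rcases n with _ | n
  · rfl
  · simp only [up_succ, emb_shift, DB.rename_upRen_shift, DB.upRen_succ, DB.up_succ, sub3_one, e2]

/-- Substituting `u` for `x` amounts to substituting `u`, `u'`, `[[u]]` for `x`, `x'`, `x_R` at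
once. The equality is exact because the translation follows the syntax and flags, not derived types.
-/
theorem tr_subst (t : Src) : ∀ σ, tr (subst σ t) = (tr t).subst (sub3 σ) := by
  induction t with
  | bvar n => intro σ; simp only [tr, subst, DB.subst, sub3_zero]
  | sort s => intro ρ; simp only [tr, subst, DB.trSort_subst]
  | pi f g A B ihA ihB =>
    intro ρ
    simp only [tr, subst, ihA, ihB, e1_subst, e2_subst, b1_subst, b2_subst, DB.trPi_subst, sub3_up]
  | lam f A B ihA ihB =>
    intro ρ
    simp only [tr, subst, ihA, ihB, e1_subst, e2_subst, DB.lam3_subst, sub3_up]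
  | app A B ihA ihB =>
    intro ρ
    simp only [tr, subst, ihA, ihB, e1_subst, e2_subst, DB.subst]

/-- Instantiation of the three variables that come from the variable with index `0`. -/
theorem sub3_scons (a : Src) : sub3 (scons a bvar) =
    DB.scons a.tr (DB.scons a.e2 (DB.scons a.e1 DB.bvar)) := by
  funext n
  rcases n with _ | _ | _ | n
  · rfl
  · rfl
  · rfl
  · obtain ⟨k, rfl | rfl | rfl⟩ := three_cases n
    · rw [show 3 * k + 1 + 1 + 1 = 3 * (k + 1) by ring, sub3_zero]; rfl
    · rw [show 3 * k + 1 + 1 + 1 + 1 = 3 * (k + 1) + 1 by ring, sub3_one]; rfl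
    · rw [show 3 * k + 2 + 1 + 1 + 1 = 3 * (k + 1) + 2 by ring, sub3_two]; rfl

end Src

/-! ### Compatibility of the translation with conversion. -/

namespace DB

/-- Instantiation of the last three variables. -/
def inst3 (b x x' r : DB) : DB := b.subst (scons r (scons x' (scons x bvar)))

/-- Three `β`-steps in succession amount to one simultaneous substitution; this simulates a single
source `β`-step. -/
theorem conv_lam3 (f A A' r b x x' p) :
    Conv (app (app (app (lam3 f A A' r b) x) x') p) (inst3 b x x' p) := by
  have h1 : (lam A'.shift (lam (relDom f A A' r) b)).inst x =
      lam A' (lam ((relDom f A A' r).subst (up (scons x bvar)))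
        (b.subst (up (up (scons x bvar))))) := by
    simp [inst_eq, subst, shift_eq]
  refine ((Conv.beta.app (.refl _)).app (.refl _)).trans ?_
  rw [h1]
  refine (Conv.beta.app (.refl _)).trans ?_
  rw [inst_eq, subst]
  refine Conv.beta.trans (.of_eq ?_)
  simp only [inst_eq, subst_subst, inst3]
  refine subst_congr _ fun n => ?_
  rcases n with _ | _ | _ | n <;> simp [subst, shift_eq]

theorem Conv.proj {f A A' r B B' r'} (hA : Conv A B) (hA' : Conv A' B') (hr : Conv r r') :
    Conv (DB.proj f A A' r) (DB.proj f B B' r') := by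
  cases f
  · exact (((Conv.refl _).app hA).app hA').app hr
  · exact (((Conv.refl _).app hA).app hA').app hr
  · exact hr

theorem Conv.relDom {f A A' r B B' r'} (hA : Conv A B) (hA' : Conv A' B') (hr : Conv r r') :
    Conv (DB.relDom f A A' r) (DB.relDom f B B' r') :=
  (((Conv.proj hA hA' hr).rename _).app (.refl _)).app (.refl _)

theorem Conv.lam3 {f A A' r b B B' r' b'} (hA : Conv A B) (hA' : Conv A' B') (hr : Conv r r')
    (hb : Conv b b') : Conv (DB.lam3 f A A' r b) (DB.lam3 f B B' r' b') :=
  .lam hA (.lam (hA'.rename _) (.lam (.relDom hA hA' hr) hb))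

theorem Conv.pi3 {f A A' r b B B' r' b'} (hA : Conv A B) (hA' : Conv A' B') (hr : Conv r r')
    (hb : Conv b b') : Conv (DB.pi3 f A A' r b) (DB.pi3 f B B' r' b') :=
  .pi hA (.pi (hA'.rename _) (.pi (.relDom hA hA' hr) hb))

theorem Conv.relBody {g A A' r B B' r' t t' u u'} (hA : Conv A B) (hA' : Conv A' B')
    (hr : Conv r r') (ht : Conv t u) (ht' : Conv t' u') :
    Conv (DB.relBody g A A' r t t') (DB.relBody g B B' r' u u') :=
  ((Conv.proj (hA.rename _) (hA'.rename _) hr).app ((ht.rename _).app (.refl _))).app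
    ((ht'.rename _).app (.refl _))

theorem Conv.trPi {f g A A' r B B' r' C C' q D D' q'} (hA : Conv A C) (hA' : Conv A' C')
    (hr : Conv r q) (hB : Conv B D) (hB' : Conv B' D') (hr' : Conv r' q') :
    Conv (DB.trPi f g A A' r B B' r') (DB.trPi f g C C' q D D' q') := by
  unfold DB.trPi
  cases f.prod g
  · exact ((((((Conv.refl _).app hA).app hA').app hr).app (.lam hA hB)).app (.lam hA' hB')).app
      (.lam3 hA hA' hr hr')
  · exact ((((((Conv.refl _).app hA).app hA').app hr).app (.lam hA hB)).app (.lam hA' hB')).app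
      (.lam3 hA hA' hr hr')
  · exact .lam (.pi hA hB) (.lam ((Conv.pi hA' hB').rename _) (.pi3 (hA.rename _) (hA'.rename _)
      (hr.rename _) (.relBody (hB.rename _) (hB'.rename _) (hr'.rename _) (.refl _) (.refl _))))

end DB

namespace Src

theorem Red.emb {t u : Src} (h : Red t u) : DB.Conv t.emb u.emb := by
  induction h with
  | @beta f A b a =>
    have : (inst b a).emb = b.emb.inst a.emb := by
      rw [inst, emb_subst, DB.inst_eq]
      refine DB.subst_congr _ fun n => ?_
      cases n <;> rfl
    rw [this]
    exact .beta
  | piDom _ ih => exact .pi ih (.refl _)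
  | piCod _ ih => exact .pi (.refl _) ih
  | lamDom _ ih => exact .lam ih (.refl _)
  | lamBody _ ih => exact .lam (.refl _) ih
  | appFun _ ih => exact .app ih (.refl _)
  | appArg _ ih => exact .app (.refl _) ih

/-- At a redex the translation has three `β`-redexes, whose contraction gives the translated
instance by `tr_subst`. Elsewhere, a part that reduces occurs also in unprimed and primed copies, so
one step may become several. -/
theorem Red.tr {t u : Src} (h : Red t u) : DB.Conv t.tr u.tr := by
  induction h with
  | @beta f A b a =>
    rw [inst, tr_subst, sub3_scons]
    exact DB.conv_lam3 ..
  | piDom h ih => exact .trPi (h.emb.rename _) (h.emb.rename _) ih (.refl _) (.refl _) (.refl _)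
  | piCod h ih => exact .trPi (.refl _) (.refl _) (.refl _) (h.emb.rename _) (h.emb.rename _) ih
  | lamDom h ih => exact .lam3 (h.emb.rename _) (h.emb.rename _) ih (.refl _)
  | lamBody _ ih => exact .lam3 (.refl _) (.refl _) (.refl _) ih
  | appFun _ ih => exact ((ih.app (.refl _)).app (.refl _)).app (.refl _)
  | appArg h ih =>
    exact ((DB.Conv.app (.refl _) (h.emb.rename _)).app (h.emb.rename _)).app ih

theorem Conv.map {t u : Src} (F : Src → DB) (hF : ∀ {a b}, Red a b → DB.Conv (F a) (F b))
    (h : Conv t u) : DB.Conv (F t) (F u) := by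
  induction h with
  | rel _ _ h => exact hF h
  | refl => exact .refl _
  | symm _ _ _ ih => exact ih.symm
  | trans _ _ _ _ _ ih ih' => exact ih.trans ih'

theorem Conv.emb {t u : Src} (h : Conv t u) : DB.Conv t.emb u.emb := h.map _ Red.emb
theorem Conv.e1 {t u : Src} (h : Conv t u) : DB.Conv t.e1 u.e1 := h.emb.rename _
theorem Conv.e2 {t u : Src} (h : Conv t u) : DB.Conv t.e2 u.e2 := h.emb.rename _
theorem Conv.tr {t u : Src} (h : Conv t u) : DB.Conv t.tr u.tr := h.map _ Red.tr

end Src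
end WeakIsoRel

namespace WeakIsoRel

/-! ## Confluence of the source calculus -/

namespace Src

open DB (upRen)

theorem Red.subst {t u : Src} (h : Red t u) : ∀ σ, Red (Src.subst σ t) (Src.subst σ u) := by
  induction h with
  | beta => intro σ; rw [subst_inst]; exact .beta
  | piDom _ ih => exact fun σ => .piDom (ih σ)
  | piCod _ ih => exact fun σ => .piCod (ih _)
  | lamDom _ ih => exact fun σ => .lamDom (ih σ)
  | lamBody _ ih => exact fun σ => .lamBody (ih _)
  | appFun _ ih => exact fun σ => .appFun (ih σ)
  | appArg _ ih => exact fun σ => .appArg (ih σ)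

theorem Conv.refl (t : Src) : Conv t t := Relation.EqvGen.refl t
theorem Conv.symm {t u : Src} (h : Conv t u) : Conv u t := Relation.EqvGen.symm _ _ h
theorem Conv.trans {t u v : Src} (h : Conv t u) (h' : Conv u v) : Conv t v :=
  Relation.EqvGen.trans _ _ _ h h'
theorem Conv.red {t u : Src} (h : Red t u) : Conv t u := Relation.EqvGen.rel _ _ h

theorem Conv.congr {t u : Src} (F : Src → Src) (hF : ∀ {a b}, Red a b → Red (F a) (F b))
    (h : Conv t u) : Conv (F t) (F u) := by
  induction h with
  | rel _ _ h => exact .red (hF h)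
  | refl => exact .refl _
  | symm _ _ _ ih => exact ih.symm
  | trans _ _ _ _ _ ih ih' => exact ih.trans ih'

theorem Conv.subst {t u : Src} (h : Conv t u) (σ) : Conv (Src.subst σ t) (Src.subst σ u) :=
  h.congr _ fun h => h.subst σ

theorem Conv.rename {t u : Src} (h : Conv t u) (ρ) : Conv (Src.rename ρ t) (Src.rename ρ u) := by
  simpa only [rename_eq_subst] using h.subst _

theorem Conv.shift {t u : Src} (h : Conv t u) : Conv t.shift u.shift := h.rename _

theorem Conv.app {f f' a a' : Src} (h : Conv f f') (h' : Conv a a') :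
    Conv (.app f a) (.app f' a') :=
  (h.congr (Src.app · a) .appFun).trans (h'.congr (Src.app f' ·) .appArg)

theorem Conv.pi {f g A A' B B'} (h : Conv A A') (h' : Conv B B') :
    Conv (.pi f g A B) (.pi f g A' B') :=
  (h.congr (Src.pi f g · B) .piDom).trans (h'.congr (Src.pi f g A' ·) .piCod)

theorem Conv.lam {f A A' b b'} (h : Conv A A') (h' : Conv b b') :
    Conv (.lam f A b) (.lam f A' b') :=
  (h.congr (Src.lam f · b) .lamDom).trans (h'.congr (Src.lam f A' ·) .lamBody)

theorem Conv.up {σ τ : ℕ → Src} (h : ∀ n, Conv (σ n) (τ n)) (n) :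
    Conv (Src.up σ n) (Src.up τ n) := by
  cases n with
  | zero => exact .refl _
  | succ n => exact (h n).shift

theorem Conv.subst_right {σ τ : ℕ → Src} (h : ∀ n, Conv (σ n) (τ n)) (t : Src) :
    Conv (Src.subst σ t) (Src.subst τ t) := by
  induction t generalizing σ τ with
  | bvar n => exact h n
  | sort => exact .refl _
  | pi _ _ _ _ ihA ihB => exact .pi (ihA h) (ihB (.up h))
  | lam _ _ _ ihA ihB => exact .lam (ihA h) (ihB (.up h))
  | app _ _ ihA ihB => exact .app (ihA h) (ihB h)

theorem Conv.inst {b b' a a' : Src} (h : Conv b b') (h' : Conv a a') :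
    Conv (b.inst a) (b'.inst a') := by
  refine (h.subst _).trans (.subst_right (fun n => ?_) _)
  cases n with
  | zero => exact h'
  | succ n => exact .refl _

/-- Parallel `β`-reduction. -/
inductive Par : Src → Src → Prop
  | bvar n : Par (bvar n) (bvar n)
  | sort s : Par (sort s) (sort s)
  | pi {f g A A' B B'} : Par A A' → Par B B' → Par (pi f g A B) (pi f g A' B')
  | lam {f A A' B B'} : Par A A' → Par B B' → Par (lam f A B) (lam f A' B')
  | app {A A' B B'} : Par A A' → Par B B' → Par (app A B) (app A' B')
  | beta {f A b b' a a'} : Par b b' → Par a a' → Par (app (lam f A b) a) (inst b' a')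

theorem Par.refl (t : Src) : Par t t := by
  induction t with
  | bvar n => exact .bvar n
  | sort s => exact .sort s
  | pi _ _ _ _ h h' => exact .pi h h'
  | lam _ _ _ h h' => exact .lam h h'
  | app _ _ h h' => exact .app h h'

theorem Par.rename {t u : Src} (h : Par t u) : ∀ ρ, Par (Src.rename ρ t) (Src.rename ρ u) := by
  induction h with
  | bvar n => exact fun _ => .bvar _
  | sort s => exact fun _ => .sort _
  | pi _ _ h h' => exact fun _ => .pi (h _) (h' _)
  | lam _ _ h h' => exact fun _ => .lam (h _) (h' _)
  | app _ _ h h' => exact fun _ => .app (h _) (h' _)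
  | beta _ _ h h' => intro ρ; rw [rename_inst]; exact .beta (h _) (h' _)

/-- The term and the substituted terms may reduce simultaneously, as the `β` case of `Par.develop`
requires. -/
theorem Par.subst {t u : Src} (h : Par t u) : ∀ {σ τ : ℕ → Src}, (∀ n, Par (σ n) (τ n)) →
    Par (Src.subst σ t) (Src.subst τ u) := by
  have up {σ τ : ℕ → Src} (h : ∀ n, Par (σ n) (τ n)) (n) : Par (Src.up σ n) (Src.up τ n) := by
    cases n with
    | zero => exact .bvar 0
    | succ n => exact (h n).rename _
  induction h with
  | bvar n => exact fun h => h n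
  | sort s => exact fun _ => .sort _
  | pi _ _ h h' => exact fun hσ => .pi (h hσ) (h' (up hσ))
  | lam _ _ h h' => exact fun hσ => .lam (h hσ) (h' (up hσ))
  | app _ _ h h' => exact fun hσ => .app (h hσ) (h' hσ)
  | beta _ _ h h' => intro σ τ hσ; rw [subst_inst]; exact .beta (h (up hσ)) (h' hσ)

theorem Par.inst {b b' a a' : Src} (h : Par b b') (h' : Par a a') : Par (b.inst a) (b'.inst a') := by
  refine h.subst fun n => ?_
  cases n with
  | zero => exact h'
  | succ n => exact .bvar n

theorem Red.par {t u : Src} (h : Red t u) : Par t u := by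
  induction h with
  | beta => exact .beta (.refl _) (.refl _)
  | piDom _ ih => exact .pi ih (.refl _)
  | piCod _ ih => exact .pi (.refl _) ih
  | lamDom _ ih => exact .lam ih (.refl _)
  | lamBody _ ih => exact .lam (.refl _) ih
  | appFun _ ih => exact .app ih (.refl _)
  | appArg _ ih => exact .app (.refl _) ih

/-- The simultaneous reduction of all redexes. -/
def develop : Src → Src
  | bvar n => bvar n
  | sort s => sort s
  | pi f g A B => pi f g (develop A) (develop B)
  | lam f A B => lam f (develop A) (develop B)
  | app (lam _ _ b) a => inst (develop b) (develop a)
  | app M N => app (develop M) (develop N)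

/-- Every parallel reduct of `t` can contract what is left of the redexes of `t`, and so reaches the
complete development. The diamond property is immediate from this. -/
theorem Par.develop {t u : Src} (h : Par t u) : Par u (develop t) := by
  induction h with
  | bvar n => exact .bvar n
  | sort s => exact .sort s
  | pi _ _ h h' => exact .pi h h'
  | lam _ _ h h' => exact .lam h h'
  | beta _ _ h h' => exact h.inst h'
  | @app A A' B B' hA _ h h' =>
    cases A with
    | lam f A b =>
      cases hA with
      | lam hA hb =>
        cases h with
        | lam _ h => exact .beta h h'
    | _ => exact .app h h'

open Relation

theorem Conv.join {t u : Src} (h : Conv t u) : Join (ReflTransGen Par) t u := by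
  -- Two parallel reducts of `t` meet in the development of `t` after one step each.
  have cr : Equivalence (Join (ReflTransGen Par)) :=
    equivalence_join_reflTransGen fun t u v hu hv =>
      ⟨t.develop, .single hu.develop, .single hv.develop⟩
  induction h with
  | rel _ _ h => exact ⟨_, .single h.par, .refl⟩
  | refl => exact cr.refl _
  | symm _ _ _ ih => exact cr.symm ih
  | trans _ _ _ _ _ ih ih' => exact cr.trans ih ih'

theorem Par.reds {t u : Src} (h : Par t u) : ReflTransGen Red t u := by
  induction h with
  | bvar n => exact .refl
  | sort s => exact .refl
  | @pi f g A A' B B' _ _ h h' =>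
    exact (h.lift (Src.pi f g · B) fun _ _ => .piDom).trans
      (h'.lift (Src.pi f g A' ·) fun _ _ => .piCod)
  | @lam f A A' B B' _ _ h h' =>
    exact (h.lift (Src.lam f · B) fun _ _ => .lamDom).trans
      (h'.lift (Src.lam f A' ·) fun _ _ => .lamBody)
  | @app A A' B B' _ _ h h' =>
    exact (h.lift (Src.app · B) fun _ _ => .appFun).trans
      (h'.lift (Src.app A' ·) fun _ _ => .appArg)
  | @beta f A b b' a a' _ _ h h' =>
    exact ((h.lift (fun b => Src.app (.lam f A b) a) fun _ _ h => .appFun (.lamBody h)).trans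
      (h'.lift (Src.app (.lam f A b') ·) fun _ _ => .appArg)).tail .beta

theorem conv_of_reds {t u : Src} (h : ReflTransGen Red t u) : Conv t u := by
  induction h with
  | refl => exact .refl _
  | tail _ h ih => exact ih.trans (.red h)

theorem conv_of_pars {t u : Src} (h : ReflTransGen Par t u) : Conv t u := by
  induction h with
  | refl => exact .refl _
  | tail _ h ih => exact ih.trans (conv_of_reds h.reds)

theorem pars_sort {s u} (h : ReflTransGen Par (sort s) u) : u = sort s := by
  induction h with
  | refl => rfl
  | tail _ h ih => subst ih; cases h; rfl

theorem pars_pi {f g A B u} (h : ReflTransGen Par (pi f g A B) u) :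
    ∃ A' B', u = pi f g A' B' ∧ ReflTransGen Par A A' ∧ ReflTransGen Par B B' := by
  induction h with
  | refl => exact ⟨_, _, rfl, .refl, .refl⟩
  | tail _ h ih =>
    obtain ⟨A', B', rfl, hA, hB⟩ := ih
    cases h with
    | pi h h' => exact ⟨_, _, rfl, hA.tail h, hB.tail h'⟩

theorem Conv.sort_inj {s s'} (h : Conv (sort s) (sort s')) : s = s' := by
  obtain ⟨u, h, h'⟩ := h.join
  have := (pars_sort h).symm.trans (pars_sort h')
  cases this; rfl

/-- A product reduces only inside its parts, so a common reduct of two products is a product with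
the same flags. -/
theorem Conv.pi_inj {f g A B f' g' A' B'} (h : Conv (Src.pi f g A B) (Src.pi f' g' A' B')) :
    f = f' ∧ g = g' ∧ Conv A A' ∧ Conv B B' := by
  obtain ⟨u, h, h'⟩ := h.join
  obtain ⟨_, _, rfl, hA, hB⟩ := pars_pi h
  obtain ⟨_, _, e, hA', hB'⟩ := pars_pi h'
  cases e
  exact ⟨rfl, rfl, (conv_of_pars hA).trans (conv_of_pars hA').symm,
    (conv_of_pars hB).trans (conv_of_pars hB').symm⟩

/-- All flags replaced by `T`. -/
def unflag : Src → Src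
  | bvar n => bvar n
  | sort s => sort s
  | pi _ _ A B => pi .T .T (unflag A) (unflag B)
  | lam _ A b => lam .T (unflag A) (unflag b)
  | app M N => app (unflag M) (unflag N)

theorem unflag_rename (t : Src) : ∀ ρ, unflag (rename ρ t) = rename ρ (unflag t) := by
  induction t <;> simp_all [unflag, rename]

theorem unflag_subst (t : Src) :
    ∀ σ, unflag (subst σ t) = subst (fun n => unflag (σ n)) (unflag t) := by
  have (σ : ℕ → Src) : (fun n => unflag (up σ n)) = up (fun n => unflag (σ n)) := by
    funext n; cases n <;> simp [unflag, unflag_rename, shift]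
  induction t <;> simp_all [unflag, subst]

theorem unflag_inst (b a : Src) : unflag (inst b a) = inst (unflag b) (unflag a) := by
  rw [inst, unflag_subst]
  refine subst_congr _ fun n => ?_
  cases n <;> rfl

theorem Conv.unflag {t u : Src} (h : Conv t u) : Conv t.unflag u.unflag := by
  refine h.congr _ fun h => ?_
  induction h with
  | beta => rw [unflag_inst]; exact .beta
  | piDom _ ih => exact .piDom ih
  | piCod _ ih => exact .piCod ih
  | lamDom _ ih => exact .lamDom ih
  | lamBody _ ih => exact .lamBody ih
  | appFun _ ih => exact .appFun ih
  | appArg _ ih => exact .appArg ih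

/-- The declaration of index `n`, with its type moved to the whole context. -/
inductive Lookup : List Src → ℕ → Src → Prop
  | zero {Γ A} : Lookup (A :: Γ) 0 A.shift
  | succ {Γ A B n} : Lookup Γ n B → Lookup (A :: Γ) (n + 1) B.shift

theorem Lookup.unique {Γ n A B} (h : Lookup Γ n A) (h' : Lookup Γ n B) : A = B := by
  induction h generalizing B with
  | zero => cases h'; rfl
  | succ _ ih => cases h' with | succ h' => rw [ih h']

end Src

/-! ## A pure type system for the flags -/

open Src

/-- The universe that stands for a flag. -/
def Flag.srt : Flag → Srt
  | .P => .prop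
  | .S => .type 0
  | .T => .type 1

theorem Flag.srt_injective : Function.Injective Flag.srt := by
  intro f g h; cases f <;> cases g <;> simp_all [Flag.srt]

/-- The type of a flag. -/
abbrev Flag.sort (f : Flag) : Src := .sort f.srt

/-- The typing judgement of the pure type system with the three universes `P`, `S`, `T`, all of them
of type `T`, and with all products. -/
inductive PTS : List Src → Src → Src → Prop
  | sort {f : Flag} : PTS [] f.sort Flag.T.sort
  | var {Γ A} {f : Flag} : PTS Γ A f.sort → PTS (A :: Γ) (.bvar 0) A.shift
  | weak {Γ a B A} {f : Flag} : PTS Γ a B → PTS Γ A f.sort → PTS (A :: Γ) a.shift B.shift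
  | pi {Γ A B} {f g : Flag} : PTS Γ A f.sort → PTS (A :: Γ) B g.sort →
      PTS Γ (.pi f g A B) (f.prod g).sort
  | lam {Γ A b B} {f g : Flag} : PTS Γ A f.sort → PTS (A :: Γ) b B → PTS (A :: Γ) B g.sort →
      PTS Γ (.lam f A b) (.pi f g A B)
  | app {Γ M N f g A B} : PTS Γ M (.pi f g A B) → PTS Γ N A → PTS Γ (.app M N) (B.inst N)
  | conv {Γ a A B} {f : Flag} : PTS Γ a A → PTS Γ B f.sort → Conv A B → PTS Γ a B

/-- Well-formed contexts. -/
inductive PTSCtx : List Src → Prop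
  | nil : PTSCtx []
  | cons {Γ A} {f : Flag} : PTSCtx Γ → PTS Γ A f.sort → PTSCtx (A :: Γ)

namespace PTS

theorem ctx {Γ : List Src} {t T : Src} (h : PTS Γ t T) : PTSCtx Γ := by
  induction h with
  | sort => exact .nil
  | var h ih => exact .cons ih h
  | weak _ h _ ih => exact .cons ih h
  | pi _ _ ih _ => exact ih
  | lam _ _ _ ih => exact ih
  | app _ _ ih _ => exact ih
  | conv _ _ _ ih _ => exact ih

theorem sort' {Γ : List Src} (hΓ : PTSCtx Γ) (f : Flag) : PTS Γ f.sort Flag.T.sort := by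
  induction hΓ with
  | nil => exact .sort
  | cons _ hA ih => exact ih.weak hA

theorem lookup {Γ : List Src} {n : ℕ} {A : Src} (hΓ : PTSCtx Γ) (h : Lookup Γ n A) :
    PTS Γ (.bvar n) A := by
  induction h with
  | zero => cases hΓ with | cons _ h => exact .var h
  | succ _ ih => cases hΓ with | cons hΓ h => exact (ih hΓ).weak h

/-- A class of substitutions between contexts that preserves typing. -/
structure Morphisms (K : List Src → List Src → (ℕ → Src) → Prop) : Prop where
  ctx {Γ Δ σ} : K Γ Δ σ → PTSCtx Δ
  zero {A Γ Δ σ} : K (A :: Γ) Δ σ → PTS Δ (σ 0) (A.shift.subst σ)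
  tail {A Γ Δ σ} : K (A :: Γ) Δ σ → K Γ Δ (fun n => σ (n + 1))
  up {A Γ Δ σ} {f : Flag} : K Γ Δ σ → PTS Δ (A.subst σ) f.sort →
    K (A :: Γ) (A.subst σ :: Δ) (Src.up σ)

theorem morphism {K} (hK : Morphisms K) {Γ : List Src} {t T : Src} (h : PTS Γ t T) :
    ∀ {Δ σ}, K Γ Δ σ → PTS Δ (t.subst σ) (T.subst σ) := by
  induction h with
  | sort => exact fun hσ => sort' (hK.ctx hσ) _
  | var => exact fun hσ => hK.zero hσ
  | weak _ _ ih =>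
    intro Δ σ hσ
    simpa only [Src.shift, Src.subst_rename] using ih (hK.tail hσ)
  | pi _ _ ih ih' => exact fun hσ => .pi (ih hσ) (ih' (hK.up hσ (ih hσ)))
  | lam _ _ _ ih ih' ih'' =>
    exact fun hσ => .lam (ih hσ) (ih' (hK.up hσ (ih hσ))) (ih'' (hK.up hσ (ih hσ)))
  | app _ _ ih ih' =>
    intro Δ σ hσ
    rw [Src.subst_inst]
    exact .app (ih hσ) (ih' hσ)
  | conv _ _ h ih ih' => exact fun hσ => .conv (ih hσ) (ih' hσ) (h.subst _)

theorem rename {Γ Δ : List Src} {t T : Src} (h : PTS Γ t T) (hΔ : PTSCtx Δ) {ρ : ℕ → ℕ}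
    (hρ : ∀ n A, Lookup Γ n A → Lookup Δ (ρ n) (A.rename ρ)) :
    PTS Δ (t.rename ρ) (T.rename ρ) := by
  simp only [Src.rename_eq_subst]
  refine morphism (K := fun Γ Δ σ => PTSCtx Δ ∧ ∃ ρ : ℕ → ℕ, σ = (fun n => .bvar (ρ n)) ∧
    ∀ n A, Lookup Γ n A → Lookup Δ (ρ n) (A.rename ρ)) ⟨fun h => h.1, ?_, ?_, ?_⟩ h
    ⟨hΔ, ρ, rfl, hρ⟩
  · rintro A Γ Δ _ ⟨hΔ, ρ, rfl, h⟩
    rw [← Src.rename_eq_subst]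
    exact lookup hΔ (h _ _ .zero)
  · rintro A Γ Δ _ ⟨hΔ, ρ, rfl, h⟩
    refine ⟨hΔ, _, rfl, fun n B hB => ?_⟩
    simpa only [Src.shift, Src.rename_rename] using h _ _ (.succ (A := A) hB)
  · rintro A Γ Δ _ s ⟨hΔ, ρ, rfl, h⟩ hA
    refine ⟨.cons hΔ hA, DB.upRen ρ, Src.up_bvar_comp ρ, fun n B hB => ?_⟩
    cases hB with
    | zero => rw [Src.rename_upRen_shift, Src.rename_eq_subst]; exact .zero
    | succ hB => rw [Src.rename_upRen_shift]; exact .succ (h _ _ hB)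

theorem subst {Γ Δ : List Src} {t T : Src} (h : PTS Γ t T) (hΔ : PTSCtx Δ) {σ : ℕ → Src}
    (hσ : ∀ n A, Lookup Γ n A → PTS Δ (σ n) (A.subst σ)) :
    PTS Δ (t.subst σ) (T.subst σ) := by
  refine morphism (K := fun Γ Δ σ => PTSCtx Δ ∧
    ∀ n A, Lookup Γ n A → PTS Δ (σ n) (A.subst σ)) ⟨fun h => h.1, ?_, ?_, ?_⟩ h ⟨hΔ, hσ⟩
  · rintro A Γ Δ σ ⟨hΔ, h⟩
    exact h _ _ .zero
  · rintro A Γ Δ σ ⟨hΔ, h⟩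
    refine ⟨hΔ, fun n B hB => ?_⟩
    simpa only [Src.shift, Src.subst_rename] using h _ _ (.succ (A := A) hB)
  · rintro A Γ Δ σ s ⟨hΔ, h⟩ hA
    refine ⟨.cons hΔ hA, fun n B hB => ?_⟩
    cases hB with
    | zero => rw [Src.subst_up_shift]; exact .var hA
    | succ hB => rw [Src.subst_up_shift]; exact (h _ _ hB).weak hA

theorem inst {Γ : List Src} {t T A a : Src} (h : PTS (A :: Γ) t T) (ha : PTS Γ a A) :
    PTS Γ (t.inst a) (T.inst a) := by
  refine h.subst ha.ctx fun n B hB => ?_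
  cases hB with
  | zero => rw [← Src.inst, Src.inst_shift]; exact ha
  | succ hB => rw [← Src.inst, Src.inst_shift]; exact lookup ha.ctx hB

/-- Weakening below the last variable. -/
theorem weak_under {Γ : List Src} {t T A C : Src} {f g : Flag} (h : PTS (A :: Γ) t T)
    (hA : PTS Γ A f.sort) (hC : PTS Γ C g.sort) : PTS (A.shift :: C :: Γ)
      (t.rename (DB.upRen fun n => n + 1)) (T.rename (DB.upRen fun n => n + 1)) := by
  refine h.rename (.cons (.cons hC.ctx hC) (hA.weak hC)) fun n B hB => ?_
  cases hB with
  | zero => rw [Src.rename_upRen_shift]; exact .zero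
  | succ hB => rw [Src.rename_upRen_shift]; exact .succ (.succ hB)

/-- Conversion of the last declaration. -/
theorem conv_ctx {Γ : List Src} {t T A C : Src} {f : Flag} (h : PTS (A :: Γ) t T)
    (hA : PTS Γ A f.sort) {g : Flag} (hC : PTS Γ C g.sort) (hAC : Conv A C) : PTS (C :: Γ) t T := by
  have := h.subst (Δ := C :: Γ) (.cons hC.ctx hC) (σ := Src.bvar) fun n B hB => ?_
  · simpa using this
  rw [Src.subst_bvar]
  cases hB with
  | zero => exact .conv (.var hC) (hA.weak hC) hAC.symm.shift
  | succ hB => exact (lookup hC.ctx hB).weak hC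

theorem bvar_inv {Γ : List Src} {n : ℕ} {T : Src} (h : PTS Γ (.bvar n) T) :
    ∃ A, Lookup Γ n A ∧ Conv A T := by
  generalize ht : Src.bvar n = t at h
  induction h generalizing n with
  | var => cases ht; exact ⟨_, .zero, .refl _⟩
  | conv _ _ h ih =>
    obtain ⟨A, hA, hT⟩ := ih ht
    exact ⟨A, hA, hT.trans h⟩
  | @weak _ a _ _ _ _ _ ih =>
    cases a <;> cases ht
    obtain ⟨A, hA, hT⟩ := ih rfl
    exact ⟨_, hA.succ, hT.shift⟩
  | _ => cases ht

theorem sort_inv {Γ : List Src} {s T} (h : PTS Γ (.sort s) T) : Conv Flag.T.sort T := by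
  generalize ht : Src.sort s = t at h
  induction h with
  | sort => exact .refl _
  | conv _ _ h ih => exact (ih ht).trans h
  | @weak _ a _ _ _ _ _ ih =>
    cases a <;> cases ht
    exact (ih rfl).shift
  | _ => cases ht

theorem pi_inv {Γ : List Src} {f g A B T} (h : PTS Γ (.pi f g A B) T) :
    PTS Γ A f.sort ∧ PTS (A :: Γ) B g.sort ∧ Conv (f.prod g).sort T := by
  generalize ht : Src.pi f g A B = t at h
  induction h generalizing A B with
  | pi h h' => cases ht; exact ⟨h, h', .refl _⟩
  | conv _ _ h ih =>
    obtain ⟨hA, hB, hT⟩ := ih ht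
    exact ⟨hA, hB, hT.trans h⟩
  | @weak Γ a _ C _ _ h' ih =>
    cases a <;> cases ht
    obtain ⟨hA, hB, hT⟩ := ih rfl
    exact ⟨hA.weak h', hB.weak_under hA h', hT.shift⟩
  | _ => cases ht

theorem lam_inv {Γ : List Src} {f A b T} (h : PTS Γ (.lam f A b) T) : ∃ B g,
    PTS Γ A f.sort ∧ PTS (A :: Γ) b B ∧ PTS (A :: Γ) B (Flag.sort g) ∧ Conv (.pi f g A B) T := by
  generalize ht : Src.lam f A b = t at h
  induction h generalizing A b with
  | lam h h' h'' => cases ht; exact ⟨_, _, h, h', h'', .refl _⟩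
  | conv _ _ h ih =>
    obtain ⟨B, g, hA, hb, hB, hT⟩ := ih ht
    exact ⟨B, g, hA, hb, hB, hT.trans h⟩
  | @weak Γ a _ C _ _ h' ih =>
    cases a <;> cases ht
    obtain ⟨B, g, hA, hb, hB, hT⟩ := ih rfl
    exact ⟨_, g, hA.weak h', hb.weak_under hA h', hB.weak_under hA h', hT.shift⟩
  | _ => cases ht

theorem app_inv {Γ : List Src} {M N T} (h : PTS Γ (.app M N) T) : ∃ f g A B,
    PTS Γ M (.pi f g A B) ∧ PTS Γ N A ∧ Conv (B.inst N) T := by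
  generalize ht : Src.app M N = t at h
  induction h generalizing M N with
  | app h h' => cases ht; exact ⟨_, _, _, _, h, h', .refl _⟩
  | conv _ _ h ih =>
    obtain ⟨f, g, A, B, hM, hN, hT⟩ := ih ht
    exact ⟨f, g, A, B, hM, hN, hT.trans h⟩
  | @weak Γ a _ C _ _ h' ih =>
    cases a <;> cases ht
    obtain ⟨f, g, A, B, hM, hN, hT⟩ := ih rfl
    refine ⟨f, g, _, _, hM.weak h', hN.weak h', ?_⟩
    have := hT.shift
    rwa [Src.shift, Src.rename_inst] at this
  | _ => cases ht

/-- Types have a universe. -/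
theorem type {Γ : List Src} {t T} (h : PTS Γ t T) : ∃ f : Flag, PTS Γ T f.sort := by
  induction h with
  | sort => exact ⟨.T, .sort⟩
  | var h => exact ⟨_, h.weak h⟩
  | weak _ h ih =>
    obtain ⟨f, hf⟩ := ih
    exact ⟨f, hf.weak h⟩
  | pi h => exact ⟨.T, sort' h.ctx _⟩
  | lam h _ h' => exact ⟨_, .pi h h'⟩
  | app _ h ih =>
    obtain ⟨f, hf⟩ := ih
    exact ⟨_, hf.pi_inv.2.1.inst h⟩
  | conv _ h => exact ⟨_, h⟩

/-- An abstraction does not record the flag of its codomain, and the induction hypothesis compares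
codomains only after erasing flags. So uniqueness is stated modulo flags. Nothing is lost for
universes, which are unchanged by the erasure. -/
theorem unique {t : Src} : ∀ {Γ : List Src} {T T'}, PTS Γ t T → PTS Γ t T' →
    Conv T.unflag T'.unflag := by
  induction t with
  | bvar n =>
    intro Γ T T' h h'
    obtain ⟨A, hA, h⟩ := h.bvar_inv
    obtain ⟨A', hA', h'⟩ := h'.bvar_inv
    cases hA.unique hA'
    exact (h.symm.trans h').unflag
  | sort => exact fun h h' => (h.sort_inv.symm.trans h'.sort_inv).unflag
  | pi => exact fun h h' => (h.pi_inv.2.2.symm.trans h'.pi_inv.2.2).unflag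
  | lam f A b _ ih =>
    intro Γ T T' h h'
    obtain ⟨B, g, hA, hb, hB, hT⟩ := h.lam_inv
    obtain ⟨B', g', hA', hb', hB', hT'⟩ := h'.lam_inv
    exact hT.unflag.symm.trans (.trans (.pi (.refl _) (ih hb hb')) hT'.unflag)
  | app M N ih =>
    intro Γ T T' h h'
    obtain ⟨f, g, A, B, hM, hN, hT⟩ := h.app_inv
    obtain ⟨f', g', A', B', hM', hN', hT'⟩ := h'.app_inv
    refine hT.unflag.symm.trans (.trans ?_ hT'.unflag)
    rw [Src.unflag_inst, Src.unflag_inst]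
    exact .inst (ih hM hM').pi_inj.2.2.2 (.refl _)

/-- Subject reduction. -/
theorem red {t u : Src} (hr : Red t u) : ∀ {Γ T}, PTS Γ t T → PTS Γ u T := by
  induction hr with
  | beta =>
    intro Γ T h
    obtain ⟨f, g, A, B, hM, hN, hT⟩ := h.app_inv
    obtain ⟨B', g', hA', hb, hB', hM'⟩ := hM.lam_inv
    -- The type of the abstraction by inversion and the one used by the application are convertible
    -- products; injectivity matches their domains, so the argument has the declared type.
    obtain ⟨rfl, rfl, hA, hB⟩ := hM'.pi_inj
    obtain ⟨u, hu⟩ := h.type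
    have hN' : PTS Γ _ _ := hN.conv hA' hA.symm
    exact .conv (hb.inst hN') hu ((hB.inst (.refl _)).trans hT)
  | piDom hr ih =>
    intro Γ T h
    obtain ⟨u, hu⟩ := h.type
    obtain ⟨hA, hB, hT⟩ := h.pi_inv
    exact .conv (.pi (ih hA) (hB.conv_ctx hA (ih hA) (.red hr))) hu hT
  | piCod hr ih =>
    intro Γ T h
    obtain ⟨u, hu⟩ := h.type
    obtain ⟨hA, hB, hT⟩ := h.pi_inv
    exact .conv (.pi hA (ih hB)) hu hT
  | lamDom hr ih =>
    intro Γ T h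
    obtain ⟨u, hu⟩ := h.type
    obtain ⟨B, g, hA, hb, hB, hT⟩ := h.lam_inv
    refine .conv (.lam (ih hA) (hb.conv_ctx hA (ih hA) (.red hr))
      (hB.conv_ctx hA (ih hA) (.red hr))) hu (.trans ?_ hT)
    exact .pi (Conv.red hr).symm (.refl _)
  | lamBody hr ih =>
    intro Γ T h
    obtain ⟨u, hu⟩ := h.type
    obtain ⟨B, g, hA, hb, hB, hT⟩ := h.lam_inv
    exact .conv (.lam hA (ih hb) hB) hu hT
  | appFun hr ih =>
    intro Γ T h
    obtain ⟨u, hu⟩ := h.type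
    obtain ⟨f, g, A, B, hM, hN, hT⟩ := h.app_inv
    exact .conv (.app (ih hM) hN) hu hT
  | appArg hr ih =>
    intro Γ T h
    obtain ⟨u, hu⟩ := h.type
    obtain ⟨f, g, A, B, hM, hN, hT⟩ := h.app_inv
    exact .conv (.app hM (ih hN)) hu (.trans (.inst (.refl _) (Conv.red hr).symm) hT)

theorem reds {Γ : List Src} {t u T : Src} (h : PTS Γ t T) (hr : Relation.ReflTransGen Red t u) :
    PTS Γ u T := by
  induction hr with
  | refl => exact h
  | tail _ hr ih => exact red hr ih

theorem pars {Γ : List Src} {t u T : Src} (h : PTS Γ t T) (hr : Relation.ReflTransGen Par t u) :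
    PTS Γ u T := by
  induction hr with
  | refl => exact h
  | tail _ hp ih => exact ih.reds hp.reds

/-- Convertible types have the same flag. -/
theorem flag_eq {Γ : List Src} {A B : Src} {f g : Flag} (hA : PTS Γ A f.sort)
    (hB : PTS Γ B g.sort) (h : Conv A B) : f = g := by
  -- By subject reduction the common reduct lies in both universes, and uniqueness of types
  -- identifies them.
  obtain ⟨C, hAC, hBC⟩ := h.join
  exact Flag.srt_injective ((hA.pars hAC).unique (hB.pars hBC)).sort_inj

end PTS
end WeakIsoRel

namespace WeakIsoRel

/-! ## The typing rules of CoC⁻ with de Bruijn indices -/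

open Src

/-- The subtyping relation. -/
inductive Src.Sub : Src → Src → Prop
  | type {i j} : 0 < i → i < j → Sub (.sort (.type i)) (.sort (.type j))
  | pi {f g C A B} : Sub A B → Sub (.pi f g C A) (.pi f g C B)

/-- Judgements: `a` has type `B`, and `B` is a type with flag `u`. -/
inductive Judg : Type
  | tm (a B : Src)
  | ty (B : Src) (u : Flag)

namespace Judg

def subst (σ : ℕ → Src) : Judg → Judg
  | tm a B => tm (a.subst σ) (B.subst σ)
  | ty B u => ty (B.subst σ) u

end Judg

open Judg

/-- The typing rules of CoC⁻ with de Bruijn indices. A type that is a product need not have a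
universe; the premises record that the types in question are types. -/
inductive SrcTyping : List Src → Judg → Prop
  | sort {s : Srt} : SrcTyping [] (tm (.sort s) (.sort s.succ))
  | var {Γ A s} : SrcTyping Γ (tm A (.sort s)) → SrcTyping (A :: Γ) (tm (.bvar 0) A.shift)
  | weak {Γ a B A s} : SrcTyping Γ (tm a B) → SrcTyping Γ (tm A (.sort s)) →
      SrcTyping (A :: Γ) (tm a.shift B.shift)
  | conv {Γ a A B s} : SrcTyping Γ (tm a A) → SrcTyping Γ (tm B (.sort s)) → Conv A B →
      SrcTyping Γ (tm a B)
  | cum {Γ a A B u} : SrcTyping Γ (tm a A) → Sub A B → SrcTyping Γ (ty B u) →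
      SrcTyping Γ (tm a B)
  | pi₁ {Γ A B i} : SrcTyping Γ (tm A (.sort (.type i))) →
      SrcTyping (A :: Γ) (tm B (.sort (.type i))) →
      SrcTyping Γ (tm (.pi (Srt.type i).flag (Srt.type i).flag A B) (.sort (.type i)))
  | pi₂ {Γ A B s} : s = .type 0 ∨ s = .prop → SrcTyping Γ (tm A (.sort s)) →
      SrcTyping (A :: Γ) (tm B (.sort .prop)) →
      SrcTyping Γ (tm (.pi s.flag .P A B) (.sort .prop))
  | app {Γ M N A B s g} : SrcTyping Γ (tm M (.pi s.flag g A B)) → SrcTyping Γ (tm N A) →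
      SrcTyping Γ (tm A (.sort s)) → SrcTyping (A :: Γ) (ty B g) →
      SrcTyping Γ (tm (.app M N) (B.inst N))
  | lam {Γ A b B s g} : SrcTyping Γ (tm A (.sort s)) → SrcTyping (A :: Γ) (tm b B) →
      SrcTyping (A :: Γ) (ty B g) → SrcTyping Γ (tm (.lam s.flag A b) (.pi s.flag g A B))
  | ty {Γ B s} : SrcTyping Γ (tm B (.sort s)) → SrcTyping Γ (ty B s.flag)
  | tyPi {Γ A B s g} : SrcTyping Γ (tm A (.sort s)) → SrcTyping (A :: Γ) (ty B g) →
      SrcTyping Γ (ty (.pi s.flag g A B) (s.flag.prod g))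

/-- Well-formed contexts. -/
inductive SrcCtx : List Src → Prop
  | nil : SrcCtx []
  | cons {Γ A s} : SrcCtx Γ → SrcTyping Γ (tm A (.sort s)) → SrcCtx (A :: Γ)

theorem Src.Sub.subst {A B : Src} (h : Sub A B) : ∀ σ, Sub (A.subst σ) (B.subst σ) := by
  induction h with
  | type h h' => exact fun _ => .type h h'
  | pi _ ih => exact fun _ => .pi (ih _)

namespace SrcTyping

theorem ctx {Γ : List Src} {j} (h : SrcTyping Γ j) : SrcCtx Γ := by
  induction h with
  | sort => exact .nil
  | var h ih => exact .cons ih h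
  | weak _ h _ ih => exact .cons ih h
  | conv _ _ _ ih _ => exact ih
  | cum _ _ _ ih _ => exact ih
  | pi₁ _ _ ih _ => exact ih
  | pi₂ _ _ _ ih _ => exact ih
  | lam _ _ _ ih => exact ih
  | app _ _ _ _ ih => exact ih
  | ty _ ih => exact ih
  | tyPi _ _ ih => exact ih

theorem sort' {Γ : List Src} (hΓ : SrcCtx Γ) (s : Srt) :
    SrcTyping Γ (tm (.sort s) (.sort s.succ)) := by
  induction hΓ with
  | nil => exact .sort
  | cons _ hA ih => exact ih.weak hA

theorem lookup {Γ : List Src} {n : ℕ} {A : Src} (hΓ : SrcCtx Γ) (h : Lookup Γ n A) :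
    SrcTyping Γ (tm (.bvar n) A) := by
  induction h with
  | zero => cases hΓ with | cons _ h => exact .var h
  | succ _ ih => cases hΓ with | cons hΓ h => exact (ih hΓ).weak h

/-- A class of substitutions between contexts that preserves typing. -/
structure Morphisms (K : List Src → List Src → (ℕ → Src) → Prop) : Prop where
  ctx {Γ Δ σ} : K Γ Δ σ → SrcCtx Δ
  zero {A Γ Δ σ} : K (A :: Γ) Δ σ → SrcTyping Δ (tm (σ 0) (A.shift.subst σ))
  tail {A Γ Δ σ} : K (A :: Γ) Δ σ → K Γ Δ (fun n => σ (n + 1))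
  up {A Γ Δ σ} {s : Srt} : K Γ Δ σ → SrcTyping Δ (tm (A.subst σ) (.sort s)) →
    K (A :: Γ) (A.subst σ :: Δ) (Src.up σ)

theorem morphism {K} (hK : Morphisms K) {Γ : List Src} {j} (h : SrcTyping Γ j) :
    ∀ {Δ σ}, K Γ Δ σ → SrcTyping Δ (j.subst σ) := by
  induction h with
  | sort => exact fun hσ => sort' (hK.ctx hσ) _
  | var => exact fun hσ => hK.zero hσ
  | weak _ _ ih =>
    intro Δ σ hσ
    simpa only [Judg.subst, Src.shift, Src.subst_rename] using ih (hK.tail hσ)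
  | conv _ _ h ih ih' => exact fun hσ => .conv (ih hσ) (ih' hσ) (h.subst _)
  | cum _ h _ ih ih' => exact fun hσ => .cum (ih hσ) (h.subst _) (ih' hσ)
  | pi₁ _ _ ih ih' => exact fun hσ => .pi₁ (ih hσ) (ih' (hK.up hσ (ih hσ)))
  | pi₂ hs _ _ ih ih' => exact fun hσ => .pi₂ hs (ih hσ) (ih' (hK.up hσ (ih hσ)))
  | app _ _ _ _ ihM ihN ihA ihB =>
    intro Δ σ hσ
    rw [Judg.subst, Src.subst_inst]
    exact .app (ihM hσ) (ihN hσ) (ihA hσ) (ihB (hK.up hσ (ihA hσ)))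
  | lam _ _ _ ih ih' ih'' =>
    exact fun hσ => .lam (ih hσ) (ih' (hK.up hσ (ih hσ))) (ih'' (hK.up hσ (ih hσ)))
  | ty _ ih => exact fun hσ => .ty (ih hσ)
  | tyPi _ _ ih ih' => exact fun hσ => .tyPi (ih hσ) (ih' (hK.up hσ (ih hσ)))

theorem rename {Γ Δ : List Src} {j} (h : SrcTyping Γ j) (hΔ : SrcCtx Δ) {ρ : ℕ → ℕ}
    (hρ : ∀ n A, Lookup Γ n A → Lookup Δ (ρ n) (A.rename ρ)) :
    SrcTyping Δ (j.subst fun n => .bvar (ρ n)) := by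
  refine morphism (K := fun Γ Δ σ => SrcCtx Δ ∧ ∃ ρ : ℕ → ℕ, σ = (fun n => .bvar (ρ n)) ∧
    ∀ n A, Lookup Γ n A → Lookup Δ (ρ n) (A.rename ρ)) ⟨fun h => h.1, ?_, ?_, ?_⟩ h
    ⟨hΔ, ρ, rfl, hρ⟩
  · rintro A Γ Δ _ ⟨hΔ, ρ, rfl, h⟩
    rw [← Src.rename_eq_subst]
    exact lookup hΔ (h _ _ .zero)
  · rintro A Γ Δ _ ⟨hΔ, ρ, rfl, h⟩
    refine ⟨hΔ, _, rfl, fun n B hB => ?_⟩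
    simpa only [Src.shift, Src.rename_rename] using h _ _ (.succ (A := A) hB)
  · rintro A Γ Δ _ s ⟨hΔ, ρ, rfl, h⟩ hA
    refine ⟨.cons hΔ hA, DB.upRen ρ, Src.up_bvar_comp ρ, fun n B hB => ?_⟩
    cases hB with
    | zero => rw [Src.rename_upRen_shift, Src.rename_eq_subst]; exact .zero
    | succ hB => rw [Src.rename_upRen_shift]; exact .succ (h _ _ hB)

theorem weak_ty {Γ : List Src} {A C : Src} {u s} (h : SrcTyping Γ (Judg.ty A u))
    (hC : SrcTyping Γ (tm C (.sort s))) : SrcTyping (C :: Γ) (Judg.ty A.shift u) := by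
  rw [Src.shift, Src.rename_eq_subst]
  refine h.rename (.cons hC.ctx hC) (ρ := fun n => n + 1) fun n B hB => ?_
  exact .succ hB

/-- Weakening below the last variable. -/
theorem weak_under {Γ : List Src} {t T A C : Src} {s s'} (h : SrcTyping (A :: Γ) (tm t T))
    (hA : SrcTyping Γ (tm A (.sort s))) (hC : SrcTyping Γ (tm C (.sort s'))) :
    SrcTyping (A.shift :: C :: Γ)
      (tm (t.rename (DB.upRen fun n => n + 1)) (T.rename (DB.upRen fun n => n + 1))) := by
  simp only [Src.rename_eq_subst]
  refine h.rename (ρ := DB.upRen fun n => n + 1) (.cons (.cons hC.ctx hC) (hA.weak hC))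
    fun n B hB => ?_
  cases hB with
  | zero => rw [Src.rename_upRen_shift]; exact .zero
  | succ hB => rw [Src.rename_upRen_shift]; exact .succ (.succ hB)

theorem inst {Γ : List Src} {j A a} (h : SrcTyping (A :: Γ) j) (ha : SrcTyping Γ (tm a A)) :
    SrcTyping Γ (j.subst (scons a .bvar)) := by
  refine morphism (K := fun Γ Δ σ => SrcCtx Δ ∧
    ∀ n A, Lookup Γ n A → SrcTyping Δ (tm (σ n) (A.subst σ))) ⟨fun h => h.1, ?_, ?_, ?_⟩ h
    ⟨ha.ctx, fun n B hB => ?_⟩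
  · rintro A Γ Δ σ ⟨hΔ, h⟩
    exact h _ _ .zero
  · rintro A Γ Δ σ ⟨hΔ, h⟩
    refine ⟨hΔ, fun n B hB => ?_⟩
    simpa only [Src.shift, Src.subst_rename] using h _ _ (.succ (A := A) hB)
  · rintro A Γ Δ σ s ⟨hΔ, h⟩ hA
    refine ⟨.cons hΔ hA, fun n B hB => ?_⟩
    cases hB with
    | zero => rw [Src.subst_up_shift]; exact .var hA
    | succ hB => rw [Src.subst_up_shift]; exact (h _ _ hB).weak hA
  · cases hB with
    | zero => rw [← Src.inst, Src.inst_shift]; exact ha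
    | succ hB => rw [← Src.inst, Src.inst_shift]; exact lookup ha.ctx hB

theorem pi_inv {Γ : List Src} {f g A B T} (h : SrcTyping Γ (tm (.pi f g A B) T)) :
    ∃ s s' : Srt, f = s.flag ∧ g = s'.flag ∧ SrcTyping Γ (tm A (.sort s)) ∧
      SrcTyping (A :: Γ) (tm B (.sort s')) := by
  generalize ht : tm (.pi f g A B) T = t at h
  induction h generalizing A B T with
  | pi₁ h h' => cases ht; exact ⟨_, _, rfl, rfl, h, h'⟩
  | pi₂ _ h h' => cases ht; exact ⟨_, _, rfl, rfl, h, h'⟩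
  | conv _ _ _ ih => cases ht; exact ih rfl
  | cum _ _ _ ih => cases ht; exact ih rfl
  | @weak Γ a _ C _ _ h' ih =>
    cases a <;> cases ht
    obtain ⟨s, s', hf, hg, hA, hB⟩ := ih rfl
    exact ⟨s, s', hf, hg, hA.weak h', hB.weak_under hA h'⟩
  | _ => cases ht

/-- A product may be a type because it has a universe or by its flags alone; in both cases its parts
are types with the recorded flags. -/
theorem ty_pi_inv {Γ : List Src} {f g A B u} (h : SrcTyping Γ (Judg.ty (.pi f g A B) u)) :
    ∃ s : Srt, f = s.flag ∧ SrcTyping Γ (tm A (.sort s)) ∧ SrcTyping (A :: Γ) (Judg.ty B g) := by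
  cases h with
  | ty h =>
    obtain ⟨s, s', hf, rfl, hA, hB⟩ := h.pi_inv
    exact ⟨s, hf, hA, .ty hB⟩
  | tyPi h h' => exact ⟨_, rfl, h, h'⟩

end SrcTyping

/-! ### Collapsing the universes -/

/-- Every universe replaced by the one that stands for its flag. -/
def Src.collapse : Src → Src
  | bvar n => bvar n
  | sort s => s.flag.sort
  | pi f g A B => pi f g (collapse A) (collapse B)
  | lam f A b => lam f (collapse A) (collapse b)
  | app M N => app (collapse M) (collapse N)

namespace Src

theorem collapse_rename (t : Src) : ∀ ρ, collapse (rename ρ t) = rename ρ (collapse t) := by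
  induction t <;> simp_all [collapse, rename]

theorem collapse_subst (t : Src) :
    ∀ σ, collapse (subst σ t) = subst (fun n => collapse (σ n)) (collapse t) := by
  have (σ : ℕ → Src) : (fun n => collapse (up σ n)) = up (fun n => collapse (σ n)) := by
    funext n; cases n <;> simp [collapse, collapse_rename, shift]
  induction t <;> simp_all [collapse, subst]

theorem collapse_inst (b a : Src) : collapse (inst b a) = inst (collapse b) (collapse a) := by
  rw [inst, collapse_subst]
  refine subst_congr _ fun n => ?_
  cases n <;> rfl

theorem Conv.collapse {t u : Src} (h : Conv t u) : Conv t.collapse u.collapse := by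
  refine h.congr _ fun h => ?_
  induction h with
  | beta => rw [collapse_inst]; exact .beta
  | piDom _ ih => exact .piDom ih
  | piCod _ ih => exact .piCod ih
  | lamDom _ ih => exact .lamDom ih
  | lamBody _ ih => exact .lamBody ih
  | appFun _ ih => exact .appFun ih
  | appArg _ ih => exact .appArg ih

/-- Subtyping starts from `Type i <: Type j` with both indices positive, and these collapse to the
same universe. The absence of `Prop <: Set` and `Set <: Type 1` is essential here. -/
theorem Sub.collapse {A B : Src} (h : Sub A B) : A.collapse = B.collapse := by
  induction h with
  | @type i j h h' =>
    obtain ⟨i, rfl⟩ := Nat.exists_eq_succ_of_ne_zero h.ne'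
    obtain ⟨j, rfl⟩ := Nat.exists_eq_succ_of_ne_zero (h.trans h').ne'
    rfl
  | pi _ ih => simp only [Src.collapse, ih]

end Src

theorem Srt.flag_succ (s : Srt) : s.succ.flag = .T := by
  rcases s with _ | _ | _ <;> rfl

/-- The judgement of the pure type system. -/
def Judg.PTS (Γ : List Src) : Judg → Prop
  | tm a B => WeakIsoRel.PTS Γ a.collapse B.collapse
  | ty B u => WeakIsoRel.PTS Γ B.collapse u.sort

/-- After collapsing, cumulativity is trivial and every product has a universe, so even products
without a universe in CoC⁻ are ordinary types of the pure type system. -/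
theorem SrcTyping.pts {Γ : List Src} {j} (h : SrcTyping Γ j) : j.PTS (Γ.map collapse) := by
  induction h with
  | sort => simp only [Judg.PTS, collapse, Srt.flag_succ]; exact .sort
  | var _ ih => simp only [Judg.PTS, collapse_rename, Src.shift]; exact .var ih
  | weak _ _ ih ih' =>
    simp only [Judg.PTS, collapse_rename, Src.shift]; exact .weak ih ih'
  | conv _ _ h ih ih' => exact .conv ih ih' h.collapse
  | cum _ h _ ih ih' =>
    simp only [Judg.PTS] at ih ⊢
    rwa [← h.collapse]
  | @pi₁ _ _ _ i _ _ ih ih' =>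
    have := PTS.pi (f := (Srt.type i).flag) (g := (Srt.type i).flag) ih ih'
    rcases i with _ | i <;> exact this
  | pi₂ hs _ _ ih ih' =>
    rcases hs with rfl | rfl <;> exact PTS.pi ih ih'
  | app _ _ _ _ ih ih' =>
    simp only [Judg.PTS, collapse_inst]
    exact .app ih ih'
  | lam _ _ _ ih ih' ih'' => exact .lam ih ih' ih''
  | ty _ ih => exact ih
  | tyPi _ _ ih ih' => exact .pi ih ih'

/-- A special case of the invariance of flags under conversion, by reflexivity; it makes the choice
of `proj` independent of the derivation. -/
theorem SrcTyping.flag_unique {Γ : List Src} {A u u'} (h : SrcTyping Γ (Judg.ty A u))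
    (h' : SrcTyping Γ (Judg.ty A u')) : u = u' :=
  h.pts.flag_eq h'.pts (.refl _)

/-- Supplies the premise of rule `cum` that the larger type is a type with a flag: subtyping changes
only universes with flag `T` at the end of a chain of codomains. -/
theorem SrcTyping.ty_sub {A B : Src} (h : Sub A B) : ∀ {Γ : List Src} {u},
    SrcTyping Γ (Judg.ty A u) → SrcTyping Γ (Judg.ty B u) := by
  induction h with
  | @type i j =>
    intro Γ u h
    have h1 : SrcTyping Γ (Judg.ty _ _) := .ty (sort' h.ctx (.type i))
    have h2 : SrcTyping Γ (Judg.ty _ _) := .ty (sort' h.ctx (.type j))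
    rw [Srt.flag_succ] at h1 h2
    rwa [h.flag_unique h1]
  | pi hs ih =>
    intro Γ u h
    obtain ⟨s, rfl, hA, hB⟩ := h.ty_pi_inv
    rw [h.flag_unique (.tyPi hA hB)]
    exact .tyPi hA (ih hB)

theorem SrcTyping.ty_pi_flag {Γ : List Src} {f g A B u}
    (h : SrcTyping Γ (Judg.ty (.pi f g A B) u)) : f.prod g = u := by
  obtain ⟨s, rfl, hA, hB⟩ := h.ty_pi_inv
  exact (SrcTyping.tyPi hA hB).flag_unique h

end WeakIsoRel

namespace WeakIsoRel

/-! ## Typing of the translation of products -/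

open DB

theorem Tgt.toDB_closed {t : Tgt} (h : t.closedIn [] = true) (l : List Var) :
    t.toDB l = t.toDB [] := Tgt.toDB_append l h

theorem piProp_closed : piProp.closedIn [] = true := by decide +kernel
theorem piSet_closed : piSet.closedIn [] = true := by decide +kernel
theorem projRel_toDB (x l) : projRel.toDB (x :: l) = projRel.toDB [] :=
  Tgt.toDB_closed (Lib.closedIn .projRel) _
theorem isoRel_toDB (x l) : isoRel.toDB (x :: l) = isoRel.toDB [] :=
  Tgt.toDB_closed (Lib.closedIn .isoRel) _
theorem piProp_toDB (x l) : piProp.toDB (x :: l) = piProp.toDB [] :=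
  Tgt.toDB_closed piProp_closed _
theorem piSet_toDB (x l) : piSet.toDB (x :: l) = piSet.toDB [] :=
  Tgt.toDB_closed piSet_closed _

theorem DB.conv_lam2 (A B b t t') :
    Conv (app (app (lam A (lam B b)) t) t') (b.subst (scons t' (scons t bvar))) := by
  refine (Conv.beta.app (.refl _)).trans ?_
  rw [inst_eq, subst]
  refine Conv.beta.trans (.of_eq ?_)
  simp only [inst_eq, subst_subst]
  refine subst_congr _ fun n => ?_
  rcases n with _ | _ | n <;> simp [subst, shift_eq]

/-- The case of a higher universe: the relation is literally an abstraction over `x₄` and `x₅`, and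
two `β`-steps undo the weakening by them. -/
theorem DB.conv_trPi_lam (f g A A' r B B' r' X Y t t') :
    Conv (app (app (lam X (lam Y
      (pi3 f (A.rename (fun n => n + 2)) (A'.rename (fun n => n + 2)) (r.rename (fun n => n + 2))
        (relBody g (B.rename (upRen fun n => n + 2)) (B'.rename (upRen fun n => n + 2))
          (r'.rename (upRen (upRen (upRen fun n => n + 2)))) (bvar 1) (bvar 0))))) t) t')
      (pi3 f A A' r (relBody g B B' r' t t')) := by
  refine (conv_lam2 ..).trans (.of_eq ?_)
  simp only [pi3_subst, relBody_subst, subst_rename, subst, scons_zero, scons_succ, subst_bvar]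
  congr 2
  all_goals
    refine (subst_congr _ fun n => ?_).trans (subst_bvar _)
    rcases n with _ | _ | _ | n <;> simp [shift_eq, rename]

/-- The product of two related families of types, as a relation, does not depend on the
universes up to conversion. -/
theorem DB.conv_trPi (f g A A' r B B' r' t t') :
    Conv (app (app (proj (f.prod g) (pi A B) (pi A' B') (trPi f g A A' r B B' r')) t) t')
      (pi3 f A A' r (relBody g B B' r' t t')) := by
  -- Values for the variables of `relNames`, innermost first: the two functions, the relation of
  -- families, the two families, the relation of domains, and the two domains.
  let σ : ℕ → DB := scons t' (scons t (scons (lam3 f A A' r r') (scons (lam A' B')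
    (scons (lam A B) (scons r (scons A' (scons A bvar)))))))
  have hB : inst (B.rename (fun n => upRen (fun n => n + 1) (upRen (fun n => n + 1) (upRen (fun n => n + 1) n)))) (bvar 2) =
      B.rename famL := by
    rw [inst_eq, subst_rename, rename_eq_subst]
    refine subst_congr _ fun n => ?_
    rcases n with _ | n <;> rfl
  have hB' : inst (B'.rename (fun n => upRen (fun n => n + 1) (upRen (fun n => n + 1) (upRen (fun n => n + 1) n)))) (bvar 1) =
      B'.rename famR := by
    rw [inst_eq, subst_rename, rename_eq_subst]
    refine subst_congr _ fun n => ?_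
    rcases n with _ | n <;> rfl
  have hr : inst3 (r'.rename (fun n => upRen (upRen (upRen fun n => n + 1))
      (upRen (upRen (upRen fun n => n + 1)) (upRen (upRen (upRen fun n => n + 1)) n)))) (bvar 2) (bvar 1)
      (bvar 0) = r' := by
    simp only [inst3, subst_rename]
    refine (subst_congr _ fun n => ?_).trans (subst_bvar r')
    rcases n with _ | _ | _ | n <;> rfl
  -- The combinators speak of families applied to variables. For families given as abstractions
  -- these are `β`-redexes, removed here.
  have key : Conv (pi A (pi A'.shift (pi
      (app (app (app (app (app (projRel.toDB []) A.shift.shift) A'.shift.shift) r.shift.shift)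
        (bvar 1)) (bvar 0))
      (app (app (app (app (app (projRel.toDB [])
        (app (lam A B).shift.shift.shift (bvar 2))) (app (lam A' B').shift.shift.shift (bvar 1)))
        (app (app (app (lam3 f A A' r r').shift.shift.shift (bvar 2)) (bvar 1)) (bvar 0)))
        (app t.shift.shift.shift (bvar 2))) (app t'.shift.shift.shift (bvar 1))))))
      (pi A (pi A'.shift (pi
        (app (app (app (app (app (projRel.toDB []) A.shift.shift) A'.shift.shift) r.shift.shift)
        (bvar 1)) (bvar 0)) (app (app (app (app (app (projRel.toDB [])
        (B.rename famL)) (B'.rename famR)) r')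
        (app t.shift.shift.shift (bvar 2))) (app t'.shift.shift.shift (bvar 1)))))) := by
    refine .pi (.refl _) (.pi (.refl _) (.pi (.refl _) (.app (.app (.app (.app (.app (.refl _)
      ?_) ?_) ?_) (.refl _)) (.refl _))))
    · simp only [shift_eq, rename_rename, rename]
      exact .trans .beta (.of_eq hB)
    · simp only [shift_eq, rename_rename, rename]
      exact .trans .beta (.of_eq hB')
    · simp only [shift_eq, rename_rename, lam3_rename]
      exact (conv_lam3 ..).trans (.of_eq hr)
  have hP := projRel_piProp.subst σ
  have hS := projRel_piSet.subst σ
  simp [relNames, Tgt.apps, prod1, prod2, piApp, piComb, Tgt.toDB, projRel_toDB,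
    piProp_toDB, relPi, relA, atB, DB.subst, projRel_subst, piProp_subst, σ] at hP
  simp [relNames, Tgt.apps, prod1, prod2, piApp, piComb, Tgt.toDB, projRel_toDB,
    piSet_toDB, relPi, relA, atB, DB.subst, projRel_subst, piSet_subst, σ] at hS
  -- The combinators relate products of the form `∀ a, F a`; with `F` an abstraction this is a
  -- `β`-expansion of the product in question.
  have hpi (A B : DB) : Conv (pi A B) (pi A (app (lam A B).shift (bvar 0))) := by
    refine .pi (.refl _) (.trans (.of_eq ?_) Conv.beta.symm)
    rw [inst_eq, subst_rename]
    refine ((subst_congr _ fun n => ?_).trans (subst_bvar B)).symm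
    rcases n with _ | n <;> rfl
  -- A bundled product has neither flag equal to `T`, so both underlying relations are obtained by
  -- `projRel`.
  have fin (f g) (hf : f ≠ .T) (hg : g ≠ .T) : pi3 f A A' r (relBody g B B' r' t t') =
      (pi A (pi A'.shift (pi
        (app (app (app (app (app (projRel.toDB []) A.shift.shift) A'.shift.shift) r.shift.shift)
        (bvar 1)) (bvar 0)) (app (app (app (app (app (projRel.toDB [])
        (B.rename famL)) (B'.rename famR)) r')
        (app t.shift.shift.shift (bvar 2))) (app t'.shift.shift.shift (bvar 1)))))) := by
    cases f <;> cases g <;> first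
      | contradiction
      | simp [pi3, relDom, relBody, proj, shift_eq, rename, projRel_rename]
  cases f <;> cases g
  all_goals first
    | exact conv_trPi_lam ..
    | rw [fin _ _ (by simp) (by simp)]
      refine .trans (.app (.app (.app (.app (.app (.refl _) (hpi A B)) (hpi A' B')) (.refl _))
        (.refl _)) (.refl _)) ?_
      first
        | exact hP.trans key
        | exact hS.trans key

end WeakIsoRel

namespace WeakIsoRel

open DB

/-! ## Related types and families of types -/

/-- The universe of the relations between types in `s`. -/
def Srt.rel : Srt → Srt
  | .type (i + 1) => .type (i + 1)
  | _ => .prop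

/-- The type of the translations of types in `s`. -/
def DB.relTy (s : Srt) (A A' : DB) : DB :=
  match s with
  | .type (i + 1) => pi A (pi A'.shift (sort (.type (i + 1))))
  | _ => app (app (isoRel.toDB []) A) A'

/-- `r` is a translation of types `A`, `A'` in the universe `s`. -/
structure IsRel (Δ : List DB) (s : Srt) (A A' r : DB) : Prop where
  left : CICTyping Δ A (sort s)
  right : CICTyping Δ A' (sort s)
  rel : CICTyping Δ r (relTy s A A')

/-- The context extended by two related variables. -/
def DB.ctx3 (Δ : List DB) (f : Flag) (A A' r : DB) : List DB :=
  relDom f A A' r :: A'.shift :: A :: Δ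

/-- Related families of types in the universe `s'` over related types in the universe `s`. -/
structure IsFam (Δ : List DB) (s s' : Srt) (A A' r B B' r' : DB) : Prop where
  base : IsRel Δ s A A' r
  left : CICTyping (A :: Δ) B (sort s')
  right : CICTyping (A' :: Δ) B' (sort s')
  rel : CICTyping (ctx3 Δ s.flag A A' r) r' (relTy s' (B.rename famL) (B'.rename famR))

theorem CICTyping.of_eq {Γ : List DB} {t T t' T' : DB} (h : CICTyping Γ t T) (ht : t = t')
    (hT : T = T') : CICTyping Γ t' T' := ht ▸ hT ▸ h

theorem CICTyping.sub_sort {Γ : List DB} {A : DB} {s s' : Srt} (h : CICTyping Γ A (.sort s))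
    (hs : s.le s') : CICTyping Γ A (.sort s') :=
  .cumul h (sort' h.ctx s') (.sort hs)

/-- A renaming from a context into a well-formed context. -/
structure IsRen (Γ Δ : List DB) (ρ : ℕ → ℕ) : Prop where
  ctx : CICCtx Δ
  lookup : ∀ n A, Lookup Γ n A → Lookup Δ (ρ n) (A.rename ρ)

theorem CICTyping.ren {Γ Δ : List DB} {t T : DB} {ρ : ℕ → ℕ} (h : CICTyping Γ t T)
    (hρ : IsRen Γ Δ ρ) : CICTyping Δ (t.rename ρ) (T.rename ρ) := h.rename hρ.ctx hρ.lookup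

namespace IsRen

theorem up {Γ Δ : List DB} {ρ : ℕ → ℕ} (h : IsRen Γ Δ ρ) {A : DB} {s : Srt}
    (hA : CICTyping Γ A (sort s)) : IsRen (A :: Γ) (A.rename ρ :: Δ) (upRen ρ) := by
  refine ⟨.cons h.ctx (hA.ren h), fun n B hB => ?_⟩
  cases hB with
  | zero => rw [rename_upRen_shift]; exact .zero
  | succ hB => rw [rename_upRen_shift]; exact .succ (h.lookup _ _ hB)

theorem add_two {Γ : List DB} {A B : DB} (h : CICCtx (B :: A :: Γ)) :
    IsRen Γ (B :: A :: Γ) (fun n => n + 2) :=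
  ⟨h, fun _ C hC => by simpa [shift_eq] using hC.succ.succ⟩

theorem add_three {Γ : List DB} {A B C : DB} (h : CICCtx (C :: B :: A :: Γ)) :
    IsRen Γ (C :: B :: A :: Γ) (fun n => n + 3) :=
  ⟨h, fun _ C hC => by simpa [shift_eq] using hC.succ.succ.succ⟩

end IsRen

theorem DB.relTy_subst (s A A' σ) :
    (relTy s A A').subst σ = relTy s (A.subst σ) (A'.subst σ) := by
  rcases s with _ | _ | i <;> simp only [relTy, subst, isoRel_subst, subst_up_shift]

theorem DB.relTy_rename (s A A' ρ) :
    (relTy s A A').rename ρ = relTy s (A.rename ρ) (A'.rename ρ) := by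
  simp only [rename_eq_subst, relTy_subst]

theorem DB.relDom_rename (f A A' r ρ) :
    (relDom f A A' r).rename (upRen (upRen ρ)) =
      relDom f (A.rename ρ) (A'.rename ρ) (r.rename ρ) := by
  simp only [rename_eq_subst, ← up_bvar_comp, relDom_subst]

namespace IsRel

variable {Δ : List DB} {s : Srt} {A A' r : DB}

theorem rename (h : IsRel Δ s A A' r) {Δ' : List DB} {ρ : ℕ → ℕ} (hρ : IsRen Δ Δ' ρ) :
    IsRel Δ' s (A.rename ρ) (A'.rename ρ) (r.rename ρ) :=
  ⟨h.left.ren hρ, h.right.ren hρ, (h.rel.ren hρ).of_eq rfl (relTy_rename ..)⟩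

/-- Since `Prop` is below `Set` in the target, the projection for `Set` also serves `Prop`; for
higher universes the translation already is a relation. -/
theorem proj (h : IsRel Δ s A A' r) :
    CICTyping Δ (proj s.flag A A' r) (pi A (pi A'.shift (sort s.rel))) := by
  have aux (hs : s.le (.type 0)) (hr : CICTyping Δ r (app (app (isoRel.toDB []) A) A')) :
      CICTyping Δ (app (app (app (projRel.toDB []) A) A') r)
        (pi A (pi A'.shift (sort .prop))) := by
    have := (((CICTyping.of_nil (lib_typing .projRel) h.left.ctx).app (h.left.sub_sort hs)).app
      (h.right.sub_sort hs)).app (.of_eq hr rfl ?_)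
    · refine this.of_eq rfl ?_
      simp [inst_eq, Tgt.toDB, subst, shift_eq, Tgt.arr]
      exact (rename_eq_subst _ _).symm
    · simp [Tgt.toDB, Tgt.apps, subst, shift_eq, isoRel_toDB, isoRel_subst]
  rcases s with _ | _ | i
  · exact aux trivial h.rel
  · exact aux (Nat.le_refl 0) h.rel
  · exact h.rel

theorem ctx2 (h : IsRel Δ s A A' r) : CICCtx (A'.shift :: A :: Δ) :=
  .cons (.cons h.left.ctx h.left) (h.right.weak h.left)

theorem relDom (h : IsRel Δ s A A' r) :
    CICTyping (A'.shift :: A :: Δ) (relDom s.flag A A' r) (sort s.rel) := by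
  have h2 := h.ctx2
  have hp := h.proj.ren (.add_two h2)
  refine ((hp.app (.of_eq (.lookup h2 (.succ .zero)) rfl ?_)).app
    (.of_eq (.lookup h2 .zero) rfl ?_)).of_eq rfl rfl
  · simp [shift_eq]
  · simp [shift_eq, ← rename_eq_subst]

theorem ctx3 (h : IsRel Δ s A A' r) : CICCtx (ctx3 Δ s.flag A A' r) :=
  .cons h.ctx2 h.relDom

theorem _root_.WeakIsoRel.CICTyping.relTy (hA : CICTyping Δ A (sort s))
    (hA' : CICTyping Δ A' (sort s)) : ∃ s', CICTyping Δ (relTy s A A') (sort s') := by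
  have aux (hs : s.le (.type 0)) : ∃ s', CICTyping Δ (app (app (isoRel.toDB []) A) A') (sort s') :=
    ⟨_, ((CICTyping.of_nil (lib_typing .isoRel) hA.ctx).app (hA.sub_sort hs)).app
      (hA'.sub_sort hs)⟩
  rcases s with _ | _ | i
  · exact aux trivial
  · exact aux (Nat.le_refl 0)
  · exact ⟨_, .pi hA (.pi (hA'.weak hA) (.sort' (.cons (.cons hA.ctx hA) (hA'.weak hA)) _))⟩

theorem famL (h : IsRel Δ s A A' r) : IsRen (A :: Δ) (DB.ctx3 Δ s.flag A A' r) famL := by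
  refine ⟨h.ctx3, fun n B hB => ?_⟩
  cases hB with
  | zero => simpa [DB.ctx3, shift_eq] using Lookup.succ (Lookup.succ (Lookup.zero (Γ := Δ) (A := A)))
  | succ hB => simpa [DB.ctx3, shift_eq] using Lookup.succ (Lookup.succ (Lookup.succ hB))

theorem famR (h : IsRel Δ s A A' r) : IsRen (A' :: Δ) (DB.ctx3 Δ s.flag A A' r) famR := by
  refine ⟨h.ctx3, fun n B hB => ?_⟩
  cases hB with
  | zero => simpa [DB.ctx3, shift_eq] using Lookup.succ (Lookup.zero (Γ := A :: Δ) (A := A'.shift))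
  | succ hB => simpa [DB.ctx3, shift_eq] using Lookup.succ (Lookup.succ (Lookup.succ hB))

theorem ctx3_up (h : IsRel Δ s A A' r) {Δ' : List DB} {ρ : ℕ → ℕ} (hρ : IsRen Δ Δ' ρ) :
    IsRen (DB.ctx3 Δ s.flag A A' r)
      (DB.ctx3 Δ' s.flag (A.rename ρ) (A'.rename ρ) (r.rename ρ)) (upRen (upRen (upRen ρ))) := by
  have := ((hρ.up h.left).up (h.right.weak h.left)).up h.relDom
  rwa [rename_upRen_shift, relDom_rename] at this

theorem lam3 (h : IsRel Δ s A A' r) {b C : DB} {s' : Srt}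
    (hC : CICTyping (DB.ctx3 Δ s.flag A A' r) C (sort s'))
    (hb : CICTyping (DB.ctx3 Δ s.flag A A' r) b C) :
    CICTyping Δ (lam3 s.flag A A' r b) (pi3 s.flag A A' r C) := by
  have h1 := CICTyping.pi h.relDom hC
  have h2 := CICTyping.pi (h.right.weak h.left) h1
  exact .lam (.lam (.lam hb h1) h2) (.pi h.left h2)

theorem at_app (h : IsRel Δ s A A' r) {t t' : DB} (ht : CICTyping Δ t A)
    (ht' : CICTyping Δ t' A') :
    CICTyping Δ (app (app (DB.proj s.flag A A' r) t) t') (sort s.rel) :=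
  (h.proj.app ht).app (ht'.of_eq rfl (inst_shift _ _).symm)

end IsRel

/-! ## Substitutions into the hypotheses of the combinators -/

/-- A substitution from a context into another. -/
def IsSub (Γ Δ : List DB) (σ : ℕ → DB) : Prop :=
  ∀ n A, Lookup Γ n A → CICTyping Δ (σ n) (A.subst σ)

theorem IsSub.nil (Δ σ) : IsSub [] Δ σ := fun _ _ h => nomatch h

/-- The value may have its type only up to subtyping; the expected type has a universe because the
extended context is well formed. -/
theorem IsSub.cons {Γ Δ : List DB} {σ : ℕ → DB} {C a T : DB} (hσ : IsSub Γ Δ σ)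
    (hC : CICCtx (C :: Γ)) (ha : CICTyping Δ a T) (hT : Cumul T (C.subst σ)) :
    IsSub (C :: Γ) Δ (scons a σ) := by
  intro n B hB
  cases hB with
  | zero =>
    cases hC with
    | cons _ hC =>
      simpa [shift_eq] using CICTyping.cumul ha (hC.subst ha.ctx hσ) hT
  | succ hB => simpa [shift_eq] using hσ _ _ hB

namespace IsFam

variable {Δ : List DB} {s s' : Srt} {A A' r B B' r' : DB}

theorem rename (h : IsFam Δ s s' A A' r B B' r') {Δ' : List DB} {ρ : ℕ → ℕ}
    (hρ : IsRen Δ Δ' ρ) : IsFam Δ' s s' (A.rename ρ) (A'.rename ρ) (r.rename ρ)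
      (B.rename (upRen ρ)) (B'.rename (upRen ρ)) (r'.rename (upRen (upRen (upRen ρ)))) := by
  refine ⟨h.base.rename hρ, h.left.ren (hρ.up h.base.left), h.right.ren (hρ.up h.base.right),
    (h.rel.ren (h.base.ctx3_up hρ)).of_eq rfl ?_⟩
  simp only [relTy_rename, rename_rename]
  congr 1
  all_goals
    refine rename_congr _ fun n => ?_
    cases n <;> simp

theorem fam (h : IsFam Δ s s' A A' r B B' r') :
    IsRel (ctx3 Δ s.flag A A' r) s' (B.rename famL) (B'.rename famR) r' :=
  ⟨h.left.ren h.base.famL, h.right.ren h.base.famR, h.rel⟩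

theorem relBody (h : IsFam Δ s s' A A' r B B' r') {t t' : DB} (ht : CICTyping Δ t (pi A B))
    (ht' : CICTyping Δ t' (pi A' B')) :
    CICTyping (ctx3 Δ s.flag A A' r) (relBody s'.flag B B' r' t t') (sort s'.rel) := by
  have h3 := h.base.ctx3
  have ren := IsRen.add_three h3
  have h1 : CICTyping (ctx3 Δ s.flag A A' r) (app (t.rename fun n => n + 3) (bvar 2))
      (B.rename famL) := by
    refine ((ht.ren ren).app (.of_eq (.lookup h3 (.succ (.succ .zero))) rfl ?_)).of_eq rfl ?_
    · simp [shift_eq]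
    · simp only [inst_eq, subst_rename]
      refine (subst_congr _ fun n => ?_).trans (rename_eq_subst _ _).symm
      cases n <;> rfl
  have h2 : CICTyping (ctx3 Δ s.flag A A' r) (app (t'.rename fun n => n + 3) (bvar 1))
      (B'.rename famR) := by
    refine ((ht'.ren ren).app (.of_eq (.lookup h3 (.succ .zero)) rfl ?_)).of_eq rfl ?_
    · simp [shift_eq]
    · simp only [inst_eq, subst_rename]
      refine (subst_congr _ fun n => ?_).trans (rename_eq_subst _ _).symm
      cases n <;> rfl
  exact (h.fam.proj.app h1).app (h2.of_eq rfl (inst_shift _ _).symm)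

theorem pi3 (h : IsFam Δ s s' A A' r B B' r') {t t' : DB} (ht : CICTyping Δ t (pi A B))
    (ht' : CICTyping Δ t' (pi A' B')) :
    CICTyping Δ (pi3 s.flag A A' r (DB.relBody s'.flag B B' r' t t'))
      (sort (s.prod (s.prod (s.rel.prod s'.rel)))) :=
  .pi h.base.left (.pi (h.base.right.weak h.base.left) (.pi h.base.relDom (h.relBody ht ht')))

end IsFam

/-- The universe `s₃` contains the products of types in `s` and `s'` and of related elements,
and has the flag of products in CoC⁻. -/
structure Srt.Admits (s s' s₃ : Srt) : Prop where
  flag : s₃.flag = s.flag.prod s'.flag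
  le : (s.prod s').le s₃
  rel : s₃.flag = .T → (s.prod (s.prod (s.rel.prod s'.rel))).le s₃

/-- Cumulativity gives in the target a universe even to products that have none in CoC⁻. If both
parts are in `Prop` or `Set`, the universe of the codomain does. -/
theorem Srt.exists_admits (s s' : Srt) : ∃ s₃, Srt.Admits s s' s₃ := by
  have aux (i j : ℕ) (hi : s.le (.type i)) (hj : s'.le (.type j))
      (h : s.flag.prod s'.flag = .T) : ∃ s₃, Srt.Admits s s' s₃ := by
    -- Above both parts, and by the successor visibly of flag `T`.
    refine ⟨.type (max i j + 1), h.symm, ?_, fun _ => ?_⟩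
    all_goals
      rcases s with _ | _ | s <;> rcases s' with _ | _ | s' <;>
        simp [Srt.prod, Srt.le, Srt.rel] at hi hj ⊢ <;> omega
  have bound (s : Srt) : ∃ i, s.le (.type i) := by
    cases s with
    | prop => exact ⟨0, trivial⟩
    | type i => exact ⟨i, Nat.le_refl i⟩
  obtain ⟨i, hi⟩ := bound s
  obtain ⟨j, hj⟩ := bound s'
  by_cases h : s.flag.prod s'.flag = .T
  · exact aux i j hi hj h
  · refine ⟨s', ?_, ?_, ?_⟩ <;> rcases s with _ | _ | s <;> rcases s' with _ | _ | s' <;>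
      simp [Srt.flag, Flag.prod, Srt.prod, Srt.le] at h ⊢

theorem Srt.admits_self (i : ℕ) : Srt.Admits (.type i) (.type i) (.type i) := by
  refine ⟨?_, ?_, fun _ => ?_⟩ <;> rcases i with _ | i <;>
    simp [Srt.flag, Flag.prod, Srt.prod, Srt.le, Srt.rel]

theorem Srt.admits_prop {s : Srt} (hs : s = .type 0 ∨ s = .prop) : Srt.Admits s .prop .prop := by
  rcases hs with rfl | rfl <;> exact ⟨rfl, trivial, fun h => nomatch h⟩

namespace IsFam

variable {Δ : List DB} {s s' : Srt} {A A' r B B' r' : DB}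

/-- The hypotheses of the combinators for products, instantiated. -/
theorem isSub (h : IsFam Δ s s' A A' r B B' r') (hs : s.le (.type 0))
    (hs' : s' ∈ [Srt.prop, .type 0]) : IsSub (ECtx.toDB (piCtx s')) Δ
      (scons (lam3 s.flag A A' r r') (scons (lam A' B') (scons (lam A B)
        (scons r (scons A' (scons A bvar)))))) := by
  have hΔ := h.base.left.ctx
  have hc := piCtx_ok s' hs'
  simp only [piCtx, ECtx.toDB] at hc ⊢
  rcases hc with _ | ⟨h5, -⟩
  have h5' := h5
  rcases h5' with _ | ⟨h4, -⟩
  have h4' := h4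
  rcases h4' with _ | ⟨h3, -⟩
  have h3' := h3
  rcases h3' with _ | ⟨h2, -⟩
  have h2' := h2
  rcases h2' with _ | ⟨h1, -⟩
  obtain ⟨u, hu⟩ := h.fam.left.relTy h.fam.right
  have hrel : relTy s A A' = app (app (isoRel.toDB []) A) A' := by
    rcases s with _ | _ | _
    · rfl
    · rfl
    · exact absurd hs (by simp [Srt.le])
  refine .cons (.cons (.cons (.cons (.cons (.cons (.nil _ _) h1 (h.base.left.sub_sort hs)
    (.conv (.of_eq ?_))) h2 (h.base.right.sub_sort hs) (.conv (.of_eq ?_))) h3 h.base.rel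
    (.conv (.of_eq ?_))) h4
    (.lam h.left (.pi h.base.left (.sort' (.cons hΔ h.base.left) _))) (.conv (.of_eq ?_))) h5
    (.lam h.right (.pi h.base.right (.sort' (.cons hΔ h.base.right) _))) (.conv (.of_eq ?_)))
    (piCtx_ok s' hs') (h.base.lam3 hu h.rel) (.conv ?_)
  · rfl
  · rfl
  · rw [hrel]
    simp [Tgt.toDB, Tgt.apps, subst, isoRel_toDB, isoRel_subst, ECtx.names]
  · simp [Tgt.toDB, Tgt.arr, subst, ECtx.names]
  · simp [Tgt.toDB, Tgt.arr, subst, ECtx.names]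
  -- The hypothesis on the relation of families mentions the families applied to variables, which
  -- are `β`-redexes after instantiation.
  · have hL : Conv (app (lam A B).shift.shift.shift (bvar 2)) (B.rename DB.famL) := by
      simp only [shift_eq, rename_rename]
      refine .trans .beta (.of_eq ?_)
      simp only [inst_eq, subst_rename]
      refine (subst_congr _ fun n => ?_).trans (rename_eq_subst _ _).symm
      cases n <;> rfl
    have hR : Conv (app (lam A' B').shift.shift.shift (bvar 1)) (B'.rename DB.famR) := by
      simp only [shift_eq, rename_rename]
      refine .trans .beta (.of_eq ?_)
      simp only [inst_eq, subst_rename]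
      refine (subst_congr _ fun n => ?_).trans (rename_eq_subst _ _).symm
      cases n <;> rfl
    refine .trans ?_ (.trans (.pi (.refl A) (.pi (.refl A'.shift) (.pi (.refl (DB.relDom s.flag A A' r))
      (.app (.app (.refl (isoRel.toDB [])) hL.symm) hR.symm)))) (.of_eq ?_))
    · refine .of_eq ?_
      simp only [List.mem_cons, List.not_mem_nil, or_false] at hs'
      rcases hs' with rfl | rfl <;> rfl
    · have hs : DB.relDom s.flag A A' r = app (app (app (app (app (projRel.toDB []) A.shift.shift)
          A'.shift.shift) r.shift.shift) (bvar 1)) (bvar 0) := by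
        rcases s with _ | _ | _
        · simp [Srt.flag, DB.relDom, DB.proj, shift_eq, DB.rename, projRel_rename]
        · simp [Srt.flag, DB.relDom, DB.proj, shift_eq, DB.rename, projRel_rename]
        · exact absurd hs (by simp [Srt.le])
      rw [hs]
      simp [Tgt.toDB, Tgt.apps, Tgt.arr, relA, subst, projRel_toDB, projRel_subst, isoRel_toDB,
        isoRel_subst, ECtx.names]
      exact ⟨rfl, rfl, rfl⟩

/-- For `Prop` and `Set` this instantiates the checked typing of a combinator and undoes a
`β`-expansion of the products. In a higher universe the relation is an explicit product, and
`Srt.Admits.rel` ensures that it fits into the same universe as the product itself. -/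
theorem trPi (h : IsFam Δ s s' A A' r B B' r') {s₃ : Srt} (hs : Srt.Admits s s' s₃) :
    IsRel Δ s₃ (.pi A B) (.pi A' B') (trPi s.flag s'.flag A A' r B B' r') := by
  have hpi := (CICTyping.pi h.base.left h.left).sub_sort hs.le
  have hpi' := (CICTyping.pi h.base.right h.right).sub_sort hs.le
  refine ⟨hpi, hpi', ?_⟩
  have hiso (h₃ : s₃.le (.type 0)) := ((CICTyping.of_nil (lib_typing .isoRel) hpi.ctx).app
    (hpi.sub_sort h₃)).app (hpi'.sub_sort h₃)
  have hconv (A B : DB) : Conv (.pi A (app (lam A B).shift (bvar 0))) (.pi A B) := by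
    refine .pi (.refl _) (.trans Conv.beta (.of_eq ?_))
    rw [inst_eq, subst_rename]
    refine ((subst_congr _ fun n => ?_).trans (subst_bvar B))
    rcases n with _ | n <;> rfl
  have hPS (h₃ : s₃.le (.type 0)) {t} (ht : CICTyping Δ t (app (app (isoRel.toDB [])
      (.pi A (app (lam A B).shift (bvar 0)))) (.pi A' (app (lam A' B').shift (bvar 0))))) :
      CICTyping Δ t (app (app (isoRel.toDB []) (.pi A B)) (.pi A' B')) :=
    .cumul ht (hiso h₃) (.conv (.app (.app (.refl _) (hconv _ _)) (hconv _ _)))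
  have hP (h0 : s.le (.type 0)) (h' : s' = .prop) := CICTyping.subst piProp_typing hpi.ctx (h' ▸ h.isSub h0 (by simp [h']))
  have hS (h0 : s.le (.type 0)) (h' : s' = .type 0) := CICTyping.subst piSet_typing hpi.ctx (h' ▸ h.isSub h0 (by simp [h']))
  simp [piCtx, ECtx.names, Tgt.apps, prod1, prod2, piApp, piComb, Tgt.toDB, isoRel_toDB,
    piProp_toDB, DB.subst, isoRel_subst, piProp_subst, piSet_toDB, piSet_subst] at hP hS
  have hT (i : ℕ) (h₃ : s₃ = .type (i + 1)) : CICTyping Δ (lam (.pi A B) (lam (DB.pi A' B').shift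
      (DB.pi3 s.flag (A.rename (fun n => n + 2)) (A'.rename (fun n => n + 2)) (r.rename (fun n => n + 2))
        (DB.relBody s'.flag (B.rename (upRen fun n => n + 2)) (B'.rename (upRen fun n => n + 2))
          (r'.rename (upRen (upRen (upRen fun n => n + 2)))) (bvar 1) (bvar 0)))))
      (.pi (.pi A B) (.pi (DB.pi A' B').shift (sort (.type (i + 1))))) := by
    subst h₃
    have h2 : CICCtx ((DB.pi A' B').shift :: DB.pi A B :: Δ) :=
      .cons (.cons hpi.ctx hpi) (hpi'.weak hpi)
    have := ((h.rename (.add_two h2)).pi3 (t := bvar 1) (t' := bvar 0)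
      (.of_eq (.lookup h2 (.succ .zero)) rfl ?_)
      (.of_eq (.lookup h2 .zero) rfl ?_)).sub_sort (hs.rel rfl)
    · exact .lam (.lam this (.pi (hpi'.weak hpi) (.sort' h2 _)))
        (.pi hpi (.pi (hpi'.weak hpi) (.sort' h2 _)))
    · simp [shift_eq, DB.rename, ← upRen_comp]
    · simp [shift_eq, DB.rename, ← upRen_comp]
  have := hs.flag
  unfold DB.trPi
  cases hf : s.flag.prod s'.flag
  · have h' : s' = .type 0 ∧ s.le (.type 0) ∧ s₃ = .type 0 := by
      rw [hf] at this
      rcases s with _ | _ | _ <;> rcases s' with _ | _ | _ <;> rcases s₃ with _ | _ | _ <;>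
        simp [Srt.flag, Flag.prod, Srt.le] at *
    obtain ⟨h', h0, rfl⟩ := h'
    exact hPS (Nat.le_refl 0) (hS h0 h')
  · have h' : s' = .prop ∧ s.le (.type 0) ∧ s₃ = .prop := by
      rw [hf] at this
      rcases s with _ | _ | _ <;> rcases s' with _ | _ | _ <;> rcases s₃ with _ | _ | _ <;>
        simp [Srt.flag, Flag.prod, Srt.le] at *
    obtain ⟨h', h0, rfl⟩ := h'
    exact hPS trivial (hP h0 h')
  · rw [hf] at this
    rcases s₃ with _ | _ | i
    · cases this
    · cases this
    · exact hT i rfl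

end IsFam

end WeakIsoRel

namespace WeakIsoRel

open Judg

/-! ## The abstraction theorem for terms with de Bruijn indices -/

theorem Src.emb_inst (b a : Src) : (b.inst a).emb = b.emb.inst a.emb := by
  rw [Src.inst, emb_subst, DB.inst_eq]
  refine DB.subst_congr _ fun n => ?_
  cases n <;> rfl

theorem Src.Sub.emb {A B : Src} (h : Sub A B) : Cumul A.emb B.emb := by
  induction h with
  | type _ h => exact .sort h.le
  | pi _ ih => exact .pi (.refl _) ih

/-- The first part of the abstraction theorem. -/
def Judg.Emb (Δ : List DB) : Judg → Prop
  | tm a B => CICTyping Δ a.emb B.emb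
  | ty B u => ∃ s : Srt, s.flag = u ∧ CICTyping Δ B.emb (.sort s)

/-- The rules of CoC⁻ hold in CIC once flags are erased. A type without a universe in CoC⁻ has one
in CIC, and it can be chosen with the flag of the type. -/
theorem SrcTyping.emb {Γ : List Src} {j} (h : SrcTyping Γ j) : j.Emb (Γ.map Src.emb) := by
  induction h with
  | sort => exact .sort
  | var _ ih => rw [Judg.Emb, Src.emb_shift]; exact .var ih
  | weak _ _ ih ih' => rw [Judg.Emb, Src.emb_shift, Src.emb_shift]; exact .weak ih ih'
  | conv _ _ h ih ih' => exact .cumul ih ih' (.conv h.emb)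
  | cum _ h _ ih ih' =>
    obtain ⟨s, -, hs⟩ := ih'
    exact .cumul ih hs h.emb
  | pi₁ _ _ ih ih' => exact (CICTyping.pi ih ih').sub_sort (Srt.admits_self _).le
  | pi₂ _ _ _ ih ih' => exact CICTyping.pi ih ih'
  | app _ _ _ _ ih ih' => rw [Judg.Emb, Src.emb_inst]; exact .app ih ih'
  | lam _ _ _ ih ih' ih'' =>
    obtain ⟨s, -, hs⟩ := ih''
    exact .lam ih' (.pi ih hs)
  | ty _ ih => exact ⟨_, rfl, ih⟩
  | @tyPi _ _ _ s g _ _ ih ih' =>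
    obtain ⟨s', rfl, hs⟩ := ih'
    obtain ⟨s₃, h⟩ := Srt.exists_admits s s'
    exact ⟨s₃, h.flag, (CICTyping.pi ih hs).sub_sort h.le⟩

/-- The premises on types carried by the rules are there for this purpose; only a flag can be
claimed, as the type of a function need not have a universe. -/
theorem SrcTyping.type {Γ : List Src} {j} (h : SrcTyping Γ j) :
    ∀ {a B}, j = tm a B → ∃ u, SrcTyping Γ (Judg.ty B u) := by
  induction h with
  | sort => rintro _ _ ⟨⟩; exact ⟨_, .ty .sort⟩
  | var h => rintro _ _ ⟨⟩; exact ⟨_, SrcTyping.weak_ty (.ty h) h⟩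
  | weak _ h ih => rintro _ _ ⟨⟩; obtain ⟨u, hu⟩ := ih rfl; exact ⟨u, hu.weak_ty h⟩
  | conv _ h => rintro _ _ ⟨⟩; exact ⟨_, .ty h⟩
  | cum _ _ h => rintro _ _ ⟨⟩; exact ⟨_, h⟩
  | pi₁ h => rintro _ _ ⟨⟩; exact ⟨_, .ty (SrcTyping.sort' h.ctx _)⟩
  | pi₂ _ h => rintro _ _ ⟨⟩; exact ⟨_, .ty (SrcTyping.sort' h.ctx _)⟩
  | app _ hN _ h => rintro _ _ ⟨⟩; exact ⟨_, h.inst hN⟩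
  | lam h _ h' => rintro _ _ ⟨⟩; exact ⟨_, .tyPi h h'⟩
  | ty => rintro _ _ ⟨⟩
  | tyPi => rintro _ _ ⟨⟩

theorem SrcTyping.ty_sort_flag {Γ : List Src} {s : Srt} {u : Flag} (h : SrcTyping Γ (Judg.ty (.sort s) u)) : u = Flag.T := by
  have := h.flag_unique (.ty (SrcTyping.sort' h.ctx s))
  rwa [Srt.flag_succ] at this

open DB

/-- The translation of contexts. -/
inductive TrCtx : List Src → List DB → Prop
  | nil : TrCtx [] []
  | cons {Γ Δ A s} : TrCtx Γ Δ → SrcTyping Γ (tm A (.sort s)) → IsRel Δ s A.e1 A.e2 A.tr →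
      TrCtx (A :: Γ) (ctx3 Δ s.flag A.e1 A.e2 A.tr)

namespace TrCtx

theorem ctx {Γ Δ} (h : TrCtx Γ Δ) : CICCtx Δ := by
  cases h with
  | nil => exact .nil
  | cons _ _ h => exact h.ctx3

/-- The unprimed copy of a source context sits inside its translation, as every third declaration.
With the analogous fact for the primed copy, this gives the first two parts of the theorem by
renaming. -/
theorem left {Γ Δ} (h : TrCtx Γ Δ) : IsRen (Γ.map Src.emb) Δ (fun n => 3 * n + 2) := by
  refine ⟨h.ctx, ?_⟩
  induction h with
  | nil => exact fun _ _ h => nomatch h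
  | @cons Γ Δ A s _ _ _ ih =>
    intro n B hB
    cases hB with
    | zero =>
      have := Lookup.succ (A := relDom s.flag A.e1 A.e2 A.tr)
        (Lookup.succ (A := A.e2.shift) (Lookup.zero (Γ := Δ) (A := A.e1)))
      simp only [ctx3, shift_eq, Src.e1, rename_rename] at this ⊢
      exact this
    | succ hB =>
      have := Lookup.succ (A := relDom s.flag A.e1 A.e2 A.tr)
        (Lookup.succ (A := A.e2.shift) (Lookup.succ (A := A.e1) (ih _ _ hB)))
      simp only [ctx3, shift_eq, rename_rename] at this ⊢
      exact this

theorem right {Γ Δ} (h : TrCtx Γ Δ) : IsRen (Γ.map Src.emb) Δ (fun n => 3 * n + 1) := by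
  refine ⟨h.ctx, ?_⟩
  induction h with
  | nil => exact fun _ _ h => nomatch h
  | @cons Γ Δ A s _ _ _ ih =>
    intro n B hB
    cases hB with
    | zero =>
      have := Lookup.succ (A := relDom s.flag A.e1 A.e2 A.tr)
        (Lookup.zero (Γ := A.e1 :: Δ) (A := A.e2.shift))
      simp only [ctx3, shift_eq, Src.e2, rename_rename] at this ⊢
      exact this
    | succ hB =>
      have := Lookup.succ (A := relDom s.flag A.e1 A.e2 A.tr)
        (Lookup.succ (A := A.e2.shift) (Lookup.succ (A := A.e1) (ih _ _ hB)))
      simp only [ctx3, shift_eq, rename_rename] at this ⊢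
      exact this

theorem e1 {Γ Δ a B} (h : TrCtx Γ Δ) (ha : SrcTyping Γ (tm a B)) : CICTyping Δ a.e1 B.e1 :=
  CICTyping.ren ha.emb h.left

theorem e2 {Γ Δ a B} (h : TrCtx Γ Δ) (ha : SrcTyping Γ (tm a B)) : CICTyping Δ a.e2 B.e2 :=
  CICTyping.ren ha.emb h.right

end TrCtx

theorem Src.b1_famL (t : Src) : t.b1.rename famL = t.e1 := by
  simp only [b1, e1, DB.rename_rename]
  refine DB.rename_congr _ fun n => ?_
  cases n <;> rfl

theorem Src.b2_famR (t : Src) : t.b2.rename famR = t.e2 := by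
  simp only [b2, e2, DB.rename_rename]
  refine DB.rename_congr _ fun n => ?_
  cases n <;> rfl

theorem DB.trSort_conv (s : Srt) (A A' : DB) :
    Conv (app (app (trSort s) A) A') (relTy s A A') := by
  rcases s with _ | _ | i
  all_goals
    refine (conv_lam2 ..).trans (.of_eq ?_)
    simp [relTy, subst, isoRel_subst, shift_eq, rename_eq_subst]

theorem DB.trSort_typing {Δ : List DB} (hΔ : CICCtx Δ) (s : Srt) :
    CICTyping Δ (trSort s) (pi (sort s) (pi (sort s) (sort s.succ))) := by
  have h0 := CICTyping.sort' hΔ s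
  have h1 := CICTyping.sort' (.cons hΔ h0) s
  have hc : CICCtx (sort s :: sort s :: Δ) := .cons (.cons hΔ h0) h1
  have v1 : CICTyping (sort s :: sort s :: Δ) (bvar 1) (sort s) := .lookup hc (.succ .zero)
  have v0 : CICTyping (sort s :: sort s :: Δ) (bvar 0) (sort s) := .lookup hc .zero
  have hb (b) (h : CICTyping (sort s :: sort s :: Δ) b (sort s.succ)) :
      CICTyping Δ (lam (sort s) (lam (sort s) b)) (pi (sort s) (pi (sort s) (sort s.succ))) := by
    have h2 := CICTyping.pi h1 (CICTyping.sort' hc s.succ)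
    exact .lam (.lam h h2) (.pi h0 h2)
  have iso (hs : s.le (.type 0)) := ((CICTyping.of_nil (lib_typing .isoRel) hc).app
    (v1.sub_sort hs)).app (v0.sub_sort hs)
  rcases s with _ | _ | i
  · exact hb _ (iso trivial)
  · exact hb _ (iso (Nat.le_refl 0))
  · have v1' : CICTyping (bvar 1 :: sort (.type (i + 1)) :: sort (.type (i + 1)) :: Δ) (bvar 1)
      (sort (.type (i + 1))) := .lookup (.cons hc v1) (.succ .zero)
    refine hb _ (CICTyping.sub_sort (.pi v1 (.pi v1' (.sort' (.cons (.cons hc v1) v1') _))) ?_)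
    simp [Srt.prod, Srt.succ, Srt.le]

/-- The translation of a universe is an abstraction over two types. Both its application and its
`β`-reduct are types, so the two readings can be exchanged. -/
theorem DB.relTy_iff {Δ : List DB} {s A A' r} (hA : CICTyping Δ A (sort s))
    (hA' : CICTyping Δ A' (sort s)) :
    CICTyping Δ r (app (app (trSort s) A) A') ↔ CICTyping Δ r (relTy s A A') := by
  constructor
  · intro h
    obtain ⟨s', hs⟩ := hA.relTy hA'
    exact .cumul h hs (.conv (trSort_conv ..))
  · intro h
    exact .cumul h (((trSort_typing hA.ctx s).app hA).app hA') (.conv (trSort_conv ..).symm)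

/-- The last part of the abstraction theorem. -/
def Judg.Tr (Γ : List Src) (Δ : List DB) : Judg → Prop
  | tm a B => ∃ u, SrcTyping Γ (Judg.ty B u) ∧
      CICTyping Δ a.tr (app (app (proj u B.e1 B.e2 B.tr) a.e1) a.e2)
  | ty B u => ∃ s : Srt, s.flag = u ∧ CICTyping (Γ.map Src.emb) B.emb (sort s) ∧
      CICTyping Δ B.tr (relTy s B.e1 B.e2)

namespace Judg

/-- For a type `A` the theorem at `A : s` says that `[[A]]` is a relation, bundled or not: universes
have flag `T`, so `proj` disappears. -/
theorem Tr.isRel {Γ Δ A s} (h : (tm A (.sort s)).Tr Γ Δ) (hΓ : TrCtx Γ Δ)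
    (hA : SrcTyping Γ (tm A (.sort s))) : IsRel Δ s A.e1 A.e2 A.tr := by
  obtain ⟨u, hu, h⟩ := h
  obtain rfl := hu.ty_sort_flag
  exact ⟨hΓ.e1 hA, hΓ.e2 hA, (relTy_iff (hΓ.e1 hA) (hΓ.e2 hA)).1 h⟩

theorem Tr.of_isRel {Γ Δ A s} (h : IsRel Δ s A.e1 A.e2 A.tr) (hΓ : SrcCtx Γ) :
    (tm A (.sort s)).Tr Γ Δ :=
  ⟨_, .ty (.sort' hΓ s), by
    rw [Srt.flag_succ]; exact (relTy_iff h.left h.right).2 h.rel⟩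

theorem Tr.tm_flag {Γ Δ a B u} (h : (tm a B).Tr Γ Δ) (hu : SrcTyping Γ (Judg.ty B u)) :
    CICTyping Δ a.tr (app (app (proj u B.e1 B.e2 B.tr) a.e1) a.e2) := by
  obtain ⟨u', hu', h⟩ := h
  rwa [hu.flag_unique hu']

end Judg

theorem TrCtx.isFam {Γ Δ} {A B : Src} {s s' : Srt} (hΓ : TrCtx Γ Δ) (hA : IsRel Δ s A.e1 A.e2 A.tr)
    (hB : CICTyping ((A :: Γ).map Src.emb) B.emb (sort s'))
    (hr : CICTyping (ctx3 Δ s.flag A.e1 A.e2 A.tr) B.tr (relTy s' B.e1 B.e2))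
    (hA' : SrcTyping Γ (tm A (.sort s))) :
    IsFam Δ s s' A.e1 A.e2 A.tr B.b1 B.b2 B.tr :=
  ⟨hA, hB.ren (hΓ.left.up (s := s) hA'.emb), hB.ren (hΓ.right.up (s := s) hA'.emb),
    hr.of_eq rfl (by rw [Src.b1_famL, Src.b2_famR])⟩

theorem Src.relBody_eq (g : Flag) (B : Src) (t t' : DB) : relBody g B.b1 B.b2 B.tr t t' =
    DB.app (DB.app (proj g B.e1 B.e2 B.tr) (DB.app (t.rename (fun n => n + 3)) (DB.bvar 2)))
      (DB.app (t'.rename (fun n => n + 3)) (DB.bvar 1)) := by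
  rw [relBody, b1_famL, b2_famR]

/-- The translation of a universe is covariant in it, once two types are supplied. At a product,
`conv_trPi` exposes the codomain at the end of three products with unchanged domains, where
cumulativity of CIC applies. The claim for all `t`, `t'` is needed since these are applied to
variables under the binders. -/
theorem Src.Sub.tr {A B : Src} (h : Sub A B) : ∀ {Γ : List Src} {u}, SrcTyping Γ (Judg.ty A u) → ∀ t t' : DB,
    Cumul (DB.app (DB.app (proj u A.e1 A.e2 A.tr) t) t') (DB.app (DB.app (proj u B.e1 B.e2 B.tr) t) t') := by
  induction h with
  | @type i j h h' =>
    intro Γ u hu t t'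
    obtain rfl := hu.ty_sort_flag
    obtain ⟨i, rfl⟩ := Nat.exists_eq_succ_of_ne_zero h.ne'
    obtain ⟨j, rfl⟩ := Nat.exists_eq_succ_of_ne_zero (h.trans h').ne'
    refine .trans (.conv (trSort_conv (.type (i + 1)) t t'))
      (.trans ?_ (.conv (trSort_conv (.type (j + 1)) t t').symm))
    exact .pi (.refl _) (.pi (.refl _) (.sort h'.le))
  | @pi f g C A B hs ih =>
    intro Γ u hu t t'
    obtain rfl := hu.ty_pi_flag
    obtain ⟨s, rfl, hC, hA⟩ := hu.ty_pi_inv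
    refine .trans (.conv (conv_trPi ..)) (.trans ?_ (.conv (conv_trPi ..).symm))
    change Cumul (pi3 _ _ _ _ (relBody g A.b1 A.b2 A.tr t t'))
      (pi3 _ _ _ _ (relBody g B.b1 B.b2 B.tr t t'))
    rw [Src.relBody_eq, Src.relBody_eq]
    exact .pi (.refl _) (.pi (.refl _) (.pi (.refl _) (ih hA _ _)))

theorem CICTyping.app3 {Δ f A A' r C t x x' p} (ht : CICTyping Δ t (pi3 f A A' r C))
    (hx : CICTyping Δ x A) (hx' : CICTyping Δ x' A')
    (hp : CICTyping Δ p (.app (.app (proj f A A' r) x) x')) :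
    CICTyping Δ (.app (.app (.app t x) x') p) (inst3 C x x' p) := by
  refine (((ht.app hx).app (hx'.of_eq rfl (inst_shift _ _).symm)).app
    (hp.of_eq rfl ?_)).of_eq rfl ?_
  · simp [relDom, DB.subst, shift_eq]
  · simp only [inst_eq, subst_subst, inst3]
    refine subst_congr _ fun n => ?_
    rcases n with _ | _ | _ | n <;> simp [DB.subst, shift_eq]

/-- Matches the type of a translated application with what the theorem asks for: putting `N`, `N'`,
`[[N]]` for the three variables translates the instance of the codomain. -/
theorem Src.inst3_relBody (g : Flag) (B N : Src) (t t' : DB) :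
    inst3 (relBody g B.b1 B.b2 B.tr t t') N.e1 N.e2 N.tr =
      DB.app (DB.app (proj g (B.inst N).e1 (B.inst N).e2 (B.inst N).tr) (DB.app t N.e1)) (DB.app t' N.e2) := by
  rw [relBody_eq, Src.inst, e1_subst, e2_subst, tr_subst, sub3_scons]
  simp [inst3, DB.subst, proj_subst]

/-- The abstraction theorem proper. It is stated for an arbitrary translation of the context, so
that the premises under a binder can use the context extended by the relation that the induction
hypothesis for the domain provides. -/
theorem SrcTyping.tr {Γ : List Src} {j} (h : SrcTyping Γ j) :
    ∀ {Δ}, TrCtx Γ Δ → j.Tr Γ Δ := by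
  induction h with
  | @sort s =>
    intro Δ hΓ
    refine .of_isRel ⟨.sort' hΓ.ctx _, .sort' hΓ.ctx _, ?_⟩ .nil
    have := trSort_typing hΓ.ctx s
    rcases s with _ | _ | i <;> exact this
  | var hA ih =>
    rintro _ (_ | ⟨hΓ, hA', h⟩)
    refine ⟨_, SrcTyping.weak_ty (.ty hA') hA', (CICTyping.lookup h.ctx3 .zero).of_eq rfl ?_⟩
    simp [relDom, shift_eq, DB.rename, proj_rename, Src.tr_shift, Src.e1_shift, Src.e2_shift]
    exact ⟨rfl, rfl⟩
  | weak _ hA ih =>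
    rintro _ (_ | ⟨hΓ, hA', h⟩)
    obtain ⟨u, hu, ht⟩ := ih hΓ
    refine ⟨u, hu.weak_ty hA', (ht.ren (.add_three h.ctx3)).of_eq ?_ ?_⟩
    · rw [Src.tr_shift]
    · simp [DB.rename, proj_rename, Src.tr_shift, Src.e1_shift, Src.e2_shift]
  | @conv Γ a A B s ha hB h ih ih' =>
    intro Δ hΓ
    obtain ⟨u, hu, ht⟩ := ih hΓ
    have hB' := (ih' hΓ).isRel hΓ hB
    -- The old type may lack a universe in CoC⁻, but by invariance of flags under conversion both
    -- types use the same projection.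
    obtain rfl : u = s.flag := PTS.flag_eq hu.pts (SrcTyping.pts (.ty hB)) h.collapse
    have := SrcTyping.conv ha hB h
    exact ⟨_, .ty hB, .cumul ht (hB'.at_app (hΓ.e1 this) (hΓ.e2 this))
      (.conv (.app (.app (.proj h.e1 h.e2 h.tr) (.refl _)) (.refl _)))⟩
  | @cum Γ a A B u ha h hB ih ih' =>
    intro Δ hΓ
    obtain ⟨u', hu, ht⟩ := ih hΓ
    obtain rfl : u' = u := (SrcTyping.ty_sub h hu).flag_unique hB
    obtain ⟨s, rfl, hs, hr⟩ := ih' hΓ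
    have := SrcTyping.cum ha h hB
    exact ⟨_, hB, .cumul ht (IsRel.at_app ⟨hs.ren hΓ.left, hs.ren hΓ.right, hr⟩ (hΓ.e1 this)
      (hΓ.e2 this)) (h.tr hu _ _)⟩
  | pi₁ hA hB ih ih' =>
    intro Δ hΓ
    have hA' := (ih hΓ).isRel hΓ hA
    have hB' := (ih' (.cons hΓ hA hA')).isRel (.cons hΓ hA hA') hB
    exact .of_isRel ((hΓ.isFam hA' hB.emb hB'.rel hA).trPi (Srt.admits_self _)) hA.ctx
  | pi₂ hs hA hB ih ih' =>
    intro Δ hΓ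
    have hA' := (ih hΓ).isRel hΓ hA
    have hB' := (ih' (.cons hΓ hA hA')).isRel (.cons hΓ hA hA') hB
    exact .of_isRel ((hΓ.isFam hA' hB.emb hB'.rel hA).trPi (Srt.admits_prop hs)) hA.ctx
  | @app Γ M N A B s g hM hN hA hB ihM ihN ihA ihB =>
    intro Δ hΓ
    have hA' := (ihA hΓ).isRel hΓ hA
    obtain ⟨s', rfl, hs', hr⟩ := ihB (.cons hΓ hA hA')
    refine ⟨_, hB.inst hN, ?_⟩
    -- With the flag of the product made explicit, `conv_trPi` turns the type of `[[M]]` into a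
    -- product over three related variables.
    have h1 := (ihM hΓ).tm_flag (.tyPi hA hB)
    have h2 := (hΓ.isFam hA' hs' hr hA).pi3 (hΓ.e1 hM) (hΓ.e2 hM)
    exact ((CICTyping.cumul h1 h2 (.conv (conv_trPi ..))).app3 (hΓ.e1 hN) (hΓ.e2 hN)
      ((ihN hΓ).tm_flag (.ty hA))).of_eq rfl (Src.inst3_relBody ..)
  | @lam Γ A b B s g hA hb hB ihA ihb ihB =>
    intro Δ hΓ
    have hA' := (ihA hΓ).isRel hΓ hA
    have hΓ' := hΓ.cons hA hA'
    obtain ⟨s', rfl, hs', hr⟩ := ihB hΓ'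
    have hl := SrcTyping.lam hA hb hB
    have hpi := SrcTyping.tyPi hA hB
    refine ⟨_, hpi, ?_⟩
    have hF := hΓ.isFam hA' hs' hr hA
    have h1 := (ihb hΓ').tm_flag hB
    have h2 := hF.relBody (hΓ.e1 hl) (hΓ.e2 hl)
    -- The relation between the functions applies them to the bound variables; by `β` this relates
    -- the bodies, as the induction hypothesis does.
    have hc1 : Conv (DB.app ((Src.lam s.flag A b).e1.rename (fun n => n + 3)) (.bvar 2)) b.e1 := by
      refine Conv.beta.trans (.of_eq ?_)
      rw [← Src.b1_famL, inst_eq, ← Src.b1, subst_rename, rename_eq_subst b.b1]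
      refine subst_congr _ fun n => ?_
      cases n <;> rfl
    have hc2 : Conv (DB.app ((Src.lam s.flag A b).e2.rename (fun n => n + 3)) (.bvar 1)) b.e2 := by
      refine Conv.beta.trans (.of_eq ?_)
      rw [← Src.b2_famR, inst_eq, ← Src.b2, subst_rename, rename_eq_subst b.b2]
      refine subst_congr _ fun n => ?_
      cases n <;> rfl
    have h3 : CICTyping _ b.tr _ := .cumul h1 h2 (.conv (by
      rw [Src.relBody_eq]
      exact .app (.app (.refl _) hc1.symm) hc2.symm))
    obtain ⟨s₃, hs₃⟩ := Srt.exists_admits s s'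
    have hP := hF.trPi hs₃
    rw [← hs₃.flag]
    refine .cumul (hA'.lam3 h2 h3) (hP.at_app (hΓ.e1 hl) (hΓ.e2 hl)) (.conv ?_)
    rw [hs₃.flag]
    exact (conv_trPi ..).symm
  | ty hB ih =>
    intro Δ hΓ
    exact ⟨_, rfl, hB.emb, ((ih hΓ).isRel hΓ hB).rel⟩
  | tyPi hA hB ih ih' =>
    intro Δ hΓ
    have hA' := (ih hΓ).isRel hΓ hA
    obtain ⟨s', rfl, hs', hr⟩ := ih' (.cons hΓ hA hA')
    obtain ⟨s₃, hs₃⟩ := Srt.exists_admits _ s'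
    exact ⟨s₃, hs₃.flag, (CICTyping.pi hA.emb hs').sub_sort hs₃.le,
      ((hΓ.isFam hA' hs' hr hA).trPi hs₃).rel⟩

/-- The declared types are translated by the theorem over the preceding part of the context. -/
theorem TrCtx.exists {Γ} (h : SrcCtx Γ) : ∃ Δ, TrCtx Γ Δ := by
  induction h with
  | nil => exact ⟨_, .nil⟩
  | cons _ hA ih =>
    obtain ⟨Δ, hΔ⟩ := ih
    exact ⟨_, .cons hΔ hA ((hA.tr hΔ).isRel hΔ hA)⟩

end WeakIsoRel

namespace WeakIsoRel

/-! ## Named terms and their de Bruijn forms -/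

namespace Src

/-- All indices are below `n`. -/
def Scoped : ℕ → Src → Prop
  | n, bvar k => k < n
  | _, sort _ => True
  | n, pi _ _ A B => Scoped n A ∧ Scoped (n + 1) B
  | n, lam _ A b => Scoped n A ∧ Scoped (n + 1) b
  | n, app M N => Scoped n M ∧ Scoped n N

theorem Scoped.rename {t : Src} : ∀ {n m : ℕ} {ρ : ℕ → ℕ}, Scoped n t → (∀ k < n, ρ k < m) →
    Scoped m (rename ρ t) := by
  have up {n m : ℕ} {ρ : ℕ → ℕ} (h : ∀ k < n, ρ k < m) : ∀ k < n + 1, DB.upRen ρ k < m + 1 := by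
    rintro (_ | k) hk
    · exact Nat.succ_pos _
    · exact Nat.succ_lt_succ (h k (Nat.lt_of_succ_lt_succ hk))
  induction t with
  | bvar k => exact fun h hρ => hρ _ h
  | sort => exact fun _ _ => trivial
  | pi _ _ A B ihA ihB => exact fun h hρ => ⟨ihA h.1 hρ, ihB h.2 (up hρ)⟩
  | lam _ A B ihA ihB => exact fun h hρ => ⟨ihA h.1 hρ, ihB h.2 (up hρ)⟩
  | app A B ihA ihB => exact fun h hρ => ⟨ihA h.1 hρ, ihB h.2 hρ⟩

theorem Scoped.shift {t : Src} {n : ℕ} (h : Scoped n t) : Scoped (n + 1) t.shift :=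
  h.rename fun _ => Nat.succ_lt_succ

theorem Scoped.subst {t : Src} : ∀ {n m : ℕ} {σ : ℕ → Src}, Scoped n t →
    (∀ k < n, Scoped m (σ k)) → Scoped m (subst σ t) := by
  have up {n m : ℕ} {σ : ℕ → Src} (h : ∀ k < n, Scoped m (σ k)) :
      ∀ k < n + 1, Scoped (m + 1) (up σ k) := by
    rintro (_ | k) hk
    · exact Nat.succ_pos _
    · exact (h k (Nat.lt_of_succ_lt_succ hk)).shift
  induction t with
  | bvar k => exact fun h hρ => hρ _ h
  | sort => exact fun _ _ => trivial
  | pi _ _ A B ihA ihB => exact fun h hρ => ⟨ihA h.1 hρ, ihB h.2 (up hρ)⟩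
  | lam _ A B ihA ihB => exact fun h hρ => ⟨ihA h.1 hρ, ihB h.2 (up hρ)⟩
  | app A B ihA ihB => exact fun h hρ => ⟨ihA h.1 hρ, ihB h.2 hρ⟩

theorem Scoped.inst {b a : Src} {n : ℕ} (hb : Scoped (n + 1) b) (ha : Scoped n a) :
    Scoped n (b.inst a) := by
  refine hb.subst ?_
  rintro (_ | k) hk
  · exact ha
  · exact Nat.lt_of_succ_lt_succ hk

end Src

/-- The de Bruijn form of a named term under the binders `l`, innermost first. -/
def Term.toSrc : List Name → Term → Src
  | l, .var x => .bvar (l.idxOf x)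
  | _, .sort s => .sort s
  | l, .pi f g x A B => .pi f g (A.toSrc l) (B.toSrc (x :: l))
  | l, .lam f x A b => .lam f (A.toSrc l) (b.toSrc (x :: l))
  | l, .app M N => .app (M.toSrc l) (N.toSrc l)

/-- A named form of a de Bruijn term under the binders `l`, with bound variables from `k` on. -/
def Src.toTerm : List Name → ℕ → Src → Term
  | l, _, .bvar n => .var (l.getD n 0)
  | _, _, .sort s => .sort s
  | l, k, .pi f g A B => .pi f g k (A.toTerm l (k + 1)) (B.toTerm (k :: l) (k + 1))
  | l, k, .lam f A b => .lam f k (A.toTerm l (k + 1)) (b.toTerm (k :: l) (k + 1))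
  | l, k, .app M N => .app (M.toTerm l k) (N.toTerm l k)

namespace Term

theorem scoped_toSrc (t : Term) : ∀ l : List Name,
    (t.toSrc l).Scoped l.length ↔ ∀ x ∈ fv t, x ∈ l := by
  have bind (A B : Finset Name) (x : Name) (l : List Name) :
      ((∀ y ∈ A, y ∈ l) ∧ ∀ y ∈ B, y ∈ x :: l) ↔ ∀ y ∈ A ∪ B.erase x, y ∈ l := by
    simp only [Finset.mem_union, Finset.mem_erase, List.mem_cons]
    grind
  induction t with
  | var x => intro l; simp [toSrc, Src.Scoped, fv, List.idxOf_lt_length_iff]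
  | sort s => intro l; simp [toSrc, Src.Scoped, fv]
  | pi f g x A B ihA ihB =>
    intro l
    rw [fv, ← bind, ← ihA, ← ihB]; rfl
  | lam f x A B ihA ihB =>
    intro l
    rw [fv, ← bind, ← ihA, ← ihB]; rfl
  | app M N ihA ihB =>
    intro l
    simp only [toSrc, Src.Scoped, fv, ihA, ihB, Finset.mem_union]
    grind

theorem idxOf_up {l l' : List Name} {x y : Name} {ρ : ℕ → ℕ}
    (h : x ≠ y → l'.idxOf x = ρ (l.idxOf x)) :
    (y :: l').idxOf x = DB.upRen ρ ((y :: l).idxOf x) := by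
  by_cases hx : y = x
  · subst hx; simp
  · rw [List.idxOf_cons_ne _ hx, List.idxOf_cons_ne _ hx, h (Ne.symm hx)]; rfl

theorem toSrc_rename (t : Term) : ∀ {l l' : List Name} {ρ : ℕ → ℕ},
    (∀ x ∈ fv t, l'.idxOf x = ρ (l.idxOf x)) → t.toSrc l' = (t.toSrc l).rename ρ := by
  induction t with
  | var x => intro l l' ρ h; simp [toSrc, Src.rename, h x (by simp [fv])]
  | sort s => intros; rfl
  | pi f g x A B ihA ihB =>
    intro l l' ρ h
    rw [toSrc, ihA fun y hy => h y (by simp [fv, hy]), ihB (ρ := DB.upRen ρ) (l := x :: l)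
      fun y hy => idxOf_up fun hxy => h y (by simp [fv, hy, hxy])]
    rfl
  | lam f x A B ihA ihB =>
    intro l l' ρ h
    rw [toSrc, ihA fun y hy => h y (by simp [fv, hy]), ihB (ρ := DB.upRen ρ) (l := x :: l)
      fun y hy => idxOf_up fun hxy => h y (by simp [fv, hy, hxy])]
    rfl
  | app M N ihA ihB =>
    intro l l' ρ h
    rw [toSrc, ihA fun y hy => h y (by simp [fv, hy]), ihB fun y hy => h y (by simp [fv, hy])]
    rfl

theorem toSrc_cons {t : Term} {x : Name} (h : x ∉ fv t) (l : List Name) :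
    t.toSrc (x :: l) = (t.toSrc l).shift := by
  refine toSrc_rename t fun y hy => List.idxOf_cons_ne _ ?_
  rintro rfl
  exact h hy

theorem subst_up {l l' : List Name} {x : Name} {u : Term} {σ : ℕ → Src} {b : Finset Name}
    (h : ∀ y ∈ b, y ≠ x → σ (l.idxOf y) = .bvar (l'.idxOf y))
    (hx : σ (l.idxOf x) = u.toSrc l') {z : Name} (hz : z ≠ x) (hu : z ∉ fv u) {B : Finset Name}
    (hb : B.erase z ⊆ b) :
    (∀ y ∈ B, y ≠ x → Src.up σ ((z :: l).idxOf y) = .bvar ((z :: l').idxOf y)) ∧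
      Src.up σ ((z :: l).idxOf x) = u.toSrc (z :: l') := by
  constructor
  · intro y hy hyx
    by_cases hyz : z = y
    · subst hyz; simp
    · rw [List.idxOf_cons_ne _ hyz, List.idxOf_cons_ne _ hyz, Src.up_succ,
        h y (hb (Finset.mem_erase.2 ⟨Ne.symm hyz, hy⟩)) hyx]
      rfl
  · rw [List.idxOf_cons_ne _ hz, Src.up_succ, hx, toSrc_cons hu]

/-- No bound variable of `b` is `x` or free in `u`, so nothing is shadowed or captured and naive
substitution agrees with that on indices. -/
theorem toSrc_unsafeSubst {x : Name} {u : Term} (b : Term) : ∀ {l l' : List Name} {σ : ℕ → Src},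
    (∀ y ∈ fv b, y ≠ x → σ (l.idxOf y) = .bvar (l'.idxOf y)) → σ (l.idxOf x) = u.toSrc l' →
    x ∉ bv b → (∀ y ∈ bv b, y ∉ fv u) →
    (unsafeSubst x u b).toSrc l' = (b.toSrc l).subst σ := by
  induction b with
  | var y =>
    intro l l' σ h hx _ _
    by_cases hy : y = x
    · subst hy; simp [unsafeSubst, toSrc, Src.subst, hx]
    · simp [unsafeSubst, toSrc, Src.subst, hy, h y (by simp [fv]) hy]
  | sort s => intros; rfl
  | pi f g z A B ihA ihB =>
    intro l l' σ h hx hb hu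
    simp only [bv, Finset.mem_insert, Finset.mem_union, not_or] at hb hu
    have hz := Ne.symm hb.1
    obtain ⟨h1, h2⟩ := subst_up h hx hz (hu z (.inl rfl)) (B := fv B) (by simp [fv])
    rw [unsafeSubst, if_neg hz, toSrc, ihA (fun y hy => h y (by simp [fv, hy])) hx hb.2.1
      (fun y hy => hu y (.inr (.inl hy))), ihB h1 h2 hb.2.2 (fun y hy => hu y (.inr (.inr hy)))]
    rfl
  | lam f z A B ihA ihB =>
    intro l l' σ h hx hb hu
    simp only [bv, Finset.mem_insert, Finset.mem_union, not_or] at hb hu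
    have hz := Ne.symm hb.1
    obtain ⟨h1, h2⟩ := subst_up h hx hz (hu z (.inl rfl)) (B := fv B) (by simp [fv])
    rw [unsafeSubst, if_neg hz, toSrc, ihA (fun y hy => h y (by simp [fv, hy])) hx hb.2.1
      (fun y hy => hu y (.inr (.inl hy))), ihB h1 h2 hb.2.2 (fun y hy => hu y (.inr (.inr hy)))]
    rfl
  | app M N ihA ihB =>
    intro l l' σ h hx hb hu
    simp only [bv, Finset.mem_union, not_or] at hb hu
    rw [unsafeSubst, toSrc, ihA (fun y hy => h y (by simp [fv, hy])) hx hb.1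
      (fun y hy => hu y (.inl hy)), ihB (fun y hy => h y (by simp [fv, hy])) hx hb.2
      (fun y hy => hu y (.inr hy))]
    rfl

theorem AlphaVar.idxOf {L : List (Name × Name)} {x y : Name} (h : AlphaVar L x y)
    (l : List Name) : (L.map Prod.fst ++ l).idxOf x = (L.map Prod.snd ++ l).idxOf y := by
  induction L with
  | nil => cases (show x = y from h); rfl
  | cons p L ih =>
    rcases h with ⟨rfl, rfl⟩ | ⟨hx, hy, h⟩
    · simp
    · simp [List.idxOf_cons_ne _ hx.symm, List.idxOf_cons_ne _ hy.symm, ih h]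

theorem AlphaIn.toSrc {t : Term} : ∀ {u : Term} {L : List (Name × Name)}, AlphaIn L t u →
    ∀ l : List Name, t.toSrc (L.map Prod.fst ++ l) = u.toSrc (L.map Prod.snd ++ l) := by
  induction t with
  | var x =>
    rintro (y | _ | _ | _ | _) L h l
    · exact congrArg Src.bvar (AlphaVar.idxOf h l)
    all_goals exact h.elim
  | sort s =>
    rintro (_ | _ | _ | _ | _) L h l
    · exact h.elim
    · exact congrArg Src.sort h
    all_goals exact h.elim
  | pi f g x A B ihA ihB =>
    rintro (_ | _ | ⟨f', g', x', A', B'⟩ | _ | _) L h l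
    · exact h.elim
    · exact h.elim
    · obtain ⟨rfl, rfl, hA, hB⟩ := h
      have := ihB hB l
      simp only [List.map_cons, List.cons_append] at this
      simp only [Term.toSrc, ihA hA l, this]
    all_goals exact h.elim
  | lam f x A B ihA ihB =>
    rintro (_ | _ | _ | ⟨f', x', A', B'⟩ | _) L h l
    · exact h.elim
    · exact h.elim
    · exact h.elim
    · obtain ⟨rfl, hA, hB⟩ := h
      have := ihB hB l
      simp only [List.map_cons, List.cons_append] at this
      simp only [Term.toSrc, ihA hA l, this]
    · exact h.elim
  | app M N ihA ihB =>
    rintro (_ | _ | _ | _ | _) L h l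
    iterate 4 exact h.elim
    simp only [Term.toSrc, ihA h.1 l, ihB h.2 l]

theorem Alpha.toSrc {t u : Term} (h : Alpha t u) (l : List Name) : t.toSrc l = u.toSrc l :=
  AlphaIn.toSrc h l

theorem AlphaVar.of_idxOf {l : List Name} : ∀ {L : List (Name × Name)} {x y : Name},
    x ∈ L.map Prod.fst ++ l →
    (L.map Prod.fst ++ l).idxOf x = (L.map Prod.snd ++ l).idxOf y → AlphaVar L x y
  | [], x, y, hx, h => List.idxOf_inj hx |>.1 h
  | (a, b) :: L, x, y, hx, h => by
    simp only [List.map_cons, List.cons_append] at h hx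
    by_cases hxa : a = x
    · by_cases hyb : b = y
      · exact .inl ⟨hxa.symm, hyb.symm⟩
      · subst hxa; rw [List.idxOf_cons_self, List.idxOf_cons_ne _ hyb] at h; cases h
    · by_cases hyb : b = y
      · subst hyb; rw [List.idxOf_cons_self, List.idxOf_cons_ne _ hxa] at h; cases h
      · rw [List.idxOf_cons_ne _ hyb, List.idxOf_cons_ne _ hxa] at h
        exact .inr ⟨Ne.symm hxa, Ne.symm hyb, of_idxOf
          ((List.mem_cons.1 hx).resolve_left (Ne.symm hxa)) (Nat.succ_injective h)⟩

/-- All unbound variables share the index at the end of the list, so the converse fails for open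
terms; the condition on free variables excludes this. -/
theorem AlphaIn.of_toSrc {l : List Name} {t : Term} : ∀ {u : Term} {L : List (Name × Name)},
    (∀ x ∈ fv t, x ∈ L.map Prod.fst ++ l) →
    t.toSrc (L.map Prod.fst ++ l) = u.toSrc (L.map Prod.snd ++ l) → AlphaIn L t u := by
  induction t with
  | var x =>
    rintro (y | _ | _ | _ | _) L hs h <;> simp only [Term.toSrc, reduceCtorEq] at h
    exact .of_idxOf (hs x (by simp [fv])) (Src.bvar.inj h)
  | sort s =>
    rintro (y | _ | _ | _ | _) L hs h <;> simp only [Term.toSrc, reduceCtorEq] at h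
    exact Src.sort.inj h
  | pi f g x A B ihA ihB =>
    rintro (_ | _ | ⟨f', g', x', A', B'⟩ | _ | _) L hs h <;>
      simp only [Term.toSrc, reduceCtorEq] at h
    obtain ⟨rfl, rfl, hA, hB⟩ := Src.pi.inj h
    refine ⟨rfl, rfl, ihA (fun y hy => hs y (by simp [fv, hy])) hA,
      ihB (L := (x, x') :: L) (fun y hy => ?_) hB⟩
    by_cases hyx : y = x
    · simp [hyx]
    · exact List.mem_cons_of_mem _ (hs y (by simp [fv, hy, hyx]))
  | lam f x A B ihA ihB =>
    rintro (_ | _ | _ | ⟨f', x', A', B'⟩ | _) L hs h <;>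
      simp only [Term.toSrc, reduceCtorEq] at h
    obtain ⟨rfl, hA, hB⟩ := Src.lam.inj h
    refine ⟨rfl, ihA (fun y hy => hs y (by simp [fv, hy])) hA,
      ihB (L := (x, x') :: L) (fun y hy => ?_) hB⟩
    by_cases hyx : y = x
    · simp [hyx]
    · exact List.mem_cons_of_mem _ (hs y (by simp [fv, hy, hyx]))
  | app M N ihA ihB =>
    rintro (_ | _ | _ | _ | ⟨M', N'⟩) L hs h <;> simp only [Term.toSrc, reduceCtorEq] at h
    obtain ⟨hM, hN⟩ := Src.app.inj h
    exact ⟨ihA (fun y hy => hs y (by simp [fv, hy])) hM,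
      ihB (fun y hy => hs y (by simp [fv, hy])) hN⟩

theorem Alpha.of_toSrc {l : List Name} {t u : Term} (ht : (t.toSrc l).Scoped l.length)
    (h : t.toSrc l = u.toSrc l) : Alpha t u :=
  AlphaIn.of_toSrc ((scoped_toSrc t l).1 ht) h

end Term

/-! ### Named forms with canonical bound variables. -/

namespace Src

theorem bv_toTerm (t : Src) : ∀ (l : List Name) (k : ℕ), ∀ x ∈ Term.bv (t.toTerm l k), k ≤ x := by
  induction t with
  | bvar | sort => simp [toTerm, Term.bv]
  | pi f g A B ihA ihB =>
    intro l k x hx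
    simp only [toTerm, Term.bv, Finset.mem_insert, Finset.mem_union] at hx
    rcases hx with rfl | hx | hx
    · exact le_rfl
    · exact (Nat.le_succ _).trans (ihA _ _ x hx)
    · exact (Nat.le_succ _).trans (ihB _ _ x hx)
  | lam f A B ihA ihB =>
    intro l k x hx
    simp only [toTerm, Term.bv, Finset.mem_insert, Finset.mem_union] at hx
    rcases hx with rfl | hx | hx
    · exact le_rfl
    · exact (Nat.le_succ _).trans (ihA _ _ x hx)
    · exact (Nat.le_succ _).trans (ihB _ _ x hx)
  | app A B ihA ihB =>
    intro l k x hx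
    simp only [toTerm, Term.bv, Finset.mem_union] at hx
    exact hx.elim (ihA _ _ x) (ihB _ _ x)

theorem noShadow_toTerm (t : Src) : ∀ (l : List Name) (k : ℕ), (t.toTerm l k).NoShadow := by
  have fresh (t : Src) (l : List Name) (k : ℕ) : k ∉ Term.bv (t.toTerm l (k + 1)) :=
    fun h => Nat.not_succ_le_self k (bv_toTerm t _ _ _ h)
  induction t with
  | bvar | sort => simp [toTerm, Term.NoShadow]
  | pi f g A B ihA ihB => exact fun l k => ⟨fresh _ _ _, fresh _ _ _, ihA _ _, ihB _ _⟩
  | lam f A B ihA ihB => exact fun l k => ⟨fresh _ _ _, fresh _ _ _, ihA _ _, ihB _ _⟩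
  | app A B ihA ihB => exact fun l k => ⟨ihA _ _, ihB _ _⟩

theorem toSrc_toTerm (t : Src) : ∀ {l : List Name} {k : ℕ}, l.Nodup → (∀ x ∈ l, x < k) →
    t.Scoped l.length → (t.toTerm l k).toSrc l = t := by
  have lt {l : List Name} {k : ℕ} (h : ∀ x ∈ l, x < k) : ∀ x ∈ l, x < k + 1 :=
    fun x hx => (h x hx).trans (Nat.lt_succ_self k)
  have cons {l : List Name} {k : ℕ} (hl : l.Nodup) (h : ∀ x ∈ l, x < k) :
      (k :: l).Nodup ∧ ∀ x ∈ k :: l, x < k + 1 := by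
    refine ⟨List.nodup_cons.2 ⟨fun hk => (h k hk).false, hl⟩, fun x hx => ?_⟩
    rcases List.mem_cons.1 hx with rfl | hx
    · exact Nat.lt_succ_self _
    · exact lt h x hx
  induction t with
  | bvar n =>
    intro l k hl h hs
    have hs : n < l.length := hs
    simp only [toTerm, Term.toSrc, List.getD_eq_getElem _ _ hs, hl.idxOf_getElem]
  | sort => intros; rfl
  | pi f g A B ihA ihB =>
    intro l k hl h hs
    simp only [toTerm, Term.toSrc, ihA hl (lt h) hs.1, ihB (cons hl h).1 (cons hl h).2 hs.2]
  | lam f A B ihA ihB =>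
    intro l k hl h hs
    simp only [toTerm, Term.toSrc, ihA hl (lt h) hs.1, ihB (cons hl h).1 (cons hl h).2 hs.2]
  | app A B ihA ihB =>
    intro l k hl h hs
    simp only [toTerm, Term.toSrc, ihA hl h hs.1, ihB hl h hs.2]

/-- Bound variables start at `k`, above everything in `l`, and are positive, whereas the reserved
variable is `0`. -/
theorem bc_toTerm {t : Src} {l : List Name} {k : ℕ} (hl : l.Nodup) (h : ∀ x ∈ l, x < k)
    (hc : c ∉ l) (hk : 0 < k) (ht : t.Scoped l.length) : BC l (t.toTerm l k) := by
  have hfv : ∀ x ∈ Term.fv (t.toTerm l k), x ∈ l := by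
    rw [← Term.scoped_toSrc, toSrc_toTerm t hl h ht]
    exact ht
  refine ⟨fun x hx hxl => (bv_toTerm t _ _ _ hx).not_gt (h x hxl), noShadow_toTerm t _ _, hfv, ?_⟩
  simp only [Term.vars, Finset.mem_union, not_or]
  exact ⟨fun h => hc (hfv _ h), fun h => (bv_toTerm t _ _ _ h).not_gt hk⟩

end Src

end WeakIsoRel

namespace WeakIsoRel

open Term

/-! ## Capture-safe terms and `β`-equivalence -/

theorem SafeSubst.toSrc {l : List Name} {b t r : Term} {x : Name} (h : SafeSubst l b x t r) :
    r.toSrc l = (b.toSrc (x :: l)).inst (t.toSrc l) := by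
  obtain ⟨b', hb, hd, hbc, rfl⟩ := h
  rw [hb.toSrc]
  refine toSrc_unsafeSubst b' (fun y _ hy => ?_) ?_ (fun hx => hbc.1 x hx (by simp))
    fun y hy hyt => Finset.disjoint_left.1 hd hy (Finset.mem_union_left _ hyt)
  · rw [List.idxOf_cons_ne _ (Ne.symm hy)]; rfl
  · rw [List.idxOf_cons_self]; rfl

theorem Term.bv_unsafeSubst {x : Name} {t : Term} (b : Term) :
    ∀ y ∈ bv (unsafeSubst x t b), y ∈ bv b ∨ y ∈ bv t := by
  induction b with
  | var y =>
    intro z hz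
    by_cases hy : y = x
    · exact .inr (by simpa [unsafeSubst, hy] using hz)
    · simp [unsafeSubst, hy, bv] at hz
  | sort => simp [unsafeSubst, bv]
  | pi f g y A B ihA ihB =>
    intro z hz
    simp only [unsafeSubst, bv, Finset.mem_insert, Finset.mem_union] at hz ⊢
    split at hz <;> grind
  | lam f y A B ihA ihB =>
    intro z hz
    simp only [unsafeSubst, bv, Finset.mem_insert, Finset.mem_union] at hz ⊢
    split at hz <;> grind
  | app M N ihA ihB =>
    intro z hz
    simp only [unsafeSubst, bv, Finset.mem_union] at hz ⊢
    grind

theorem Term.NoShadow.unsafeSubst {x : Name} {t b : Term} (hb : NoShadow b) (ht : NoShadow t)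
    (hd : ∀ y ∈ bv b, y ∉ bv t) : NoShadow (unsafeSubst x t b) := by
  have bind (y : Name) (A : Term) (hA : y ∉ bv A) (hy : y ∉ bv t) :
      y ∉ bv (Term.unsafeSubst x t A) := fun h => (bv_unsafeSubst A y h).elim hA hy
  induction b with
  | var y =>
    by_cases hy : y = x
    · simpa [Term.unsafeSubst, hy] using ht
    · simp [Term.unsafeSubst, hy, NoShadow]
  | sort => trivial
  | pi f g y A B ihA ihB =>
    obtain ⟨hyA, hyB, hA, hB⟩ := hb
    simp only [bv, Finset.mem_insert, Finset.mem_union] at hd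
    have hyt := hd y (.inl rfl)
    refine ⟨bind y A hyA hyt, ?_, ihA hA fun z hz => hd z (.inr (.inl hz)), ?_⟩
    · split
      · exact hyB
      · exact bind y B hyB hyt
    · split
      · exact hB
      · exact ihB hB fun z hz => hd z (.inr (.inr hz))
  | lam f y A B ihA ihB =>
    obtain ⟨hyA, hyB, hA, hB⟩ := hb
    simp only [bv, Finset.mem_insert, Finset.mem_union] at hd
    have hyt := hd y (.inl rfl)
    refine ⟨bind y A hyA hyt, ?_, ihA hA fun z hz => hd z (.inr (.inl hz)), ?_⟩
    · split
      · exact hyB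
      · exact bind y B hyB hyt
    · split
      · exact hB
      · exact ihB hB fun z hz => hd z (.inr (.inr hz))
  | app M N ihA ihB =>
    simp only [bv, Finset.mem_union] at hd
    exact ⟨ihA hb.1 fun z hz => hd z (.inl hz), ihB hb.2 fun z hz => hd z (.inr hz)⟩

/-- Finitely many variables have an upper bound. -/
theorem exists_bound (l : List Name) (s : Finset Name) :
    ∃ k : ℕ, 0 < k ∧ (∀ x ∈ l, x < k) ∧ ∀ x ∈ s, x < k := by
  refine ⟨(l.toFinset ∪ s).sup id + 1, Nat.succ_pos _, fun x hx => ?_, fun x hx => ?_⟩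
  · exact Nat.lt_succ_of_le (Finset.le_sup (f := id) (by simp [hx]))
  · exact Nat.lt_succ_of_le (Finset.le_sup (f := id) (by simp [hx]))

/-- Contexts of variables that are distinct and not reserved. -/
structure GoodNames (l : List Name) : Prop where
  nodup : l.Nodup
  not_mem : c ∉ l

theorem GoodNames.cons {l : List Name} (h : GoodNames l) {x : Name} (hx : x ∉ l) (hc : x ≠ c) :
    GoodNames (x :: l) :=
  ⟨List.nodup_cons.2 ⟨hx, h.nodup⟩, by simp [h.not_mem, hc.symm]⟩

namespace BC

theorem toSrc_scoped {l : List Name} {t : Term} (h : BC l t) : (t.toSrc l).Scoped l.length :=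
  (scoped_toSrc t l).2 h.2.2.1

theorem mk' {l : List Name} {t : Term} (hl : c ∉ l) (h1 : ∀ x ∈ bv t, x ∉ l) (h2 : NoShadow t)
    (h3 : (t.toSrc l).Scoped l.length) (h4 : c ∉ bv t) : BC l t := by
  refine ⟨h1, h2, (scoped_toSrc t l).1 h3, ?_⟩
  simp only [vars, Finset.mem_union, not_or]
  exact ⟨fun h => hl ((scoped_toSrc t l).1 h3 _ h), h4⟩

theorem not_mem_bv {l : List Name} {t : Term} (h : BC l t) : c ∉ bv t :=
  fun hc => h.2.2.2 (Finset.mem_union_right _ hc)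

theorem app_iff {l : List Name} {M N : Term} : BC l (app M N) ↔ BC l M ∧ BC l N := by
  simp only [BC, bv, fv, vars, NoShadow, Finset.mem_union]
  grind

theorem pi_iff {l : List Name} {f g x A B} : BC l (pi f g x A B) ↔
    x ∉ l ∧ x ≠ c ∧ x ∉ bv A ∧ BC l A ∧ BC (x :: l) B := by
  simp only [BC, bv, fv, vars, NoShadow, Finset.mem_union, Finset.mem_insert, Finset.mem_erase,
    List.mem_cons]
  grind

theorem lam_iff {l : List Name} {f x A B} : BC l (lam f x A B) ↔
    x ∉ l ∧ x ≠ c ∧ x ∉ bv A ∧ BC l A ∧ BC (x :: l) B := by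
  simp only [BC, bv, fv, vars, NoShadow, Finset.mem_union, Finset.mem_insert, Finset.mem_erase,
    List.mem_cons]
  grind

end BC

/-- A safe renaming of `b` is found by passing to indices and back, with bound variables beyond all
those in sight. The set `s` lists variables that must not become bound anew; it is used to keep
binders distinct from the bound variables of their domains. -/
theorem SafeSubst.exists {l : List Name} (hl : GoodNames l) {x : Name} (hx : x ∉ l) (hc : x ≠ c)
    {b t : Term} (hb : (b.toSrc (x :: l)).Scoped (l.length + 1)) (ht : BC l t) (s : Finset Name) :
    ∃ r, SafeSubst l b x t r ∧ BC l r ∧ ∀ y ∈ s, y ∈ bv r → y ∈ bv t := by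
  obtain ⟨k, hk, h1, h2⟩ := exists_bound (x :: l) (vars t ∪ s)
  have hl' := hl.cons hx hc
  have hbc := Src.bc_toTerm hl'.nodup h1 hl'.not_mem hk hb
  have hd : ∀ y ∈ bv ((b.toSrc (x :: l)).toTerm (x :: l) k), y ∉ vars t :=
    fun y hy hyt => (Src.bv_toTerm _ _ _ _ hy).not_gt (h2 y (Finset.mem_union_left _ hyt))
  have hs : SafeSubst l b x t (unsafeSubst x t ((b.toSrc (x :: l)).toTerm (x :: l) k)) :=
    ⟨_, Alpha.of_toSrc (l := x :: l) hb (Src.toSrc_toTerm _ hl'.nodup h1 hb).symm,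
      Finset.disjoint_left.2 hd, hbc, rfl⟩
  refine ⟨_, hs, .mk' hl.not_mem (fun y hy => ?_) ?_ ?_ fun hc => ?_, fun y hys hy => ?_⟩
  · rcases bv_unsafeSubst _ y hy with hy | hy
    · exact fun hyl => hbc.1 y hy (List.mem_cons_of_mem _ hyl)
    · exact ht.1 y hy
  · exact hbc.2.1.unsafeSubst ht.2.1 fun y hy hyt => hd y hy (Finset.mem_union_right _ hyt)
  · rw [hs.toSrc]
    exact hb.inst ht.toSrc_scoped
  · exact (bv_unsafeSubst _ _ hc).elim hbc.not_mem_bv ht.not_mem_bv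
  · exact (bv_unsafeSubst _ _ hy).resolve_left fun hy =>
      (Src.bv_toTerm _ _ _ _ hy).not_gt (h2 y (Finset.mem_union_right _ hys))

theorem Step.toSrc {l : List Name} {t u : Term} (h : Step l t u) :
    Src.Red (t.toSrc l) (u.toSrc l) := by
  induction h with
  | beta h => rw [h.toSrc]; exact .beta
  | piDom _ ih => exact .piDom ih
  | piCod _ ih => exact .piCod ih
  | lamDom _ ih => exact .lamDom ih
  | lamBody _ ih => exact .lamBody ih
  | appFun _ ih => exact .appFun ih
  | appArg _ ih => exact .appArg ih

theorem BetaEq.toSrc {l : List Name} {t u : Term} (h : BetaEq l t u) :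
    Src.Conv (t.toSrc l) (u.toSrc l) := by
  induction h with
  | refl => exact .refl _
  | step _ _ h => exact .red h.toSrc
  | symm _ ih => exact ih.symm
  | trans _ _ ih ih' => exact ih.trans ih'

/-- Reduction on indices lifts to safe named terms. A contraction may rename bound variables, and
inside the domain of a binder this could make its variable bound again; the control over `s`
prevents it. -/
theorem Src.Red.step {t' u' : Src} (h : Red t' u') : ∀ {l : List Name} {t : Term}, GoodNames l →
    BC l t → t.toSrc l = t' → ∀ s : Finset Name,
    ∃ u, Step l t u ∧ BC l u ∧ u.toSrc l = u' ∧ ∀ y ∈ s, y ∈ bv u → y ∈ bv t := by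
  induction h with
  | beta =>
    rintro l (_ | _ | _ | _ | ⟨_ | _ | _ | ⟨f, x, A, b⟩ | _, a⟩) hl ht h s <;>
      simp only [toSrc, reduceCtorEq, Src.app.injEq, false_and] at h
    obtain ⟨h, rfl⟩ := h
    obtain ⟨rfl, rfl, rfl⟩ := Src.lam.inj h
    rw [BC.app_iff, BC.lam_iff] at ht
    obtain ⟨⟨hx, hc, -, -, hb⟩, ha⟩ := ht
    obtain ⟨r, hr, hr', hs⟩ := SafeSubst.exists hl hx hc hb.toSrc_scoped ha s
    exact ⟨r, .beta hr, hr', hr.toSrc, fun y hy hyr => Finset.mem_union_right _ (hs y hy hyr)⟩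
  | piDom _ ih =>
    rintro l (_ | _ | ⟨f, g, x, A, B⟩ | _ | _) hl ht h s <;> simp only [toSrc, reduceCtorEq] at h
    obtain ⟨rfl, rfl, rfl, rfl⟩ := Src.pi.inj h
    rw [BC.pi_iff] at ht
    obtain ⟨hx, hc, hxA, hA, hB⟩ := ht
    -- The variable of the binder must stay unbound in the reduced domain.
    obtain ⟨u, hu, hu', rfl, hs⟩ := ih hl hA rfl (insert x s)
    refine ⟨_, .piDom hu, BC.pi_iff.2 ⟨hx, hc, fun h => hxA (hs x (by simp) h), hu', hB⟩, rfl,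
      fun y hy h => ?_⟩
    have := hs y (by simp [hy])
    simp only [bv, Finset.mem_insert, Finset.mem_union] at h ⊢
    grind
  | piCod _ ih =>
    rintro l (_ | _ | ⟨f, g, x, A, B⟩ | _ | _) hl ht h s <;> simp only [toSrc, reduceCtorEq] at h
    obtain ⟨rfl, rfl, rfl, rfl⟩ := Src.pi.inj h
    rw [BC.pi_iff] at ht
    obtain ⟨hx, hc, hxA, hA, hB⟩ := ht
    obtain ⟨u, hu, hu', rfl, hs⟩ := ih (hl.cons hx hc) hB rfl s
    refine ⟨_, .piCod hu, BC.pi_iff.2 ⟨hx, hc, hxA, hA, hu'⟩, rfl, fun y hy h => ?_⟩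
    have := hs y hy
    simp only [bv, Finset.mem_insert, Finset.mem_union] at h ⊢
    grind
  | lamDom _ ih =>
    rintro l (_ | _ | _ | ⟨f, x, A, B⟩ | _) hl ht h s <;> simp only [toSrc, reduceCtorEq] at h
    obtain ⟨rfl, rfl, rfl⟩ := Src.lam.inj h
    rw [BC.lam_iff] at ht
    obtain ⟨hx, hc, hxA, hA, hB⟩ := ht
    obtain ⟨u, hu, hu', rfl, hs⟩ := ih hl hA rfl (insert x s)
    refine ⟨_, .lamDom hu, BC.lam_iff.2 ⟨hx, hc, fun h => hxA (hs x (by simp) h), hu', hB⟩, rfl,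
      fun y hy h => ?_⟩
    have := hs y (by simp [hy])
    simp only [bv, Finset.mem_insert, Finset.mem_union] at h ⊢
    grind
  | lamBody _ ih =>
    rintro l (_ | _ | _ | ⟨f, x, A, B⟩ | _) hl ht h s <;> simp only [toSrc, reduceCtorEq] at h
    obtain ⟨rfl, rfl, rfl⟩ := Src.lam.inj h
    rw [BC.lam_iff] at ht
    obtain ⟨hx, hc, hxA, hA, hB⟩ := ht
    obtain ⟨u, hu, hu', rfl, hs⟩ := ih (hl.cons hx hc) hB rfl s
    refine ⟨_, .lamBody hu, BC.lam_iff.2 ⟨hx, hc, hxA, hA, hu'⟩, rfl, fun y hy h => ?_⟩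
    have := hs y hy
    simp only [bv, Finset.mem_insert, Finset.mem_union] at h ⊢
    grind
  | appFun _ ih =>
    rintro l (_ | _ | _ | _ | ⟨M, N⟩) hl ht h s <;> simp only [toSrc, reduceCtorEq] at h
    obtain ⟨rfl, rfl⟩ := Src.app.inj h
    rw [BC.app_iff] at ht
    obtain ⟨u, hu, hu', rfl, hs⟩ := ih hl ht.1 rfl s
    refine ⟨_, .appFun hu, BC.app_iff.2 ⟨hu', ht.2⟩, rfl, fun y hy h => ?_⟩
    have := hs y hy
    simp only [bv, Finset.mem_union] at h ⊢
    grind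
  | appArg _ ih =>
    rintro l (_ | _ | _ | _ | ⟨M, N⟩) hl ht h s <;> simp only [toSrc, reduceCtorEq] at h
    obtain ⟨rfl, rfl⟩ := Src.app.inj h
    rw [BC.app_iff] at ht
    obtain ⟨u, hu, hu', rfl, hs⟩ := ih hl ht.2 rfl s
    refine ⟨_, .appArg hu, BC.app_iff.2 ⟨ht.1, hu'⟩, rfl, fun y hy h => ?_⟩
    have := hs y hy
    simp only [bv, Finset.mem_union] at h ⊢
    grind

theorem Term.unsafeSubst_of_not_mem {x : Name} {u t : Term} (h : x ∉ fv t) (h' : x ∉ bv t) :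
    unsafeSubst x u t = t := by
  induction t with
  | var y => simp only [fv, Finset.mem_singleton] at h; simp [unsafeSubst, Ne.symm h]
  | sort => rfl
  | pi f g y A B ihA ihB | lam f y A B ihA ihB =>
    simp only [fv, bv, Finset.mem_union, Finset.mem_insert, Finset.mem_erase] at h h'
    rw [unsafeSubst, if_neg (by grind), ihA (by grind) (by grind), ihB (by grind) (by grind)]
  | app M N ihA ihB =>
    simp only [fv, bv, Finset.mem_union] at h h'
    rw [unsafeSubst, ihA (by grind) (by grind), ihB (by grind) (by grind)]

/-- Terms that are equal up to renaming of bound variables have a common expansion. -/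
theorem BetaEq.of_alpha {l : List Name} {t u : Term} (ht : BC l t)
    (hu : BC l u) (h : t.toSrc l = u.toSrc l) : BetaEq l t u := by
  obtain ⟨x, h0, h1, h2⟩ := exists_bound l (vars t ∪ vars u)
  have hx : x ∉ l := fun h => (h1 x h).false
  have hc : x ≠ c := h0.ne'
  have hxt : x ∉ vars t := fun h => (h2 x (Finset.mem_union_left _ h)).false
  have hxu : x ∉ vars u := fun h => (h2 x (Finset.mem_union_right _ h)).false
  have weak {v : Term} (hv : BC l v) (hx : x ∉ vars v) : BC (x :: l) v := by
    refine ⟨fun y hy => ?_, hv.2.1, fun y hy => List.mem_cons_of_mem _ (hv.2.2.1 y hy), hv.2.2.2⟩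
    rw [List.mem_cons, not_or]
    exact ⟨fun h => hx (Finset.mem_union_right _ (h ▸ hy)), hv.1 y hy⟩
  -- The expansion is `(λ x : Prop, t) Prop` with `x` not occurring. Safe substitution may first
  -- rename the body, so this redex contracts to any safe variant of `t`.
  have hE : BC l (.app (.lam .P x (.sort .prop) t) (.sort .prop)) := by
    have hs : BC l (.sort .prop) := by simp [BC, bv, fv, vars, NoShadow]
    rw [BC.app_iff, BC.lam_iff]
    exact ⟨⟨hx, hc, by simp [bv], hs, weak ht hxt⟩, hs⟩
  have step {v : Term} (hv : BC l v) (hx : x ∉ vars v) (h : t.toSrc l = v.toSrc l) :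
      BetaEq l (.app (.lam .P x (.sort .prop) t) (.sort .prop)) v := by
    refine .step hE hv (.beta ⟨v, .of_toSrc ht.toSrc_scoped h, ?_, weak hv hx, ?_⟩)
    · simp [vars, fv, bv]
    · rw [unsafeSubst_of_not_mem] <;> simp_all [vars]
  exact (step ht hxt rfl).symm.trans (step hu hxu h)

theorem BetaEq.of_reds {l : List Name} {t : Term} {t' u' : Src} (hl : GoodNames l) (ht : BC l t)
    (h : t.toSrc l = t') (hr : Relation.ReflTransGen Src.Red t' u') :
    ∃ u, BetaEq l t u ∧ BC l u ∧ u.toSrc l = u' := by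
  induction hr with
  | refl => exact ⟨t, .refl ht, ht, h⟩
  | tail _ hr ih =>
    obtain ⟨u, h1, h2, h3⟩ := ih
    obtain ⟨v, h4, h5, h6, -⟩ := hr.step hl h2 h3 ∅
    exact ⟨v, h1.trans (.step h2 h5 h4), h5, h6⟩

/-- By confluence both terms reduce to one indexed term; the lifted reductions end in two named
variants of it, which are equivalent through a common expansion. -/
theorem BetaEq.of_conv {l : List Name} {t u : Term} (hl : GoodNames l) (ht : BC l t)
    (hu : BC l u) (h : Src.Conv (t.toSrc l) (u.toSrc l)) : BetaEq l t u := by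
  obtain ⟨v', h1, h2⟩ := h.join
  have reds {a b : Src} (h : Relation.ReflTransGen Src.Par a b) :
      Relation.ReflTransGen Src.Red a b := by
    induction h with
    | refl => exact .refl
    | tail _ h ih => exact ih.trans h.reds
  obtain ⟨v, h3, hv, h4⟩ := of_reds hl ht rfl (reds h1)
  obtain ⟨w, h5, hw, h6⟩ := of_reds hl hu rfl (reds h2)
  exact (h3.trans (.of_alpha hv hw (h4.trans h6.symm))).trans h5.symm

end WeakIsoRel

namespace WeakIsoRel

open Term Judg

/-! ## Typing of named terms and of their de Bruijn forms -/

/-- The de Bruijn form of a context. -/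
def Ctx.toSrc : Ctx → List Src
  | [] => []
  | (_, A) :: Γ => A.toSrc (Ctx.names Γ) :: Ctx.toSrc Γ

theorem Ctx.length_toSrc (Γ : Ctx) : (Ctx.toSrc Γ).length = (Ctx.names Γ).length := by
  induction Γ with
  | nil => rfl
  | cons p Γ ih => exact congrArg Nat.succ ih

/-- The indices of a judgement are below `n`. -/
def Judg.Scoped (n : ℕ) : Judg → Prop
  | tm a B => a.Scoped n ∧ B.Scoped n
  | ty B _ => B.Scoped n

theorem SrcTyping.scoped {Γ : List Src} {j} (h : SrcTyping Γ j) : j.Scoped Γ.length := by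
  induction h with
  | sort => exact ⟨trivial, trivial⟩
  | var _ ih => exact ⟨Nat.succ_pos _, ih.1.shift⟩
  | weak _ _ ih => exact ⟨ih.1.shift, ih.2.shift⟩
  | conv _ _ _ ih ih' => exact ⟨ih.1, ih'.1⟩
  | cum _ _ _ ih ih' => exact ⟨ih.1, ih'⟩
  | pi₁ _ _ ih ih' => exact ⟨⟨ih.1, ih'.1⟩, trivial⟩
  | pi₂ _ _ _ ih ih' => exact ⟨⟨ih.1, ih'.1⟩, trivial⟩
  | app _ _ _ _ ih ih' ih'' ih₃ => exact ⟨⟨ih.1, ih'.1⟩, Src.Scoped.inst ih₃ ih'.1⟩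
  | lam _ _ _ ih ih' => exact ⟨⟨ih.1, ih'.1⟩, ⟨ih.1, ih'.2⟩⟩
  | ty _ ih => exact ih.1
  | tyPi _ _ ih ih' => exact ⟨ih.1, ih'⟩

theorem SubTy.toSrc {A B : Term} (h : SubTy A B) : ∀ l, Src.Sub (A.toSrc l) (B.toSrc l) := by
  induction h with
  | type h h' => exact fun _ => .type h h'
  | pi _ ih => exact fun _ => .pi (ih _)

theorem SrcTyping.not_mem_fv {Γ : Ctx} {t : Term} {T : Src} {x : Name}
    (h : SrcTyping Γ.toSrc (tm (t.toSrc Γ.names) T)) (hx : x ∉ Γ.names) : x ∉ fv t := by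
  have := h.scoped.1
  rw [Ctx.length_toSrc, scoped_toSrc] at this
  exact fun h => hx (this x h)

/-- Renaming becomes equality. The additional premises of the indexed rules are recovered because
types of typable terms are types with a flag. -/
theorem Typing.toSrc {Γ : Ctx} {a B : Term} (h : Typing Γ a B) :
    SrcTyping Γ.toSrc (tm (a.toSrc Γ.names) (B.toSrc Γ.names)) := by
  induction h with
  | ax₁ => exact .sort
  | ax₂ => exact .sort
  | @var Γ x A s hx _ ih =>
    have hA : x ∉ fv A := fun h => hx ((scoped_toSrc A _).1 (Ctx.length_toSrc Γ ▸ ih.scoped.1) x h)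
    simp only [Ctx.toSrc, Ctx.names, List.map_cons, Term.toSrc, List.idxOf_cons_self]
    rw [toSrc_cons hA]
    exact .var ih
  | @weak Γ x A s B C hx _ _ ih ih' =>
    have hB : x ∉ fv B := fun h => hx ((scoped_toSrc B _).1 (Ctx.length_toSrc Γ ▸ ih.scoped.1) x h)
    have hC : x ∉ fv C := fun h => hx ((scoped_toSrc C _).1 (Ctx.length_toSrc Γ ▸ ih.scoped.2) x h)
    simp only [Ctx.toSrc, Ctx.names, List.map_cons]
    rw [toSrc_cons hB, toSrc_cons hC]
    exact .weak ih ih'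
  | conv _ _ h ih ih' => exact .conv ih ih' h.toSrc.symm
  | cum _ h ih =>
    obtain ⟨u, hu⟩ := ih.type rfl
    exact .cum ih (h.toSrc _) (hu.ty_sub (h.toSrc _))
  | pi₁ _ _ ih ih' => exact .pi₁ ih ih'
  | pi₂ hs _ _ ih ih' => exact .pi₂ hs ih ih'
  | app _ _ h ih ih' =>
    rw [h.toSrc]
    obtain ⟨u, hu⟩ := ih.type rfl
    obtain ⟨s, rfl, hA, hB⟩ := hu.ty_pi_inv
    exact .app ih ih' hA hB
  | abs _ _ _ ih ih' ih'' => exact .lam ih' ih (.ty ih'')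
  | absPi _ _ ih ih' =>
    obtain ⟨u, hu⟩ := ih.type rfl
    -- The flag that rule `absPi` reads off the codomain is the one it has as a type, so the two
    -- rules for abstraction become one.
    obtain rfl := hu.ty_pi_flag
    exact .lam ih' ih hu
  | alpha _ hA hB ih => rwa [← hA.toSrc, ← hB.toSrc]

theorem Typing.nodup {Γ : Ctx} {a B : Term} (h : Typing Γ a B) : Γ.names.Nodup := by
  induction h with
  | ax₁ | ax₂ => exact List.nodup_nil
  | var hx _ ih => exact List.nodup_cons.2 ⟨hx, ih⟩
  | weak hx _ _ ih => exact List.nodup_cons.2 ⟨hx, ih⟩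
  | conv _ _ _ ih => exact ih
  | cum _ _ ih => exact ih
  | pi₁ _ _ ih => exact ih
  | pi₂ _ _ _ ih => exact ih
  | app _ _ _ ih => exact ih
  | abs _ _ _ _ ih => exact ih
  | absPi _ _ _ ih => exact ih
  | alpha _ _ _ ih => exact ih

theorem Src.Sub.toTerm {A B : Src} (h : Sub A B) : ∀ l k, SubTy (A.toTerm l k) (B.toTerm l k) := by
  induction h with
  | type h h' => exact fun _ _ => .type h h'
  | pi _ ih => exact fun _ _ => .pi (ih _ _)

/-- All named forms of a judgement are derivable. -/
def Judg.Named (Γ : Ctx) : Judg → Prop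
  | tm a B => ∀ a' B', a'.toSrc Γ.names = a → B'.toSrc Γ.names = B → Typing Γ a' B'
  | ty B u => ∀ B', B'.toSrc Γ.names = B → InUniverse Γ B' u

/-- Well-typed terms are scoped, so equal de Bruijn forms mean equality up to renaming, and rule
`alpha` applies. -/
theorem Typing.named {Γ : Ctx} {a B : Term} (h : Typing Γ a B) :
    (tm (a.toSrc Γ.names) (B.toSrc Γ.names)).Named Γ := by
  intro a' B' ha hB
  have hs := h.toSrc.scoped
  rw [Ctx.length_toSrc] at hs
  exact .alpha h (.of_toSrc hs.1 ha.symm) (.of_toSrc hs.2 hB.symm)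

/-- A bound for fresh variables. -/
theorem GoodNames.bound {l : List Name} (hl : GoodNames l) : ∃ k, 0 < k ∧ (∀ x ∈ l, x < k) ∧
    k ∉ l ∧ GoodNames (k :: l) ∧ ∀ x ∈ k :: l, x < k + 1 := by
  obtain ⟨k, h0, h1, -⟩ := exists_bound l ∅
  have hk : k ∉ l := fun h => (h1 k h).false
  refine ⟨k, h0, h1, hk, hl.cons hk h0.ne', fun x hx => ?_⟩
  rcases List.mem_cons.1 hx with rfl | hx
  · exact Nat.lt_succ_self _
  · exact (h1 x hx).trans (Nat.lt_succ_self _)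

theorem Ctx.toSrc_cons_inv {Γ : Ctx} {A : Src} {Δ : List Src} (h : Γ.toSrc = A :: Δ) :
    ∃ (x : Name) (A' : Term) (Γ' : Ctx), Γ = (x, A') :: Γ' ∧ A'.toSrc Γ'.names = A ∧ Γ'.toSrc = Δ := by
  rcases Γ with _ | ⟨⟨x, A'⟩, Γ⟩
  · cases h
  · obtain ⟨h1, h2⟩ := List.cons.inj h
    exact ⟨x, A', Γ, rfl, h1, h2⟩

theorem GoodNames.tail {x : Name} {l : List Name} (h : GoodNames (x :: l)) :
    x ∉ l ∧ GoodNames l :=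
  ⟨(List.nodup_cons.1 h.nodup).1, (List.nodup_cons.1 h.nodup).2,
    fun hc => h.not_mem (List.mem_cons_of_mem _ hc)⟩

/-- Completeness of the named rules. It is needed because `InUniverse` refers to named derivations,
while the flag of a type is found on the indexed side. Canonical names are chosen for the terms
occurring in premises, and `Typing.named` then gives all other choices. -/
theorem SrcTyping.named {Γ' : List Src} {j} (h : SrcTyping Γ' j) :
    ∀ {Γ : Ctx}, GoodNames Γ.names → Γ.toSrc = Γ' → j.Named Γ := by
  induction h with
  | @sort s =>
    rintro (_ | _) hl hΓ
    · rcases s with _ | i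
      · exact Typing.ax₁.named
      · exact Typing.ax₂.named
    · cases hΓ
  | var hA ih =>
    intro Γ hl hΓ
    obtain ⟨x, A, Γ, rfl, rfl, rfl⟩ := Ctx.toSrc_cons_inv hΓ
    obtain ⟨hx, hl'⟩ : x ∉ Γ.names ∧ GoodNames Γ.names := GoodNames.tail hl
    have h := Typing.var hx (ih hl' rfl A (.sort _) rfl rfl)
    have := h.named
    have hA : x ∉ fv A := hA.not_mem_fv hx
    simp only [Ctx.names, List.map_cons, Term.toSrc, List.idxOf_cons_self] at this
    rwa [toSrc_cons hA] at this
  | @weak _ a B _ _ hB hA ih ih' =>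
    intro Γ hl hΓ
    obtain ⟨x, A, Γ, rfl, rfl, rfl⟩ := Ctx.toSrc_cons_inv hΓ
    obtain ⟨hx, hl'⟩ : x ∉ Γ.names ∧ GoodNames Γ.names := GoodNames.tail hl
    obtain ⟨k, h0, h1, -⟩ := hl'.bound
    have hs := hB.scoped
    rw [Ctx.length_toSrc] at hs
    have ha' := Src.toSrc_toTerm a hl'.nodup h1 hs.1
    have hB' := Src.toSrc_toTerm B hl'.nodup h1 hs.2
    have h := Typing.weak hx (ih hl' rfl _ _ ha' hB') (ih' hl' rfl A (.sort _) rfl rfl)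
    have := h.named
    change (tm (Term.toSrc (x :: Γ.names) _) (Term.toSrc (x :: Γ.names) _)).Named _ at this
    have ha : x ∉ fv (a.toTerm Γ.names k) :=
      fun h => hx ((scoped_toSrc _ _).1 (by rw [ha']; exact hs.1) x h)
    have hb : x ∉ fv (B.toTerm Γ.names k) :=
      fun h => hx ((scoped_toSrc _ _).1 (by rw [hB']; exact hs.2) x h)
    rw [toSrc_cons ha, toSrc_cons hb] at this
    rwa [ha', hB'] at this
  | @conv _ a A B s ha hB h ih ih' =>
    rintro Γ hl rfl a' B' rfl rfl
    obtain ⟨k, h0, h1, -⟩ := hl.bound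
    have hs := ha.scoped.2
    have hs' := hB.scoped.1
    rw [Ctx.length_toSrc] at hs hs'
    have hA' := Src.toSrc_toTerm A hl.nodup h1 hs
    have hB' := Src.toSrc_toTerm _ hl.nodup h1 hs'
    -- Named conversion is defined on safe terms only, so both types are taken in canonical form.
    refine (Typing.conv (ih hl rfl a' _ rfl hA') (ih' hl rfl _ (.sort _) hB' rfl)
      (.of_conv hl (Src.bc_toTerm hl.nodup h1 hl.not_mem h0 hs')
        (Src.bc_toTerm hl.nodup h1 hl.not_mem h0 hs) ?_)).named _ _ rfl hB'.symm
    rw [hA', hB']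
    exact h.symm
  | @cum _ a A B u ha h hB ih ih' =>
    rintro Γ hl rfl a' B' rfl rfl
    obtain ⟨k, h0, h1, -⟩ := hl.bound
    have hs := ha.scoped.2
    have hs' : Src.Scoped _ _ := hB.scoped
    rw [Ctx.length_toSrc] at hs hs'
    have hA' := Src.toSrc_toTerm A hl.nodup h1 hs
    have hB' := Src.toSrc_toTerm _ hl.nodup h1 hs'
    exact (Typing.cum (ih hl rfl a' _ rfl hA') (h.toTerm _ _)).named _ _ rfl hB'.symm
  | @pi₁ _ A B i hA hB ih ih' =>
    rintro Γ hl rfl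
    obtain ⟨k, h0, h1, hk, hl', h1'⟩ := hl.bound
    have hs := hA.scoped.1
    have hs' := hB.scoped.1
    rw [Ctx.length_toSrc] at hs
    rw [List.length_cons, Ctx.length_toSrc] at hs'
    have hA' := Src.toSrc_toTerm A hl.nodup h1 hs
    have hB' := Src.toSrc_toTerm B hl'.nodup h1' hs'
    have := (Typing.pi₁ (ih hl rfl _ (.sort _) hA' rfl) (ih' (Γ := (k, _) :: Γ) hl'
      (congrArg (· :: Γ.toSrc) hA') _ (.sort _) hB' rfl)).named
    simp only [Term.toSrc, hA', hB'] at this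
    exact this
  | @pi₂ _ A B s hs₀ hA hB ih ih' =>
    rintro Γ hl rfl
    obtain ⟨k, h0, h1, hk, hl', h1'⟩ := hl.bound
    have hs := hA.scoped.1
    have hs' := hB.scoped.1
    rw [Ctx.length_toSrc] at hs
    rw [List.length_cons, Ctx.length_toSrc] at hs'
    have hA' := Src.toSrc_toTerm A hl.nodup h1 hs
    have hB' := Src.toSrc_toTerm B hl'.nodup h1' hs'
    have := (Typing.pi₂ hs₀ (ih hl rfl _ (.sort _) hA' rfl) (ih' (Γ := (k, _) :: Γ) hl'
      (congrArg (· :: Γ.toSrc) hA') _ (.sort _) hB' rfl)).named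
    simp only [Term.toSrc, hA', hB'] at this
    exact this
  | @app _ M N A B s g hM hN hA hB ihM ihN ihA ihB =>
    rintro Γ hl rfl
    obtain ⟨k, h0, h1, hk, hl', h1'⟩ := hl.bound
    have hsM := hM.scoped.1
    have hsN := hN.scoped.1
    have hs := hA.scoped.1
    have hs' : Src.Scoped _ _ := hB.scoped
    rw [Ctx.length_toSrc] at hs hsM hsN
    rw [List.length_cons, Ctx.length_toSrc] at hs'
    have hA' := Src.toSrc_toTerm A hl.nodup h1 hs
    have hM' := Src.toSrc_toTerm M hl.nodup h1 hsM
    have hN' := Src.toSrc_toTerm N hl.nodup h1 hsN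
    have hB' := Src.toSrc_toTerm B hl'.nodup h1' hs'
    obtain ⟨R, hR, -⟩ := SafeSubst.exists hl hk h0.ne'
      (b := B.toTerm (k :: Γ.names) (k + 1)) (t := N.toTerm Γ.names k) (by rwa [hB'])
      (Src.bc_toTerm hl.nodup h1 hl.not_mem h0 hsN) ∅
    have := (Typing.app (ihM hl rfl _ (.pi s.flag g k (A.toTerm Γ.names k)
      (B.toTerm (k :: Γ.names) (k + 1))) hM' (by simp only [Term.toSrc, hA', hB']))
      (ihN hl rfl _ _ hN' hA') hR).named
    rw [hR.toSrc] at this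
    simp only [Term.toSrc, hM', hN', hB'] at this
    exact this
  | @lam _ A b B s g hA hb hB ihA ihb ihB =>
    rintro Γ hl rfl
    obtain ⟨k, h0, h1, hk, hl', h1'⟩ := hl.bound
    have hs := hA.scoped.1
    have hsb := hb.scoped.1
    have hs' : Src.Scoped _ _ := hB.scoped
    rw [Ctx.length_toSrc] at hs
    rw [List.length_cons, Ctx.length_toSrc] at hs' hsb
    have hA' := Src.toSrc_toTerm A hl.nodup h1 hs
    have hb' := Src.toSrc_toTerm b hl'.nodup h1' hsb
    have hB' := Src.toSrc_toTerm B hl'.nodup h1' hs'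
    have tA := ihA hl rfl _ (.sort _) hA' rfl
    have tb := ihb (Γ := (k, A.toTerm Γ.names k) :: Γ) hl' (congrArg (· :: Γ.toSrc) hA') _ _
      hb' hB'
    have : Typing Γ (.lam s.flag k (A.toTerm Γ.names k) (b.toTerm (k :: Γ.names) (k + 1)))
        (.pi s.flag g k (A.toTerm Γ.names k) (B.toTerm (k :: Γ.names) (k + 1))) := by
      -- The two ways for the codomain to be a type correspond to the two named rules for
      -- abstraction.
      rcases ihB (Γ := (k, A.toTerm Γ.names k) :: Γ) hl' (congrArg (· :: Γ.toSrc) hA') _ hB' with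
        ⟨s', h, rfl⟩ | ⟨f, g', x, D, E, h, rfl⟩
      · exact .abs tb tA h
      · change Typing _ _ (B.toTerm (k :: Γ.names) (k + 1)) at tb
        change B.toTerm (k :: Γ.names) (k + 1) = _ at h
        rw [h] at tb ⊢
        exact .absPi tb tA
    have := this.named
    simp only [Term.toSrc, hA', hb', hB'] at this
    exact this
  | ty hB ih =>
    rintro Γ hl rfl B' hB'
    exact .inl ⟨_, ih hl rfl B' (.sort _) hB' rfl, rfl⟩
  | tyPi =>
    rintro Γ hl rfl (_ | _ | ⟨f, g, x, D, E⟩ | _ | _) hB' <;>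
      simp only [Term.toSrc, reduceCtorEq] at hB'
    obtain ⟨rfl, rfl, -, -⟩ := Src.pi.inj hB'
    exact .inr ⟨_, _, x, D, E, rfl, rfl⟩

end WeakIsoRel

namespace WeakIsoRel

open Judg DB

/-! ## The translation of named terms and its de Bruijn form -/

theorem DB.idxOf_up {α β : Type} [DecidableEq α] [DecidableEq β] {L : List α} {l : List β}
    {v : β → α} (hv : Function.Injective v) {x y : β} {ρ : ℕ → ℕ}
    (h : x ≠ y → L.idxOf (v x) = ρ (l.idxOf x)) :
    (v y :: L).idxOf (v x) = upRen ρ ((y :: l).idxOf x) := by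
  by_cases hx : y = x
  · subst hx; simp
  · rw [List.idxOf_cons_ne _ hx, List.idxOf_cons_ne _ fun h => hx (hv h), h (Ne.symm hx)]; rfl

/-- An injection of variables preserves binding, so only the positions of the free variables matter.
-/
theorem Term.embed_toDB {v : Name → Var} (hv : Function.Injective v) (t : Term) :
    ∀ {L : List Var} {l : List Name} {ρ : ℕ → ℕ},
    (∀ x ∈ fv t, L.idxOf (v x) = ρ (l.idxOf x)) →
    (embed v t).toDB L = (t.toSrc l).emb.rename ρ := by
  induction t with
  | var x => intro L l ρ h; simp [embed, Tgt.toDB, toSrc, Src.emb, DB.rename, h x (by simp [fv])]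
  | sort s => intros; rfl
  | pi f g x A B ihA ihB =>
    intro L l ρ h
    rw [embed, Tgt.toDB, ihA fun y hy => h y (by simp [fv, hy]), ihB (ρ := upRen ρ) (l := x :: l)
      fun y hy => DB.idxOf_up hv fun hxy => h y (by simp [fv, hy, hxy])]
    rfl
  | lam f x A B ihA ihB =>
    intro L l ρ h
    rw [embed, Tgt.toDB, ihA fun y hy => h y (by simp [fv, hy]), ihB (ρ := upRen ρ) (l := x :: l)
      fun y hy => DB.idxOf_up hv fun hxy => h y (by simp [fv, hy, hxy])]
    rfl
  | app M N ihA ihB =>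
    intro L l ρ h
    rw [embed, Tgt.toDB, ihA fun y hy => h y (by simp [fv, hy]),
      ihB fun y hy => h y (by simp [fv, hy])]
    rfl

/-- The binders `L` bind the three variables that come from each variable in `l`. -/
structure TrVars (L : List Var) (l : List Name) (ρ : ℕ → ℕ) : Prop where
  one : ∀ x ∈ l, L.idxOf (.one x) = ρ (3 * l.idxOf x + 2)
  prime : ∀ x ∈ l, L.idxOf (.prime x) = ρ (3 * l.idxOf x + 1)
  rel : ∀ x ∈ l, L.idxOf (.rel x) = ρ (3 * l.idxOf x)

namespace TrVars

variable {L : List Var} {l : List Name} {ρ : ℕ → ℕ}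

/-- Used for binders that do not belong to the translated context: `x₄` and `x₅`, or `x` and `x'`
while the remaining parts of the domain are translated. The renaming `ρ` records the indices they
occupy. -/
theorem skip (h : TrVars L l ρ) {v : Var}
    (hv : ∀ x ∈ l, v ≠ .one x ∧ v ≠ .prime x ∧ v ≠ .rel x) :
    TrVars (v :: L) l (fun n => ρ n + 1) :=
  ⟨fun x hx => by rw [List.idxOf_cons_ne _ (hv x hx).1, h.one x hx],
    fun x hx => by rw [List.idxOf_cons_ne _ (hv x hx).2.1, h.prime x hx],
    fun x hx => by rw [List.idxOf_cons_ne _ (hv x hx).2.2, h.rel x hx]⟩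

theorem bind (h : TrVars L l ρ) (x : Name) :
    TrVars (.rel x :: .prime x :: .one x :: L) (x :: l) (upRen (upRen (upRen ρ))) := by
  have hne {y : Name} (hy : y ∈ x :: l) (hyx : x ≠ y) :
      y ∈ l ∧ (x :: l).idxOf y = l.idxOf y + 1 :=
    ⟨(List.mem_cons.1 hy).resolve_left (Ne.symm hyx), List.idxOf_cons_ne _ hyx⟩
  refine ⟨fun y hy => ?_, fun y hy => ?_, fun y hy => ?_⟩ <;> by_cases hyx : x = y
  · subst hyx; simp
  · rw [(hne hy hyx).2]; simp [hyx, h.one y (hne hy hyx).1, Nat.mul_succ]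
  · subst hyx; simp
  · rw [(hne hy hyx).2]; simp [hyx, h.prime y (hne hy hyx).1, Nat.mul_succ]
  · subst hyx; simp
  · rw [(hne hy hyx).2]; simp [hyx, h.rel y (hne hy hyx).1, Nat.mul_succ]

theorem emb (h : TrVars L l ρ) {t : Term} (ht : BC l t) :
    t.emb.toDB L = (t.toSrc l).e1.rename ρ := by
  rw [Term.emb, Term.embed_toDB (fun _ _ => Var.one.inj) t (l := l) (ρ := fun n => ρ (3 * n + 2))
    fun x hx => h.one x (ht.2.2.1 x hx), Src.e1, rename_rename]

theorem primed (h : TrVars L l ρ) {t : Term} (ht : BC l t) :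
    t.primed.toDB L = (t.toSrc l).e2.rename ρ := by
  rw [Term.primed, Term.embed_toDB (fun _ _ => Var.prime.inj) t (l := l)
    (ρ := fun n => ρ (3 * n + 1)) fun x hx => h.prime x (ht.2.2.1 x hx), Src.e2, rename_rename]

theorem emb_bind (h : TrVars L l ρ) {x : Name} {t : Term} (ht : BC (x :: l) t) :
    t.emb.toDB (.one x :: L) = (t.toSrc (x :: l)).b1.rename (upRen ρ) := by
  rw [Term.emb, Term.embed_toDB (fun _ _ => Var.one.inj) t (l := x :: l)
    (ρ := upRen fun n => ρ (3 * n + 2)) fun y hy => DB.idxOf_up (fun _ _ => Var.one.inj)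
      fun hyx => h.one y ((List.mem_cons.1 (ht.2.2.1 y hy)).resolve_left hyx), Src.b1,
    rename_rename, upRen_comp ρ]

theorem primed_bind (h : TrVars L l ρ) {x : Name} {t : Term} (ht : BC (x :: l) t) :
    t.primed.toDB (.prime x :: L) = (t.toSrc (x :: l)).b2.rename (upRen ρ) := by
  rw [Term.primed, Term.embed_toDB (fun _ _ => Var.prime.inj) t (l := x :: l)
    (ρ := upRen fun n => ρ (3 * n + 1)) fun y hy => DB.idxOf_up (fun _ _ => Var.prime.inj)
      fun hyx => h.prime y ((List.mem_cons.1 (ht.2.2.1 y hy)).resolve_left hyx), Src.b2,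
    rename_rename, upRen_comp ρ]

/-- The translation of `t` is compatible with de Bruijn forms. -/
def _root_.WeakIsoRel.Term.TransEq (l : List Name) (t : Term) : Prop :=
  ∀ (L : List Var) (ρ : ℕ → ℕ), TrVars L l ρ → (trans t).toDB L = (t.toSrc l).tr.rename ρ

theorem projFlag (h : TrVars L l ρ) {t : Term} (ht : BC l t) (ht' : t.TransEq l) (f : Flag) :
    (projFlag f t (trans t)).toDB L =
      (proj f (t.toSrc l).e1 (t.toSrc l).e2 (t.toSrc l).tr).rename ρ := by
  have hc : projRel.toDB L = projRel.toDB [] := Tgt.toDB_closed (Lib.closedIn .projRel) _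
  cases f <;>
    simp [WeakIsoRel.projFlag, Tgt.apps, Tgt.toDB, proj, DB.rename, h.emb ht, h.primed ht,
      ht' L ρ h, hc, projRel_rename]

/-- The bindings of three related variables. -/
theorem triple (h : TrVars L l ρ) {x : Name} (hx : x ∉ l) {A : Term} (hA : BC l A)
    (hA' : A.TransEq l) (f : Flag) :
    A.primed.toDB (.one x :: L) = ((A.toSrc l).e2.rename ρ).shift ∧
    (Tgt.apps (WeakIsoRel.projFlag f A (trans A)) [Var.one x, Var.prime x]).toDB
      (.prime x :: .one x :: L) = relDom f ((A.toSrc l).e1.rename ρ) ((A.toSrc l).e2.rename ρ)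
        ((A.toSrc l).tr.rename ρ) := by
  have h1 : TrVars (.one x :: L) l (fun n => ρ n + 1) := h.skip fun y hy => by
    refine ⟨fun h => ?_, nofun, nofun⟩
    exact hx (Var.one.inj h ▸ hy)
  have h2 : TrVars (.prime x :: .one x :: L) l (fun n => ρ n + 1 + 1) := h1.skip fun y hy => by
    refine ⟨nofun, fun h => ?_, nofun⟩
    exact hx (Var.prime.inj h ▸ hy)
  constructor
  · rw [h1.primed hA, shift_eq, rename_rename]
  · simp only [Tgt.apps, List.foldl, Tgt.toDB, h2.projFlag hA hA' f, relDom, proj_rename,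
      rename_rename]
    congr 2
    · rw [List.idxOf_cons_ne _ (by simp), List.idxOf_cons_self]
    · rw [List.idxOf_cons_self]

theorem lam3 (h : TrVars L l ρ) {x : Name} (hx : x ∉ l) {A : Term} (hA : BC l A)
    (hA' : A.TransEq l) (f : Flag) (b : Tgt) :
    (Tgt.lam (.one x) A.emb <| .lam (.prime x) A.primed <|
      .lam (.rel x) (.apps (WeakIsoRel.projFlag f A (trans A)) [Var.one x, Var.prime x]) b).toDB L =
    lam3 f ((A.toSrc l).e1.rename ρ) ((A.toSrc l).e2.rename ρ) ((A.toSrc l).tr.rename ρ)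
      (b.toDB (.rel x :: .prime x :: .one x :: L)) := by
  obtain ⟨h1, h2⟩ := h.triple hx hA hA' f
  rw [Tgt.toDB, Tgt.toDB, Tgt.toDB, h1, h2, h.emb hA, DB.lam3]

theorem pi3 (h : TrVars L l ρ) {x : Name} (hx : x ∉ l) {A : Term} (hA : BC l A)
    (hA' : A.TransEq l) (f : Flag) (b : Tgt) :
    (Tgt.pi (.one x) A.emb <| .pi (.prime x) A.primed <|
      .pi (.rel x) (.apps (WeakIsoRel.projFlag f A (trans A)) [Var.one x, Var.prime x]) b).toDB L =
    pi3 f ((A.toSrc l).e1.rename ρ) ((A.toSrc l).e2.rename ρ) ((A.toSrc l).tr.rename ρ)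
      (b.toDB (.rel x :: .prime x :: .one x :: L)) := by
  obtain ⟨h1, h2⟩ := h.triple hx hA hA' f
  rw [Tgt.toDB, Tgt.toDB, Tgt.toDB, h1, h2, h.emb hA, DB.pi3]

end TrVars

/-- The named translation puts `A'` and `[[A]]` under the binder of `x`, and the relation also under
that of `x'`. Capture safety says that `x` is not declared outside, so these binders capture
nothing. The five classes of variables are disjoint, which settles `x'`, `x_R`, `x₄`, `x₅`. -/
theorem Term.transEq (t : Term) : ∀ {l : List Name}, BC l t → t.TransEq l := by
  induction t with
  | var x =>
    intro l ht L ρ h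
    simp [trans, Tgt.toDB, toSrc, Src.tr, DB.rename, h.rel x (ht.2.2.1 x (by simp [fv]))]
  | sort s =>
    intro l ht L ρ h
    have hc (a b) : isoRel.toDB (a :: b :: L) = isoRel.toDB [] :=
      Tgt.toDB_closed (Lib.closedIn .isoRel) _
    rcases s with _ | _ | i <;>
      simp [trans, Tgt.toDB, Tgt.apps, Tgt.arr, toSrc, Src.tr, DB.rename, trSort, hc,
        isoRel_rename]
  | app M N ihM ihN =>
    intro l ht L ρ h
    rw [BC.app_iff] at ht
    simp only [trans, Tgt.apps, List.foldl, Tgt.toDB, toSrc, Src.tr, DB.rename, h.emb ht.2,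
      h.primed ht.2, ihM ht.1 L ρ h, ihN ht.2 L ρ h]
  | lam f x A b ihA ihb =>
    intro l ht L ρ h
    rw [BC.lam_iff] at ht
    obtain ⟨hx, -, -, hA, hb⟩ := ht
    rw [trans, h.lam3 hx hA (ihA hA), ihb hb _ _ (h.bind x), toSrc, Src.tr, lam3_rename]
  | pi f g x A B ihA ihB =>
    intro l ht L ρ h
    rw [BC.pi_iff] at ht
    obtain ⟨hx, -, -, hA, hB⟩ := ht
    have hP : piProp.toDB L = piProp.toDB [] := Tgt.toDB_closed piProp_closed _
    have hS : piSet.toDB L = piSet.toDB [] := Tgt.toDB_closed piSet_closed _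
    rw [trans, toSrc, Src.tr, trPi_rename, trPi]
    cases f.prod g
    · simp only [Tgt.apps, List.foldl, Tgt.toDB, hS, h.emb hA, h.primed hA, ihA hA L ρ h,
        h.emb_bind hB, h.primed_bind hB]
      have := h.lam3 hx hA (ihA hA) f (trans B)
      simp only [Tgt.apps, List.foldl, Tgt.toDB, h.emb hA] at this
      rw [this, ihB hB _ _ (h.bind x)]
    · simp only [Tgt.apps, List.foldl, Tgt.toDB, hP, h.emb hA, h.primed hA, ihA hA L ρ h,
        h.emb_bind hB, h.primed_bind hB]
      have := h.lam3 hx hA (ihA hA) f (trans B)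
      simp only [Tgt.apps, List.foldl, Tgt.toDB, h.emb hA] at this
      rw [this, ihB hB _ _ (h.bind x)]
    · have h1 : TrVars (.four x :: L) l (fun n => ρ n + 1) := h.skip fun y hy => by
        refine ⟨nofun, nofun, nofun⟩
      have h2 : TrVars (.five x :: .four x :: L) l (fun n => ρ n + 1 + 1) := h1.skip fun y hy => by
        refine ⟨nofun, nofun, nofun⟩
      rw [Tgt.toDB, Tgt.toDB, Tgt.toDB, Tgt.toDB, h2.pi3 hx hA (ihA hA), h.emb hA, h.emb_bind hB,
        h1.primed hA, h1.primed_bind hB]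
      congr 1
      congr 1
      · simp only [shift_eq, DB.rename, rename_rename, ← upRen_comp]
      · simp only [rename_rename]
        congr 1
        have hproj := (h2.bind x).projFlag hB (ihB hB) g
        simp only [Tgt.apps, List.foldl, Tgt.toDB, hproj, relBody, proj_rename, rename_rename,
          ← Src.b1_famL, ← Src.b2_famR, DB.rename]
        -- Placing a family in the scope of the three related variables commutes with weakening by
        -- `x₄` and `x₅`, which are bound outside them.
        have hL (n : ℕ) : upRen (upRen (upRen fun n => ρ n + 1 + 1)) (famL n) =
            famL (upRen (fun n => n + 2) (upRen ρ n)) := by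
          rcases n with _ | n <;> rfl
        have hR (n : ℕ) : upRen (upRen (upRen fun n => ρ n + 1 + 1)) (famR n) =
            famR (upRen (fun n => n + 2) (upRen ρ n)) := by
          rcases n with _ | n <;> rfl
        simp only [hL, hR, ← upRen_comp]
        simp

/-! ## The translation of contexts -/

theorem transCtx_vars (Γ : Ctx) : TrVars (transCtx Γ).names Γ.names (fun n => n) := by
  induction Γ with
  | nil => exact ⟨nofun, nofun, nofun⟩
  | cons p Γ ih =>
    have := ih.bind p.1
    rw [upRen_id, upRen_id, upRen_id] at this
    exact this

theorem InUniverse.flag_eq {Γ : Ctx} {A : Term} {u v : Flag} (h : InUniverse Γ A v)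
    (hA : SrcTyping Γ.toSrc (Judg.ty (A.toSrc Γ.names) u)) : v = u := by
  rcases h with ⟨s, h, rfl⟩ | ⟨f, g, x, D, E, rfl, rfl⟩
  · exact (SrcTyping.ty h.toSrc).flag_unique hA
  · exact hA.ty_pi_flag

/-- The type lies in the universe of its flag by completeness of the named rules, and in no other by
uniqueness of flags; so the case distinction in `projTyRel` agrees with the flag. -/
theorem projTyRel_eq {Γ : Ctx} (hl : GoodNames Γ.names) {A : Term} {u : Flag}
    (hA : SrcTyping Γ.toSrc (Judg.ty (A.toSrc Γ.names) u)) (t : Tgt) :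
    projTyRel Γ A t = projFlag u A t := by
  have h : InUniverse Γ A u := hA.named hl rfl A rfl
  rw [projTyRel]
  cases u with
  | S => rw [if_pos (.inl h)]; rfl
  | P => rw [if_pos (.inr h)]; rfl
  | T =>
    rw [if_neg]
    · rfl
    · rintro (h | h) <;> cases h.flag_eq hA

theorem BCCtx.not_mem {Γ : Ctx} (h : BCCtx Γ) : c ∉ Γ.names := by
  induction Γ with
  | nil => exact List.not_mem_nil
  | cons p Γ ih => exact fun hc => (List.mem_cons.1 hc).elim (fun e => h.2.1 e.symm) (ih h.1)

/-- The translation of a context leaves no choice, since the universe enters only through its flag,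
which is unique. -/
theorem TrCtx.eq_toDB : ∀ {Γ : Ctx} {Δ : List DB}, TrCtx Γ.toSrc Δ → GoodNames Γ.names →
    BCCtx Γ → Δ = (transCtx Γ).toDB := by
  intro Γ
  induction Γ with
  | nil => rintro Δ ⟨⟩ _ _; rfl
  | cons p Γ ih =>
    obtain ⟨x, A⟩ := p
    rintro _ (_ | ⟨hΔ, hA, -⟩) hl ⟨hΓ, -, hbc⟩
    obtain ⟨hx, hl'⟩ : x ∉ Ctx.names Γ ∧ GoodNames (Ctx.names Γ) := GoodNames.tail hl
    obtain rfl := ih hΔ hl' hΓ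
    have hv := transCtx_vars Γ
    obtain ⟨h1, h2⟩ := hv.triple hx hbc (A.transEq hbc) (Srt.flag _)
    have h3 := hv.emb hbc
    simp only [rename_id] at h1 h2 h3
    rw [transCtx, projTyRel_eq hl' (.ty hA), ECtx.toDB, ECtx.toDB, ECtx.toDB]
    simp only [ECtx.names, List.map_cons] at h1 h2 h3 ⊢
    rw [h1, h2, h3, ctx3]

end WeakIsoRel

/-- The abstraction theorem for the weak IsoRel translation of CoC⁻. -/
theorem mainTheorem1 (Γ : WeakIsoRel.Ctx) (a B : WeakIsoRel.Term)
    (ha : WeakIsoRel.BC Γ.names a) (hB : WeakIsoRel.BC Γ.names B) (hΓ : WeakIsoRel.BCCtx Γ)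
    (h : WeakIsoRel.Typing Γ a B) :
    WeakIsoRel.CoqTyping (WeakIsoRel.transCtx Γ) a.emb B.emb ∧
    WeakIsoRel.CoqTyping (WeakIsoRel.transCtx Γ) a.primed B.primed ∧
    WeakIsoRel.CoqTyping (WeakIsoRel.transCtx Γ) (WeakIsoRel.trans a)
      (WeakIsoRel.Tgt.apps (WeakIsoRel.projTyRel Γ B (WeakIsoRel.trans B))
        [a.emb, a.primed]) := by
  open WeakIsoRel in
  -- Distinctness of the declared variables comes from typing, and avoidance of the reserved one
  -- from capture safety.
  have hl : GoodNames Γ.names := ⟨h.nodup, hΓ.not_mem⟩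
  have hs := h.toSrc
  obtain ⟨Δ, hΔ⟩ := TrCtx.exists hs.ctx
  have hv := transCtx_vars Γ
  obtain ⟨u, hu, ht⟩ := hs.tr hΔ
  have h1 := hΔ.e1 hs
  have h2 := hΔ.e2 hs
  have ea := hv.emb ha
  have eB := hv.emb hB
  have pa := hv.primed ha
  have pB := hv.primed hB
  have ta := a.transEq ha _ _ hv
  have tB := hv.projFlag hB (B.transEq hB) u
  simp only [DB.rename_id] at ea eB pa pB ta tB
  -- The context found on the indexed side is the de Bruijn form of the named translation.
  obtain rfl := hΔ.eq_toDB hl hΓ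
  refine ⟨?_, ?_, ?_⟩
  · rwa [CoqTyping, ea, eB]
  · rwa [CoqTyping, pa, pB]
  · rw [projTyRel_eq hl hu, CoqTyping, ta]
    simp only [Tgt.apps, List.foldl, Tgt.toDB, tB, ea, pa]
    exact ht
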